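/- **Setting.** A chain of $g$ loops with bridges is the metric graph $\Gamma$ with vertices $w_0,\dots,w_g$ and $v_1,\dots,v_{g+1}$, where for $1\le k\le g$ the vertices $v_k$ and $w_k$ are joined by a top edge of length $\ell_k>0$ and a bottom edge of length $m_k>0$ (the $k$th loop), and for $0\le k\le g$ a bridge of length $n_k>0$ joins $w_k$ to $v_{k+1}$. Given integers $r,s$ with $g\ge (r+1)s$ and a real number $C$, the edge lengths are called *$C$-admissible* if - $4g\,m_k<\ell_k$ and $C\,\ell_k\le\min\{n_{k-1},n_k\}$ for $1\le k\le g$; - there is no nontrivial relation $c_1m_1+\dots+c_gm_g=0$ with integers $|c_k|\le g+1$; - $C\Big(\sum_{i=\alpha s+1}^{(\alpha+1)s}\ell_i+\sum_{i=\alpha s+1}^{(\alpha+1)s-1}n_i\Big)\le\min\{n_{\alpha s},n_{(\alpha+1)s}\}$ for $0\le\alpha\le r$. $\operatorname{PL}(\Gamma)$ is the set of continuous piecewise linear functions with integral slopes, $\operatorname{div}\psi$ has at each point the sum of the incoming slopes of $\psi$ as coefficient, $D\sim D'$ means $D'=D+\operatorname{div}\psi$ for some $\psi\in\operatorname{PL}(\Gamma)$,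 and rank is Baker–Norine rank. The class of a divisor $D$ of rank $r$ is *vertex avoiding* if for every $0\le i\le r$ there is a unique effective divisor $D_i\sim D$ with exactly $i$ chips at $w_0$ and exactly $r-i$ chips at $v_{g+1}$, and $D_i$ has no chips at $v_1,w_1,\dots,v_g,w_g$. For a multiset $I\subset\{0,\dots,r\}$ of size $m$, let $\psi_I\in\operatorname{PL}(\Gamma)$ be a function (unique up to an additive constant) with $mD+\operatorname{div}\psi_I=\sum_{i\in I}D_i$. Functions $\{\psi_I\}_{I\in\mathcal A}$ are *tropically independent* if there are no real numbers $b_I$ such that the minimum of the $\psi_I(v)+b_I$, $I\in\mathcal A$, occurs at least twice at every point $v\in\Gamma$. For integers $r\ge 3$, $s\ge1$, $\rho\ge0$, $m\ge1$ put $g=(r+1)s+\rho$ and $d=g+r-s$. One says that *the tropical maximal rank conjecture holds for $(r,s,\rho,m)$* if there is a constant $C$, depending only on $(r,s,\rho,m)$, such that on every chain of $g$ loops with $C$-admissible edge lengths there is a divisor $D$ of degree $d$ and rank $r$ whose class is vertex avoiding, and a set $\mathcal A$ of multisets $I\subset\{0,\dots,r\}$ of size $m$, with $$|\mathcal A|=\min\left\{\binom{r+m}{m},\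 md-g+1\right\},$$ such that $\{\psi_I\}_{I\in\mathcal A}$ is tropically independent. The parameters are in the *injective range* if $\binom{r+m}{m}\le md-g+1$ and in the *surjective range* if $\binom{r+m}{m}\ge md-g+1$. **Theorem 1.3.** Let $r\ge3$, $s\ge1$ and $\rho\ge0$ be integers. 1. If $s\ge r^2/4$, then $(r,s,\rho,3)$ is in the injective range and the tropical maximal rank conjecture holds for $(r,s,\rho,3)$. 2. If $\rho=0$ and $r\ge s+1$, then $(r,s,0,3)$ is in the surjective range and the tropical maximal rank conjecture holds for $(r,s,0,3)$. -/

import Mathlib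

open Filter Topology

/-- A metric graph given by a model: vertices `V`, edges `E`, each edge `e` being a segment of
length `len e` that starts at `src e` and ends at `tgt e` (the orientation is only a coordinate). -/
structure MetricGraph (V E : Type) where
  src : E → V
  tgt : E → V
  len : E → ℝ
  len_pos : ∀ e, 0 < len e

namespace MetricGraph

/-- The points of the metric graph: the vertices and the interior points of the edges. -/
inductive Point {V E : Type} (Γ : MetricGraph V E) : Type
  | vertex (x : V) : Point Γ
  | inner (e : E) (t : ℝ) (pos : 0 < t) (lt : t < Γ.len e) : Point Γ

open Classical in
/-- The point at distance `t` from the start of the edge `e`, for `0 ≤ t ≤ len e`. -/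
noncomputable def onEdge {V E : Type} (Γ : MetricGraph V E) (e : E) (t : ℝ) : Γ.Point :=
  if h₀ : 0 < t then
    if h₁ : t < Γ.len e then Point.inner e t h₀ h₁ else Point.vertex (Γ.tgt e)
  else Point.vertex (Γ.src e)

/-- Near the point of `e` at coordinate `t`, in the direction of `tgt e`, the function `f` is
affine with (outgoing) slope `k`. -/
def HasSlopeForward {V E : Type} (Γ : MetricGraph V E) (f : Γ.Point → ℝ) (e : E) (t : ℝ)
    (k : ℤ) : Prop :=
  ∀ᶠ h in 𝓝[>] (0 : ℝ), f (Γ.onEdge e (t + h)) = f (Γ.onEdge e t) + k * h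

/-- Near the point of `e` at coordinate `t`, in the direction of `src e`, the function `f` is
affine with (outgoing) slope `k`. -/
def HasSlopeBackward {V E : Type} (Γ : MetricGraph V E) (f : Γ.Point → ℝ) (e : E) (t : ℝ)
    (k : ℤ) : Prop :=
  ∀ᶠ h in 𝓝[>] (0 : ℝ), f (Γ.onEdge e (t - h)) = f (Γ.onEdge e t) + k * h

/-- `f ∈ PL(Γ)`: continuous and piecewise linear with integral slopes.  Every point, and every
tangent direction at it, has a segment on which `f` is affine with integral slope; since the edges
are compact, finitely many such segments cover each of them, and `f` is continuous. -/
def IsPL {V E : Type} (Γ : MetricGraph V E) (f : Γ.Point → ℝ) : Prop :=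
  ∀ e : E,
    (∀ t : ℝ, 0 ≤ t → t < Γ.len e → ∃ k : ℤ, Γ.HasSlopeForward f e t k) ∧
    (∀ t : ℝ, 0 < t → t ≤ Γ.len e → ∃ k : ℤ, Γ.HasSlopeBackward f e t k)

open Classical in
/-- The outgoing slope of `f` at coordinate `t` of `e` towards `tgt e`. -/
noncomputable def slopeForward {V E : Type} (Γ : MetricGraph V E) (f : Γ.Point → ℝ) (e : E)
    (t : ℝ) : ℤ :=
  if h : ∃ k : ℤ, Γ.HasSlopeForward f e t k then h.choose else 0

open Classical in
/-- The outgoing slope of `f` at coordinate `t` of `e` towards `src e`. -/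
noncomputable def slopeBackward {V E : Type} (Γ : MetricGraph V E) (f : Γ.Point → ℝ) (e : E)
    (t : ℝ) : ℤ :=
  if h : ∃ k : ℤ, Γ.HasSlopeBackward f e t k then h.choose else 0

open Classical in
/-- The coefficient of `div f` at a point: the sum of the incoming slopes of `f`, that is, minus
the sum of the outgoing slopes over all tangent directions. -/
noncomputable def ord {V E : Type} [Fintype E] (Γ : MetricGraph V E) (f : Γ.Point → ℝ) :
    Γ.Point → ℤ
  | Point.vertex x =>
      -∑ e : E, ((if Γ.src e = x then Γ.slopeForward f e 0 else 0) +
        (if Γ.tgt e = x then Γ.slopeBackward f e (Γ.len e) else 0))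
  | Point.inner e t _ _ => -(Γ.slopeForward f e t + Γ.slopeBackward f e t)

/-- Divisors: finite formal integer combinations of points. -/
abbrev Divisor {V E : Type} (Γ : MetricGraph V E) : Type := Γ.Point →₀ ℤ

/-- The degree of a divisor. -/
def deg {V E : Type} {Γ : MetricGraph V E} (D : Γ.Divisor) : ℤ := D.sum fun _ a => a

/-- `f ∈ PL(Γ)` and `D + div f = D'`. -/
def MovesTo {V E : Type} [Fintype E] {Γ : MetricGraph V E} (f : Γ.Point → ℝ)
    (D D' : Γ.Divisor) : Prop :=
  Γ.IsPL f ∧ ∀ p, D' p = D p + Γ.ord f p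

/-- Linear equivalence of divisors. -/
def LinEquiv {V E : Type} [Fintype E] {Γ : MetricGraph V E} (D D' : Γ.Divisor) : Prop :=
  ∃ f : Γ.Point → ℝ, MovesTo f D D'

/-- The Baker–Norine rank of `D` is at least `k`: for every effective divisor `F` of degree `k`,
the divisor `D - F` is linearly equivalent to an effective one. -/
def RankAtLeast {V E : Type} [Fintype E] {Γ : MetricGraph V E} (D : Γ.Divisor) (k : ℕ) : Prop :=
  ∀ F : Γ.Divisor, 0 ≤ F → deg F = k → ∃ D' : Γ.Divisor, 0 ≤ D' ∧ LinEquiv (D - F) D'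

/-- The Baker–Norine rank of `D` is exactly `r`. -/
def HasRank {V E : Type} [Fintype E] {Γ : MetricGraph V E} (D : Γ.Divisor) (r : ℕ) : Prop :=
  RankAtLeast D r ∧ ¬ RankAtLeast D (r + 1)

end MetricGraph

/-- The functions `f i`, `i ∈ A`, are tropically dependent: for some real constants `b i`, the
minimum of the `f i x + b i` occurs at least twice at every point `x`. -/
def TropicallyDependent {X ι : Type} (A : Finset ι) (f : ι → X → ℝ) : Prop :=
  ∃ b : ι → ℝ, ∀ x : X, ∃ i ∈ A, ∃ j ∈ A, i ≠ j ∧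
    f i x + b i = f j x + b j ∧ ∀ k ∈ A, f i x + b i ≤ f k x + b k

/-- Tropical independence. -/
def TropicallyIndependent {X ι : Type} (A : Finset ι) (f : ι → X → ℝ) : Prop :=
  ¬ TropicallyDependent A f

/-- The edge lengths of a chain of `g` loops with bridges: for `1 ≤ k ≤ g` the top and bottom edges
of the `k`th loop have lengths `topLen k` (often written `ℓ_k`) and `botLen k` (often `m_k`), and
for `0 ≤ k ≤ g` the `k`th bridge has length `bridgeLen k` (often `n_k`).  The values at other
indices play no role. -/
structure ChainOfLoops (g : ℕ) where
  topLen : ℕ → ℝ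
  botLen : ℕ → ℝ
  bridgeLen : ℕ → ℝ
  topLen_pos : ∀ k, 1 ≤ k → k ≤ g → 0 < topLen k
  botLen_pos : ∀ k, 1 ≤ k → k ≤ g → 0 < botLen k
  bridgeLen_pos : ∀ k, k ≤ g → 0 < bridgeLen k

namespace ChainOfLoops

/-- The `2g + 2` vertices: `Sum.inl k` is `w_k` (`0 ≤ k ≤ g`) and `Sum.inr k` is `v_{k+1}`
(`0 ≤ k ≤ g`). -/
abbrev Vertex (g : ℕ) : Type := Fin (g + 1) ⊕ Fin (g + 1)

/-- The edges: the top edges of the loops, the bottom edges of the loops (the `k : Fin g` standing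
for the loop number `k + 1`), and the bridges (the `k : Fin (g + 1)` standing for bridge
number `k`). -/
abbrev Edge (g : ℕ) : Type := Fin g ⊕ Fin g ⊕ Fin (g + 1)

/-- The metric graph: the two edges of the `k`th loop join `v_k` to `w_k` (`1 ≤ k ≤ g`), and the
`k`th bridge joins `w_k` to `v_{k+1}` (`0 ≤ k ≤ g`). -/
def graph {g : ℕ} (Γ : ChainOfLoops g) : MetricGraph (Vertex g) (Edge g) where
  src
    | Sum.inl k => Sum.inr k.castSucc
    | Sum.inr (Sum.inl k) => Sum.inr k.castSucc
    | Sum.inr (Sum.inr k) => Sum.inl k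
  tgt
    | Sum.inl k => Sum.inl k.succ
    | Sum.inr (Sum.inl k) => Sum.inl k.succ
    | Sum.inr (Sum.inr k) => Sum.inr k
  len
    | Sum.inl k => Γ.topLen (k + 1)
    | Sum.inr (Sum.inl k) => Γ.botLen (k + 1)
    | Sum.inr (Sum.inr k) => Γ.bridgeLen k
  len_pos
    | Sum.inl k => Γ.topLen_pos _ (Nat.le_add_left _ _) k.isLt
    | Sum.inr (Sum.inl k) => Γ.botLen_pos _ (Nat.le_add_left _ _) k.isLt
    | Sum.inr (Sum.inr k) => Γ.bridgeLen_pos _ (Nat.lt_succ_iff.mp k.isLt)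

/-- The point `w_k`, for `0 ≤ k ≤ g`. -/
def wPoint {g : ℕ} (Γ : ChainOfLoops g) (k : Fin (g + 1)) : Γ.graph.Point :=
  MetricGraph.Point.vertex (Sum.inl k)

/-- The point `v_{k+1}`, for `0 ≤ k ≤ g`. -/
def vSuccPoint {g : ℕ} (Γ : ChainOfLoops g) (k : Fin (g + 1)) : Γ.graph.Point :=
  MetricGraph.Point.vertex (Sum.inr k)

/-- Admissible edge lengths, for the decomposition of the first `(r + 1) s` loops into `r + 1`
blocks of `s` loops.  The relation `a ≪ b` is made precise as `C * a ≤ b`. -/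
structure Admissible {g : ℕ} (Γ : ChainOfLoops g) (r s : ℕ) (C : ℝ) : Prop where
  bot_lt_top : ∀ k, 1 ≤ k → k ≤ g → 4 * g * Γ.botLen k < Γ.topLen k
  top_ll_bridge : ∀ k, 1 ≤ k → k ≤ g →
    C * Γ.topLen k ≤ min (Γ.bridgeLen (k - 1)) (Γ.bridgeLen k)
  no_relation : ∀ c : ℕ → ℤ, (∀ k, |c k| ≤ g + 1) →
    ∑ k ∈ Finset.Icc 1 g, (c k : ℝ) * Γ.botLen k = 0 → ∀ k ∈ Finset.Icc 1 g, c k = 0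
  block_ll_bridge : ∀ α, α ≤ r →
    C * (∑ i ∈ Finset.Icc (α * s + 1) ((α + 1) * s), Γ.topLen i +
        ∑ i ∈ Finset.Icc (α * s + 1) ((α + 1) * s - 1), Γ.bridgeLen i) ≤
      min (Γ.bridgeLen (α * s)) (Γ.bridgeLen ((α + 1) * s))

/-- `D'` is an effective divisor linearly equivalent to `D` with exactly `i` chips at the left end
`w_0` and exactly `r - i` chips at the right end `v_{g+1}`. -/
def IsEndDivisor {g : ℕ} (Γ : ChainOfLoops g) (r : ℕ) (D : Γ.graph.Divisor) (i : Fin (r + 1))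
    (D' : Γ.graph.Divisor) : Prop :=
  0 ≤ D' ∧ MetricGraph.LinEquiv D D' ∧
    D' (Γ.wPoint 0) = (i : ℕ) ∧ D' (Γ.vSuccPoint (Fin.last g)) = (r : ℤ) - (i : ℕ)

/-- The class of `D` (of rank `r`) is vertex avoiding: for each `0 ≤ i ≤ r` there is a unique
effective divisor `D_i ∼ D` with `i` chips at `w_0` and `r - i` chips at `v_{g+1}`, and `D_i` has
no chip at any of the vertices `v_1, w_1, …, v_g, w_g` of the loops. -/
def VertexAvoiding {g : ℕ} (Γ : ChainOfLoops g) (r : ℕ) (D : Γ.graph.Divisor) : Prop :=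
  ∀ i : Fin (r + 1), ∃ D' : Γ.graph.Divisor, Γ.IsEndDivisor r D i D' ∧
    (∀ D'' : Γ.graph.Divisor, Γ.IsEndDivisor r D i D'' → D'' = D') ∧
    ∀ k : Fin g, D' (Γ.vSuccPoint k.castSucc) = 0 ∧ D' (Γ.wPoint k.succ) = 0

end ChainOfLoops

/-- The genus `g` determined by `s = g - d + r` and `ρ = g - (r + 1)(g - d + r)`. -/
def genusOf (r s ρ : ℕ) : ℕ := (r + 1) * s + ρ

/-- The degree `d = g + r - s`. -/
def degreeOf (r s ρ : ℕ) : ℤ := (genusOf r s ρ : ℤ) + r - s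

/-- The injective range: `binom (r + m) m ≤ m d - g + 1`. -/
def InjectiveRange (r s ρ m : ℕ) : Prop :=
  ((r + m).choose m : ℤ) ≤ m * degreeOf r s ρ - genusOf r s ρ + 1

/-- The surjective range: `binom (r + m) m ≥ m d - g + 1`. -/
def SurjectiveRange (r s ρ m : ℕ) : Prop :=
  (m * degreeOf r s ρ - genusOf r s ρ + 1 : ℤ) ≤ (r + m).choose m

/-- The assertion of the tropical maximal rank conjecture for the parameters `(r, s, ρ, m)`.  On
every chain of `g` loops with admissible edge lengths (with a constant `C` in `≪` that depends on
the parameters only) there is a divisor `D` of degree `d` and rank `r` with vertex avoiding class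
such that, with `D_i` the corresponding divisors and `ψ_I` functions with
`m D + div ψ_I = ∑_{i ∈ I} D_i` for the multisets `I ⊂ {0, …, r}` of size `m`, some
`min {binom (r + m) m, m d - g + 1}` of the `ψ_I` are tropically independent. -/
def TropicalMaximalRank (r s ρ m : ℕ) : Prop :=
  ∃ C : ℝ, ∀ Γ : ChainOfLoops (genusOf r s ρ), Γ.Admissible r s C →
    ∃ D : Γ.graph.Divisor,
      MetricGraph.deg D = degreeOf r s ρ ∧ MetricGraph.HasRank D r ∧ Γ.VertexAvoiding r D ∧
      ∃ (Di : Fin (r + 1) → Γ.graph.Divisor) (ψ : Sym (Fin (r + 1)) m → Γ.graph.Point → ℝ),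
        (∀ i, Γ.IsEndDivisor r D i (Di i)) ∧
        (∀ I, MetricGraph.MovesTo (ψ I) (m • D) ((I : Multiset (Fin (r + 1))).map Di).sum) ∧
        ∃ A : Finset (Sym (Fin (r + 1)) m),
          (A.card : ℤ) =
            min ((r + m).choose m : ℤ) (m * degreeOf r s ρ - genusOf r s ρ + 1) ∧
          TropicallyIndependent A ψ

/-! The divisor class is built from a lattice path. On every bridge `k` there are integers `p k 0 >
... > p k r`, the slopes of the functions that carry a base divisor to the end divisors `D_0, ...,
D_r`; at the loop after the bridge `k`, at most one of them, the one equal to a special value `P k`,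
increases by one. The class has degree one on each loop, and small multiples of a bottom length are
never multiples of the circumference of the loop. Hence a slope can increase at a loop only without
chips and only from the value `P k`. This rigidity squeezes the slopes of any effective
representative between bounds read off at the two ends; it yields vertex avoidance and the upper
bound for the rank. The lower bound for the rank follows by changing from one slope of the path to
the next at each chip that has to be subtracted. The path used (`blockSlope`) lets the slope `i`
increase at each of the `s` loops of the block `i`.

Suppose now that functions of triples `i ≤ j ≤ k` are dependent. On the very long bridge before a
block `α`, triples of median less than `α` are steeper than the others, so they can compete only
before the block, and the others only after that bridge. A discrete intermediate value argument
(`exists_block`, `exists_minimalBlock`) produces a block `α` on which all functions attaining the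
minimum have median `α`. On it the slope of `(i, α, k)` grows by one, two or three per loop,
according to how often `α` occurs in the triple, and two functions must share the minimum on each
bridge and at the middle of the top edge of each loop.

In the surjective range the triples are chosen so that this is impossible for slope reasons alone.
If `α > s`, the slopes on the last bridge of the block are distinct. If `α ≤ s`, ties on the bridges
`α - 1` and `α` force the common slope to jump by three at the loop between them, and only `(α, α,
α)` can follow such a jump.

In the injective range all triples are taken. Triples `i < α < k` with the same sum `c = i + k` are
parallel on all bridges of the block, and their relative values at the middle of a top edge are
shifted by `-i * q`, where `q` is the bottom length. Ties are thus breakpoints of the minimum of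
affine functions `B i - i * m`, located at `m = 0` for bridges and at the distinct numbers `q` for
loops, so their number is less than the size of the group. Summing over `c` the bridges in the
middle of the block, with a loss of at most one caused by `(α, α, α)`, gives `s < α * (r - α) ≤ r ^
2 / 4`, a contradiction. -/

namespace MetricGraph

variable {V E : Type} {Γ : MetricGraph V E}

/-! ### Piecewise linear functions and their divisors, edge by edge -/

theorem onEdge_zero (e : E) : Γ.onEdge e 0 = Point.vertex (Γ.src e) := by
  simp [onEdge]

theorem onEdge_len (e : E) : Γ.onEdge e (Γ.len e) = Point.vertex (Γ.tgt e) := by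
  simp [onEdge, Γ.len_pos e]

theorem onEdge_inner (e : E) (t : ℝ) (h0 : 0 < t) (h1 : t < Γ.len e) :
    Γ.onEdge e t = Point.inner e t h0 h1 := by
  simp [onEdge, h0, h1]

/-- The function `φ` is affine of slope `k` immediately to the right of `t`. -/
def SlopeRight (φ : ℝ → ℝ) (t : ℝ) (k : ℤ) : Prop :=
  ∀ᶠ h in 𝓝[>] (0 : ℝ), φ (t + h) = φ t + k * h

/-- The function `φ` is affine of outgoing slope `k` immediately to the left of `t`. -/
def SlopeLeft (φ : ℝ → ℝ) (t : ℝ) (k : ℤ) : Prop :=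
  ∀ᶠ h in 𝓝[>] (0 : ℝ), φ (t - h) = φ t + k * h

theorem eventually_small {ε : ℝ} (hε : 0 < ε) : ∀ᶠ h in 𝓝[>] (0 : ℝ), 0 < h ∧ h < ε := by
  filter_upwards [Ioo_mem_nhdsGT hε] with h hh using hh

theorem eq_of_eventually_mul_eq {a b : ℝ} (h : ∀ᶠ x in 𝓝[>] (0 : ℝ), a * x = b * x) : a = b := by
  obtain ⟨x, hx, h0, -⟩ := (h.and (eventually_small one_pos)).exists
  exact mul_right_cancel₀ h0.ne' hx

theorem SlopeLeft.unique {φ : ℝ → ℝ} {t : ℝ} {k l : ℤ} (hk : SlopeLeft φ t k)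
    (hl : SlopeLeft φ t l) : k = l := by
  have : (k : ℝ) = l := eq_of_eventually_mul_eq (by
    filter_upwards [hk, hl] with h h1 h2
    linarith)
  exact_mod_cast this

theorem slopeForward_eq {f : Γ.Point → ℝ} {e : E} {t : ℝ} {k : ℤ}
    (h : Γ.HasSlopeForward f e t k) : Γ.slopeForward f e t = k := by
  have hex : ∃ k : ℤ, Γ.HasSlopeForward f e t k := ⟨k, h⟩
  have h2 := hex.choose_spec
  rw [slopeForward, dif_pos hex]
  have : ((hex.choose : ℤ) : ℝ) = k := eq_of_eventually_mul_eq (by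
    filter_upwards [h, h2] with x h1 h2
    linarith)
  exact_mod_cast this

theorem slopeBackward_eq {f : Γ.Point → ℝ} {e : E} {t : ℝ} {k : ℤ}
    (h : Γ.HasSlopeBackward f e t k) : Γ.slopeBackward f e t = k := by
  have hex : ∃ k : ℤ, Γ.HasSlopeBackward f e t k := ⟨k, h⟩
  have h2 := hex.choose_spec
  rw [slopeBackward, dif_pos hex]
  have : ((hex.choose : ℤ) : ℝ) = k := eq_of_eventually_mul_eq (by
    filter_upwards [h, h2] with x h1 h2
    linarith)
  exact_mod_cast this

theorem hasSlopeForward_iff {f : Γ.Point → ℝ} {e : E} {φ : ℝ → ℝ}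
    (hφ : ∀ t, 0 ≤ t → t ≤ Γ.len e → f (Γ.onEdge e t) = φ t) {t : ℝ} (h0 : 0 ≤ t)
    (h1 : t < Γ.len e) {k : ℤ} : Γ.HasSlopeForward f e t k ↔ SlopeRight φ t k := by
  have hs := eventually_small (sub_pos.2 h1)
  constructor
  · intro h
    filter_upwards [h, hs] with x hx hx2
    rw [← hφ _ (by linarith) (by linarith), ← hφ _ h0 h1.le, hx]
  · intro h
    filter_upwards [h, hs] with x hx hx2
    rw [hφ _ (by linarith) (by linarith), hφ _ h0 h1.le, hx]

theorem hasSlopeBackward_iff {f : Γ.Point → ℝ} {e : E} {φ : ℝ → ℝ}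
    (hφ : ∀ t, 0 ≤ t → t ≤ Γ.len e → f (Γ.onEdge e t) = φ t) {t : ℝ} (h0 : 0 < t)
    (h1 : t ≤ Γ.len e) {k : ℤ} : Γ.HasSlopeBackward f e t k ↔ SlopeLeft φ t k := by
  have hs := eventually_small h0
  constructor
  · intro h
    filter_upwards [h, hs] with x hx hx2
    rw [← hφ _ (by linarith) (by linarith), ← hφ _ h0.le h1, hx]
  · intro h
    filter_upwards [h, hs] with x hx hx2
    rw [hφ _ (by linarith) (by linarith), hφ _ h0.le h1, hx]

theorem SlopeRight.add {φ χ : ℝ → ℝ} {t : ℝ} {k l : ℤ} (hk : SlopeRight φ t k)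
    (hl : SlopeRight χ t l) : SlopeRight (fun x => φ x + χ x) t (k + l) := by
  filter_upwards [hk, hl] with h h1 h2
  rw [h1, h2]; push_cast; ring

theorem SlopeLeft.add {φ χ : ℝ → ℝ} {t : ℝ} {k l : ℤ} (hk : SlopeLeft φ t k)
    (hl : SlopeLeft χ t l) : SlopeLeft (fun x => φ x + χ x) t (k + l) := by
  filter_upwards [hk, hl] with h h1 h2
  rw [h1, h2]; push_cast; ring

theorem slopeRight_affine (b : ℝ) (k : ℤ) (t : ℝ) : SlopeRight (fun x => b + k * x) t k :=
  Eventually.of_forall fun h => by ring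

theorem slopeLeft_affine (b : ℝ) (k : ℤ) (t : ℝ) : SlopeLeft (fun x => b + k * x) t (-k) :=
  Eventually.of_forall fun h => by push_cast; ring

open Classical in
/-- The multiplicity one of an interior point of the edge `e`. -/
noncomputable def onWeight (e : E) : Γ.Point → ℤ
  | Point.vertex _ => 0
  | Point.inner e' _ _ _ => if e' = e then 1 else 0

open Classical in
/-- The hinge function of an interior point of the edge `e`. -/
noncomputable def hingeWeight (e : E) (t : ℝ) : Γ.Point → ℝ
  | Point.vertex _ => 0
  | Point.inner e' a _ _ => if e' = e then max 0 (t - a) else 0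

open Classical in
/-- Indicator of the interior points of `e` with coordinate at most `t`. -/
noncomputable def leWeight (e : E) (t : ℝ) : Γ.Point → ℤ
  | Point.vertex _ => 0
  | Point.inner e' a _ _ => if e' = e ∧ a ≤ t then 1 else 0

open Classical in
/-- Indicator of the interior points of `e` with coordinate less than `t`. -/
noncomputable def ltWeight (e : E) (t : ℝ) : Γ.Point → ℤ
  | Point.vertex _ => 0
  | Point.inner e' a _ _ => if e' = e ∧ a < t then 1 else 0

/-- The degree of the restriction of a divisor to the interior of `e`. -/
noncomputable def degOn (D : Γ.Divisor) (e : E) : ℤ := D.sum fun p c => c * onWeight e p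

/-- The sum of the hinge functions of the chips in the interior of `e`. -/
noncomputable def hinge (D : Γ.Divisor) (e : E) (t : ℝ) : ℝ :=
  D.sum fun p c => c * hingeWeight e t p

theorem degOn_add (D D' : Γ.Divisor) (e : E) : degOn (D + D') e = degOn D e + degOn D' e :=
  Finsupp.sum_add_index' (by simp) (by intros; ring)

theorem hinge_add (D D' : Γ.Divisor) (e : E) (t : ℝ) :
    hinge (D + D') e t = hinge D e t + hinge D' e t :=
  Finsupp.sum_add_index' (by simp) (by intros; push_cast; ring)

theorem degOn_zero (e : E) : degOn (0 : Γ.Divisor) e = 0 := Finsupp.sum_zero_index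

theorem hinge_zero (e : E) (t : ℝ) : hinge (0 : Γ.Divisor) e t = 0 := Finsupp.sum_zero_index

theorem degOn_neg (D : Γ.Divisor) (e : E) : degOn (-D) e = -degOn D e := by
  have := degOn_add D (-D) e
  rw [add_neg_cancel, degOn_zero] at this
  linarith

theorem hinge_neg (D : Γ.Divisor) (e : E) (t : ℝ) : hinge (-D) e t = -hinge D e t := by
  have := hinge_add D (-D) e t
  rw [add_neg_cancel, hinge_zero] at this
  linarith

theorem degOn_sub (D D' : Γ.Divisor) (e : E) : degOn (D - D') e = degOn D e - degOn D' e := by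
  rw [sub_eq_add_neg, degOn_add, degOn_neg]; ring

theorem hinge_sub (D D' : Γ.Divisor) (e : E) (t : ℝ) :
    hinge (D - D') e t = hinge D e t - hinge D' e t := by
  rw [sub_eq_add_neg, hinge_add, hinge_neg]; ring

theorem degOn_sum {ι : Type*} (A : Finset ι) (D : ι → Γ.Divisor) (e : E) :
    degOn (∑ i ∈ A, D i) e = ∑ i ∈ A, degOn (D i) e := by
  classical
  induction A using Finset.induction_on with
  | empty => simp [degOn_zero]
  | insert a s ha ih => rw [Finset.sum_insert ha, Finset.sum_insert ha, degOn_add, ih]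

theorem hinge_sum {ι : Type*} (A : Finset ι) (D : ι → Γ.Divisor) (e : E) (t : ℝ) :
    hinge (∑ i ∈ A, D i) e t = ∑ i ∈ A, hinge (D i) e t := by
  classical
  induction A using Finset.induction_on with
  | empty => simp [hinge_zero]
  | insert a s ha ih => rw [Finset.sum_insert ha, Finset.sum_insert ha, hinge_add, ih]

theorem degOn_single (p : Γ.Point) (c : ℤ) (e : E) :
    degOn (Finsupp.single p c) e = c * onWeight e p := by
  simp [degOn]

theorem hinge_single (p : Γ.Point) (c : ℤ) (e : E) (t : ℝ) :
    hinge (Finsupp.single p c) e t = c * hingeWeight e t p := by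
  simp [hinge]

theorem degOn_nonneg {D : Γ.Divisor} (hD : 0 ≤ D) (e : E) : 0 ≤ degOn D e := by
  refine Finset.sum_nonneg fun p _ => mul_nonneg (hD p) ?_
  cases p <;> simp only [onWeight]
  · exact le_rfl
  · split_ifs <;> simp

/-- A chip at `a` contributes the slope one to the right of `t` as soon as `a ≤ t`, whereas to the
left of `t` it contributes only if `a < t`. The two weights differ exactly by the chips at `t`,
which therefore become the kinks. -/
theorem slopeRight_hinge (D : Γ.Divisor) (e : E) (t : ℝ) :
    SlopeRight (hinge D e) t (D.sum fun p c => c * leWeight e t p) := by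
  have h : ∀ p ∈ D.support, ∀ᶠ h in 𝓝[>] (0 : ℝ),
      hingeWeight e (t + h) p = hingeWeight e t p + leWeight e t p * h := by
    intro p _
    cases p with
    | vertex x => exact Eventually.of_forall fun h => by simp [hingeWeight, leWeight]
    | inner e' a h0 h1 =>
      by_cases he : e' = e
      · by_cases ha : a ≤ t
        · filter_upwards [eventually_small one_pos] with h hh
          simp only [hingeWeight, leWeight, he, ha, and_self, if_true]
          rw [max_eq_right (by linarith), max_eq_right (by linarith)]; push_cast; ring
        · filter_upwards [eventually_small (sub_pos.2 (not_le.1 ha))] with h hh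
          simp only [hingeWeight, leWeight, he, ha, and_false, if_true, if_false]
          rw [max_eq_left (by linarith), max_eq_left (by linarith)]; simp
      · exact Eventually.of_forall fun h => by simp [hingeWeight, leWeight, he]
  filter_upwards [(Filter.eventually_all_finset _).2 h] with x hx
  simp only [hinge, Finsupp.sum]
  push_cast
  rw [Finset.sum_mul, ← Finset.sum_add_distrib]
  refine Finset.sum_congr rfl fun p hp => ?_
  rw [hx p hp]; ring

theorem slopeLeft_hinge (D : Γ.Divisor) (e : E) (t : ℝ) :
    SlopeLeft (hinge D e) t (-(D.sum fun p c => c * ltWeight e t p)) := by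
  have h : ∀ p ∈ D.support, ∀ᶠ h in 𝓝[>] (0 : ℝ),
      hingeWeight e (t - h) p = hingeWeight e t p - ltWeight e t p * h := by
    intro p _
    cases p with
    | vertex x => exact Eventually.of_forall fun h => by simp [hingeWeight, ltWeight]
    | inner e' a h0 h1 =>
      by_cases he : e' = e
      · by_cases ha : a < t
        · filter_upwards [eventually_small (sub_pos.2 ha)] with h hh
          simp only [hingeWeight, ltWeight, he, ha, and_self, if_true]
          rw [max_eq_right (by linarith), max_eq_right (by linarith)]; push_cast; ring
        · filter_upwards [eventually_small one_pos] with h hh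
          simp only [hingeWeight, ltWeight, he, ha, and_false, if_true, if_false]
          rw [max_eq_left (by linarith), max_eq_left (by linarith)]; simp
      · exact Eventually.of_forall fun h => by simp [hingeWeight, ltWeight, he]
  filter_upwards [(Filter.eventually_all_finset _).2 h] with x hx
  simp only [hinge, Finsupp.sum]
  push_cast
  rw [neg_mul, Finset.sum_mul, ← sub_eq_add_neg, ← Finset.sum_sub_distrib]
  refine Finset.sum_congr rfl fun p hp => ?_
  rw [hx p hp]; ring

theorem sum_leWeight_sub_ltWeight (D : Γ.Divisor) (e : E) (t : ℝ) (h0 : 0 < t)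
    (h1 : t < Γ.len e) :
    (D.sum fun p c => c * leWeight e t p) - (D.sum fun p c => c * ltWeight e t p) =
      D (Point.inner e t h0 h1) := by
  classical
  simp only [Finsupp.sum]
  rw [← Finset.sum_sub_distrib]
  rw [Finset.sum_eq_single (Point.inner e t h0 h1)]
  · simp [leWeight, ltWeight]
  · intro p _ hp
    cases p with
    | vertex x => simp [leWeight, ltWeight]
    | inner e' a g0 g1 =>
      by_cases he : e' = e
      · subst he
        have : a ≠ t := by
          rintro rfl; exact hp rfl
        have h3 : a ≤ t ↔ a < t := ⟨fun h => lt_of_le_of_ne h this, le_of_lt⟩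
        simp [leWeight, ltWeight, h3]
      · simp [leWeight, ltWeight, he]
  · intro h
    rw [Finsupp.notMem_support_iff.1 h]; simp

theorem sum_leWeight_zero (D : Γ.Divisor) (e : E) :
    (D.sum fun p c => c * leWeight e 0 p) = 0 := by
  refine Finset.sum_eq_zero fun p _ => ?_
  cases p with
  | vertex x => simp [leWeight]
  | inner e' a g0 g1 => simp [leWeight, g0]

theorem sum_ltWeight_len (D : Γ.Divisor) (e : E) :
    (D.sum fun p c => c * ltWeight e (Γ.len e) p) = degOn D e := by
  refine Finset.sum_congr rfl fun p _ => ?_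
  cases p with
  | vertex x => simp [ltWeight, onWeight]
  | inner e' a g0 g1 =>
    by_cases he : e' = e
    · subst he; simp [ltWeight, onWeight, g1]
    · simp [ltWeight, onWeight, he]

theorem hinge_at_zero (D : Γ.Divisor) (e : E) : hinge D e 0 = 0 := by
  refine Finset.sum_eq_zero fun p _ => ?_
  cases p with
  | vertex x => simp [hingeWeight]
  | inner e' a g0 g1 => simp [hingeWeight, max_eq_left (by linarith : -a ≤ 0)]

/-- The function with the prescribed values at the vertices and on the edges. -/
def ofEdges (val : V → ℝ) (φ : E → ℝ → ℝ) : Γ.Point → ℝ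
  | Point.vertex x => val x
  | Point.inner e t _ _ => φ e t

theorem ofEdges_onEdge {val : V → ℝ} {φ : E → ℝ → ℝ} {e : E} (h0 : φ e 0 = val (Γ.src e))
    (h1 : φ e (Γ.len e) = val (Γ.tgt e)) (t : ℝ) (ht0 : 0 ≤ t) (ht1 : t ≤ Γ.len e) :
    ofEdges val φ (Γ.onEdge e t) = φ e t := by
  rcases ht0.eq_or_lt with rfl | ht0
  · rw [onEdge_zero, ofEdges, h0]
  rcases ht1.eq_or_lt with rfl | ht1
  · rw [onEdge_len, ofEdges, h1]
  · rw [onEdge_inner _ _ ht0 ht1, ofEdges]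

variable [Fintype E]

/-- A piecewise linear function with prescribed divisor. -/
theorem exists_ord_eq [DecidableEq V] (D : Γ.Divisor) (κ : E → ℤ) (val : V → ℝ)
    (hE : ∀ e, val (Γ.tgt e) = val (Γ.src e) + κ e * Γ.len e - hinge D e (Γ.len e))
    (hV : ∀ x, D (Point.vertex x) = ∑ e, ((if Γ.tgt e = x then κ e - degOn D e else 0) -
      (if Γ.src e = x then κ e else 0))) :
    ∃ f : Γ.Point → ℝ, Γ.IsPL f ∧ (∀ p, Γ.ord f p = D p) ∧ (∀ x, f (Point.vertex x) = val x) ∧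
      ∀ e t, 0 ≤ t → t ≤ Γ.len e →
        f (Γ.onEdge e t) = val (Γ.src e) + κ e * t - hinge D e t := by
  set φ : E → ℝ → ℝ := fun e t => val (Γ.src e) + κ e * t - hinge D e t with hφ
  have hf : ∀ e t, 0 ≤ t → t ≤ Γ.len e → ofEdges val φ (Γ.onEdge e t) = φ e t := by
    intro e
    exact ofEdges_onEdge (by simp [hφ, hinge_at_zero]) (by simp [hφ, hE])
  have hR : ∀ e t, SlopeRight (φ e) t (κ e - D.sum fun p c => c * leWeight e t p) := by
    intro e t
    filter_upwards [slopeRight_hinge D e t] with h hh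
    simp only [hφ]
    rw [hh]; push_cast; ring
  have hL : ∀ e t, SlopeLeft (φ e) t (-κ e + D.sum fun p c => c * ltWeight e t p) := by
    intro e t
    filter_upwards [slopeLeft_hinge D e t] with h hh
    simp only [hφ]
    rw [hh]; push_cast; ring
  have hF : ∀ e t, 0 ≤ t → t < Γ.len e → Γ.HasSlopeForward (ofEdges val φ) e t
      (κ e - D.sum fun p c => c * leWeight e t p) :=
    fun e t h0 h1 => (hasSlopeForward_iff (hf e) h0 h1).2 (hR e t)
  have hB : ∀ e t, 0 < t → t ≤ Γ.len e → Γ.HasSlopeBackward (ofEdges val φ) e t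
      (-κ e + D.sum fun p c => c * ltWeight e t p) :=
    fun e t h0 h1 => (hasSlopeBackward_iff (hf e) h0 h1).2 (hL e t)
  refine ⟨ofEdges val φ, fun e => ⟨fun t h0 h1 => ⟨_, hF e t h0 h1⟩,
    fun t h0 h1 => ⟨_, hB e t h0 h1⟩⟩, ?_, fun x => rfl, hf⟩
  intro p
  cases p with
  | vertex x =>
    rw [ord, hV, ← Finset.sum_neg_distrib]
    refine Finset.sum_congr rfl fun e _ => ?_
    rw [slopeForward_eq (hF e 0 le_rfl (Γ.len_pos e)),
      slopeBackward_eq (hB e _ (Γ.len_pos e) le_rfl), sum_leWeight_zero, sum_ltWeight_len]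
    split_ifs <;> ring
  | inner e t h0 h1 =>
    rw [ord, slopeForward_eq (hF e t h0.le h1), slopeBackward_eq (hB e t h0 h1.le),
      ← sum_leWeight_sub_ltWeight]
    ring

/-- A function that is locally affine without kinks and starts flat is constant. -/
theorem eq_zero_of_slopes {δ : ℝ → ℝ} {b : ℝ} (h0 : δ 0 = 0) (hr0 : SlopeRight δ 0 0)
    (hk : ∀ t, 0 < t → t < b → ∃ k : ℤ, SlopeRight δ t k ∧ SlopeLeft δ t (-k))
    (hl : ∃ k, SlopeLeft δ b k) : ∀ t, 0 ≤ t → t ≤ b → δ t = 0 := by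
  by_contra! hcon
  obtain ⟨t₁, ht0, ht1, hne⟩ := hcon
  -- The infimum of the points where `δ` does not vanish: `δ` vanishes there by its left slope,
  -- hence has right slope zero there and vanishes a little further.
  set Z : Set ℝ := {t | 0 ≤ t ∧ t ≤ b ∧ δ t ≠ 0} with hZ
  have hZne : Z.Nonempty := ⟨t₁, ht0, ht1, hne⟩
  have hZb : BddBelow Z := ⟨0, fun t ht => ht.1⟩
  set x := sInf Z with hx
  have hx0 : 0 ≤ x := le_csInf hZne fun t ht => ht.1
  have hxt : x ≤ t₁ := csInf_le hZb ⟨ht0, ht1, hne⟩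
  have hlow : ∀ t, 0 ≤ t → t < x → δ t = 0 := by
    intro t h0 h1
    by_contra h
    exact absurd (csInf_le hZb ⟨h0, by linarith, h⟩) (not_le.2 h1)
  have hleft : ∀ k, 0 < x → SlopeLeft δ x k → δ x = 0 ∧ k = 0 := by
    intro k hx0 hk
    obtain ⟨c, hc, hc'⟩ : ∃ c, 0 < c ∧ ∀ h, 0 < h → h < c → δ (x - h) = δ x + k * h := by
      obtain ⟨c, hc, hsub⟩ := mem_nhdsGT_iff_exists_Ioo_subset.1 hk
      exact ⟨c, hc, fun h h1 h2 => hsub ⟨h1, h2⟩⟩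
    set d := min c x
    have hd : 0 < d := lt_min hc hx0
    have hd1 : d ≤ c := min_le_left _ _
    have hd2 : d ≤ x := min_le_right _ _
    -- Two sample points to the left determine both the value and the slope of the affine germ.
    have e1 := hc' (d / 2) (by linarith) (by linarith)
    have e2 := hc' (d / 3) (by linarith) (by linarith)
    rw [hlow _ (by linarith) (by linarith)] at e1 e2
    have : (k : ℝ) * d = 0 := by linarith
    have hk0 : (k : ℝ) = 0 := by
      rcases mul_eq_zero.1 this with h | h
      · exact h
      · exact absurd h hd.ne'
    rw [hk0] at e1
    exact ⟨by linarith, by exact_mod_cast hk0⟩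
  have hδx : δ x = 0 := by
    rcases hx0.eq_or_lt with h | h
    · rw [← h, h0]
    · rcases (hxt.trans ht1).eq_or_lt with h2 | h2
      · obtain ⟨k, hk⟩ := hl
        exact (hleft k h (h2 ▸ hk)).1
      · obtain ⟨k, -, hk⟩ := hk x h h2
        exact (hleft _ h hk).1
  have hxlt : x < b := by
    rcases (hxt.trans ht1).eq_or_lt with h2 | h2
    · exfalso
      have : t₁ = x := le_antisymm (h2 ▸ ht1) hxt
      exact hne (this ▸ hδx)
    · exact h2
  have hright : SlopeRight δ x 0 := by
    rcases hx0.eq_or_lt with h | h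
    · rw [← h]; exact hr0
    · obtain ⟨k, hk1, hk2⟩ := hk x h hxlt
      have := (hleft _ h hk2).2
      have hk0 : k = 0 := by omega
      rwa [hk0] at hk1
  obtain ⟨c, hc, hc'⟩ : ∃ c, 0 < c ∧ ∀ h, 0 < h → h < c → δ (x + h) = 0 := by
    obtain ⟨c, hc, hsub⟩ := mem_nhdsGT_iff_exists_Ioo_subset.1 hright
    refine ⟨c, hc, fun h h1 h2 => ?_⟩
    have := hsub ⟨h1, h2⟩
    simp only [Set.mem_ofPred_eq, hδx] at this
    simpa using this
  obtain ⟨z, hz, hzlt⟩ := exists_lt_of_csInf_lt hZne (show sInf Z < x + c by linarith)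
  have hxz : x ≤ z := csInf_le hZb hz
  rcases hxz.eq_or_lt with h | h
  · exact hz.2.2 (h ▸ hδx)
  · apply hz.2.2
    have := hc' (z - x) (by linarith) (by linarith)
    rwa [add_sub_cancel] at this

/-- The divisor of a piecewise linear function determines it up to the slopes at the starts of the
edges, and satisfies the corresponding balancing conditions. -/
theorem balance_of_ord_eq [DecidableEq V] {f : Γ.Point → ℝ} {D : Γ.Divisor} (hf : Γ.IsPL f)
    (hD : ∀ p, Γ.ord f p = D p) :
    (∀ e, f (Point.vertex (Γ.tgt e)) = f (Point.vertex (Γ.src e)) +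
        Γ.slopeForward f e 0 * Γ.len e - hinge D e (Γ.len e)) ∧
    (∀ x, D (Point.vertex x) = ∑ e, ((if Γ.tgt e = x then Γ.slopeForward f e 0 - degOn D e else 0) -
      (if Γ.src e = x then Γ.slopeForward f e 0 else 0))) := by
  have hspecF : ∀ e t, 0 ≤ t → t < Γ.len e →
      Γ.HasSlopeForward f e t (Γ.slopeForward f e t) := by
    intro e t h0 h1
    obtain ⟨k, hk⟩ := (hf e).1 t h0 h1
    rwa [slopeForward_eq hk]
  have hspecB : ∀ e t, 0 < t → t ≤ Γ.len e →
      Γ.HasSlopeBackward f e t (Γ.slopeBackward f e t) := by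
    intro e t h0 h1
    obtain ⟨k, hk⟩ := (hf e).2 t h0 h1
    rwa [slopeBackward_eq hk]
  have key : ∀ e t, 0 ≤ t → t ≤ Γ.len e → f (Γ.onEdge e t) =
      f (Point.vertex (Γ.src e)) + Γ.slopeForward f e 0 * t - hinge D e t := by
    intro e
    set κ := Γ.slopeForward f e 0 with hκ
    -- The difference between `f` and its expected formula. The kinks of `f` cancel those of the
    -- hinge functions, so `eq_zero_of_slopes` applies.
    set δ : ℝ → ℝ := fun t => f (Γ.onEdge e t) +
      (hinge D e t + (-f (Point.vertex (Γ.src e)) + ((-κ : ℤ) : ℝ) * t)) with hδ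
    have hRf : ∀ t, 0 ≤ t → t < Γ.len e →
        SlopeRight (fun t => f (Γ.onEdge e t)) t (Γ.slopeForward f e t) := fun t h0 h1 =>
      hspecF e t h0 h1
    have hLf : ∀ t, 0 < t → t ≤ Γ.len e →
        SlopeLeft (fun t => f (Γ.onEdge e t)) t (Γ.slopeBackward f e t) := fun t h0 h1 =>
      hspecB e t h0 h1
    have hz := eq_zero_of_slopes (δ := δ) (b := Γ.len e)
      (by simp [hδ, onEdge_zero, hinge_at_zero])
      (by
        have := (hRf 0 le_rfl (Γ.len_pos e)).add
          ((slopeRight_hinge D e 0).add (slopeRight_affine (-f (Point.vertex (Γ.src e))) (-κ) 0))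
        rw [sum_leWeight_zero, ← hκ] at this
        convert this using 1
        ring)
      (by
        intro t h0 h1
        refine ⟨_, (hRf t h0.le h1).add
          ((slopeRight_hinge D e t).add (slopeRight_affine (-f (Point.vertex (Γ.src e))) (-κ) t)), ?_⟩
        have h2 := (hLf t h0 h1.le).add
          ((slopeLeft_hinge D e t).add (slopeLeft_affine (-f (Point.vertex (Γ.src e))) (-κ) t))
        have h3 := hD (Point.inner e t h0 h1)
        rw [ord, ← sum_leWeight_sub_ltWeight] at h3
        convert h2 using 1
        linarith)
      ⟨_, (hLf _ (Γ.len_pos e) le_rfl).add ((slopeLeft_hinge D e _).add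
        (slopeLeft_affine (-f (Point.vertex (Γ.src e))) (-κ) _))⟩
    intro t h0 h1
    have := hz t h0 h1
    simp only [hδ] at this
    push_cast at this
    linarith
  refine ⟨fun e => ?_, fun x => ?_⟩
  · have := key e _ (Γ.len_pos e).le le_rfl
    rwa [onEdge_len] at this
  · rw [← hD, ord, ← Finset.sum_neg_distrib]
    refine Finset.sum_congr rfl fun e _ => ?_
    have hb : Γ.slopeBackward f e (Γ.len e) = -Γ.slopeForward f e 0 + degOn D e := by
      have h1 := (hasSlopeBackward_iff (key e) (Γ.len_pos e) le_rfl).1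
        (hspecB e _ (Γ.len_pos e) le_rfl)
      refine h1.unique ?_
      rw [← sum_ltWeight_len]
      filter_upwards [slopeLeft_hinge D e (Γ.len e)] with h hh
      rw [hh]; push_cast; ring
    rw [hb]
    split_ifs <;> ring

end MetricGraph

/-! ### Linear equivalence on a chain of loops as balancing of slopes -/

namespace ChainOfLoops

open MetricGraph

variable {g : ℕ} {Γ : ChainOfLoops g}

/-- The top edge of a loop. -/
abbrev top (k : Fin g) : Edge g := Sum.inl k

/-- The bottom edge of a loop. -/
abbrev bot (k : Fin g) : Edge g := Sum.inr (Sum.inl k)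

/-- The bridge with the given index. -/
abbrev bridge (k : Fin (g + 1)) : Edge g := Sum.inr (Sum.inr k)

theorem len_top (k : Fin g) : Γ.graph.len (top k) = Γ.topLen (k + 1) := rfl
theorem len_bot (k : Fin g) : Γ.graph.len (bot k) = Γ.botLen (k + 1) := rfl
theorem len_bridge (k : Fin (g + 1)) : Γ.graph.len (bridge k) = Γ.bridgeLen k := rfl

/-- The integers `κt`, `κb`, `σ` are the slopes at the starts of the edges of a function with
divisor `D` on the chain of loops. -/
structure Balanced (D : Γ.graph.Divisor) (κt κb : Fin g → ℤ) (σ : Fin (g + 1) → ℤ) : Prop where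
  start : D (Γ.wPoint 0) = -σ 0
  left : ∀ k : Fin g, D (Γ.vSuccPoint k.castSucc) =
    σ k.castSucc - degOn D (bridge k.castSucc) - κt k - κb k
  right : ∀ k : Fin g, D (Γ.wPoint k.succ) =
    κt k - degOn D (top k) + (κb k - degOn D (bot k)) - σ k.succ
  finish : D (Γ.vSuccPoint (Fin.last g)) = σ (Fin.last g) - degOn D (bridge (Fin.last g))
  loop : ∀ k : Fin g, κt k * Γ.topLen (k + 1) - hinge D (top k) (Γ.topLen (k + 1)) =
    κb k * Γ.botLen (k + 1) - hinge D (bot k) (Γ.botLen (k + 1))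

theorem vertexSum_start (a b : Edge g → ℤ) :
    ∑ e : Edge g, ((if Γ.graph.tgt e = Sum.inl 0 then a e else 0) -
      (if Γ.graph.src e = Sum.inl 0 then b e else 0)) = -b (bridge 0) := by
  simp only [Fintype.sum_sum_type, graph]
  simp [Fin.succ_ne_zero]

theorem vertexSum_right (a b : Edge g → ℤ) (k : Fin g) :
    ∑ e : Edge g, ((if Γ.graph.tgt e = Sum.inl k.succ then a e else 0) -
      (if Γ.graph.src e = Sum.inl k.succ then b e else 0)) =
      a (top k) + a (bot k) - b (bridge k.succ) := by
  simp only [Fintype.sum_sum_type, graph]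
  simp
  ring

theorem vertexSum_left (a b : Edge g → ℤ) (k : Fin g) :
    ∑ e : Edge g, ((if Γ.graph.tgt e = Sum.inr k.castSucc then a e else 0) -
      (if Γ.graph.src e = Sum.inr k.castSucc then b e else 0)) =
      a (bridge k.castSucc) - b (top k) - b (bot k) := by
  simp only [Fintype.sum_sum_type, graph]
  simp
  ring

theorem vertexSum_finish (a b : Edge g → ℤ) :
    ∑ e : Edge g, ((if Γ.graph.tgt e = Sum.inr (Fin.last g) then a e else 0) -
      (if Γ.graph.src e = Sum.inr (Fin.last g) then b e else 0)) = a (bridge (Fin.last g)) := by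
  simp only [Fintype.sum_sum_type, graph]
  simp [Fin.castSucc_ne_last]

theorem balanced_of_ord_eq {f : Γ.graph.Point → ℝ} {D : Γ.graph.Divisor} (hf : Γ.graph.IsPL f)
    (hD : ∀ p, Γ.graph.ord f p = D p) :
    ∃ κt κb σ, Balanced D κt κb σ := by
  obtain ⟨h1, h2⟩ := balance_of_ord_eq hf hD
  refine ⟨fun k => Γ.graph.slopeForward f (top k) 0, fun k => Γ.graph.slopeForward f (bot k) 0,
    fun k => Γ.graph.slopeForward f (bridge k) 0, ?_, ?_, ?_, ?_, ?_⟩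
  · rw [wPoint, h2, vertexSum_start (fun e => Γ.graph.slopeForward f e 0 - degOn D e)]
  · intro k
    rw [vSuccPoint, h2, vertexSum_left (fun e => Γ.graph.slopeForward f e 0 - degOn D e)]
  · intro k
    rw [wPoint, h2, vertexSum_right (fun e => Γ.graph.slopeForward f e 0 - degOn D e)]
  · rw [vSuccPoint, h2, vertexSum_finish (fun e => Γ.graph.slopeForward f e 0 - degOn D e)
      (fun e => Γ.graph.slopeForward f e 0)]
  · intro k
    have e1 := h1 (top k)
    have e2 := h1 (bot k)
    rw [len_top] at e1
    rw [len_bot] at e2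
    have e3 : Γ.graph.tgt (top k) = Γ.graph.tgt (bot k) := rfl
    have e4 : Γ.graph.src (top k) = Γ.graph.src (bot k) := rfl
    rw [e3, e4] at e1
    linarith

/-- The only cycles are the loops, so values can be assigned from left to right; `loop` says that
the two ways around each loop agree. -/
theorem Balanced.exists_ord_eq {D : Γ.graph.Divisor} {κt κb : Fin g → ℤ} {σ : Fin (g + 1) → ℤ}
    (h : Balanced D κt κb σ) :
    ∃ f : Γ.graph.Point → ℝ, Γ.graph.IsPL f ∧ (∀ p, Γ.graph.ord f p = D p) ∧
      (∀ k t, 0 ≤ t → t ≤ Γ.bridgeLen (k : Fin (g + 1)) → f (Γ.graph.onEdge (bridge k) t) =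
        f (Γ.wPoint k) + σ k * t - hinge D (bridge k) t) ∧
      (∀ k t, 0 ≤ t → t ≤ Γ.topLen ((k : Fin g) + 1) → f (Γ.graph.onEdge (top k) t) =
        f (Γ.vSuccPoint k.castSucc) + κt k * t - hinge D (top k) t) ∧
      ∀ k : Fin g, f (Γ.wPoint k.succ) = f (Γ.vSuccPoint k.castSucc) +
        κb k * Γ.botLen (k + 1) - hinge D (bot k) (Γ.botLen (k + 1)) := by
  let inc : Fin (g + 1) → ℝ := fun k => σ k * Γ.bridgeLen k - hinge D (bridge k) (Γ.bridgeLen k)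
  -- The values at the points `w_k`, computed along the bridges and the bottom edges, starting with
  -- zero.
  let w : Fin (g + 1) → ℝ := Fin.induction (motive := fun _ => ℝ) 0
    (fun k x => x + inc k.castSucc + κb k * Γ.botLen (k + 1) -
      hinge D (bot k) (Γ.botLen (k + 1)))
  have hw : ∀ k : Fin g, w k.succ = w k.castSucc + inc k.castSucc + κb k * Γ.botLen (k + 1) -
      hinge D (bot k) (Γ.botLen (k + 1)) := fun k => by simp only [w, Fin.induction_succ]
  let val : Vertex g → ℝ := Sum.elim w (fun k => w k + inc k)
  let κ : Edge g → ℤ := Sum.elim κt (Sum.elim κb σ)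
  obtain ⟨f, h1, h2, h3, h4⟩ := MetricGraph.exists_ord_eq (Γ := Γ.graph) D κ val
    (by
      rintro (k | k | k)
      · have := h.loop k
        change w k.succ = w k.castSucc + inc k.castSucc + κt k * Γ.topLen (k + 1) -
          hinge D (top k) (Γ.topLen (k + 1))
        rw [hw]; linarith
      · exact hw k
      · change w k + inc k = w k + σ k * Γ.bridgeLen k - hinge D (bridge k) (Γ.bridgeLen k)
        simp only [inc]; ring)
    (by
      rintro (k | k)
      · refine Fin.cases ?_ (fun k => ?_) k
        · rw [vertexSum_start (fun e => κ e - degOn D e)]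
          exact h.start
        · rw [vertexSum_right (fun e => κ e - degOn D e)]
          exact h.right k
      · refine Fin.lastCases ?_ (fun k => ?_) k
        · rw [vertexSum_finish (fun e => κ e - degOn D e) κ]
          exact h.finish
        · rw [vertexSum_left (fun e => κ e - degOn D e)]
          exact h.left k)
  refine ⟨f, h1, h2, fun k t ht0 ht1 => ?_, fun k t ht0 ht1 => ?_, fun k => ?_⟩
  · rw [h4 (bridge k) t ht0 ht1, wPoint, h3]; rfl
  · rw [h4 (top k) t ht0 ht1, vSuccPoint, h3]; rfl
  · rw [wPoint, vSuccPoint, h3, h3]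
    exact hw k

/-- This turns all questions about ranks and representatives into integer arithmetic of slopes, plus
one real equation per loop. -/
theorem linEquiv_iff {D D' : Γ.graph.Divisor} :
    MetricGraph.LinEquiv D D' ↔ ∃ κt κb σ, Balanced (D' - D) κt κb σ := by
  constructor
  · rintro ⟨f, hf, h⟩
    exact balanced_of_ord_eq hf fun p => by rw [Finsupp.sub_apply, h]; ring
  · rintro ⟨κt, κb, σ, h⟩
    obtain ⟨f, h1, h2, -⟩ := h.exists_ord_eq
    exact ⟨f, h1, fun p => by rw [h2, Finsupp.sub_apply]; ring⟩

/-! ### Divisors with chips at the vertices and at one point of each edge of a loop -/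

variable (Γ) in
/-- The divisor with `c x` chips at the vertices `x`, and with `d k` and `d' k` chips at the points
with coordinates `a k` and `b k` of the top and bottom edges of the loops. -/
noncomputable def loopDivisor (c : Vertex g → ℤ) (a b : Fin g → ℝ) (d d' : Fin g → ℤ) :
    Γ.graph.Divisor :=
  (∑ x, Finsupp.single (Point.vertex x) (c x)) +
    (∑ k, Finsupp.single (Γ.graph.onEdge (top k) (a k)) (d k) +
      ∑ k, Finsupp.single (Γ.graph.onEdge (bot k) (b k)) (d' k))

/-- The coordinates are those of interior points. -/
def Inside (Γ : ChainOfLoops g) (a b : Fin g → ℝ) : Prop :=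
  ∀ k : Fin g, (0 < a k ∧ a k < Γ.graph.len (top k)) ∧ 0 < b k ∧ b k < Γ.graph.len (bot k)

section loopDivisor

variable {c : Vertex g → ℤ} {a b : Fin g → ℝ} {d d' : Fin g → ℤ}

theorem loopDivisor_eq (h : Inside Γ a b) : loopDivisor Γ c a b d d' =
    (∑ x, Finsupp.single (Point.vertex x) (c x)) +
    (∑ k, Finsupp.single (Point.inner (top k) (a k) (h k).1.1 (h k).1.2) (d k) +
      ∑ k, Finsupp.single (Point.inner (bot k) (b k) (h k).2.1 (h k).2.2) (d' k)) := by
  unfold loopDivisor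
  congr 2
  · exact Finset.sum_congr rfl fun k _ => by rw [onEdge_inner _ _ (h k).1.1 (h k).1.2]
  · exact Finset.sum_congr rfl fun k _ => by rw [onEdge_inner _ _ (h k).2.1 (h k).2.2]

theorem loopDivisor_vertex (h : Inside Γ a b) (x : Vertex g) :
    loopDivisor Γ c a b d d' (Point.vertex x) = c x := by
  classical
  rw [loopDivisor_eq h]
  rcases x with x | x <;> simp [Finsupp.single_apply]

theorem loopDivisor_top (h : Inside Γ a b) (k : Fin g) (t : ℝ) (h0 : 0 < t)
    (h1 : t < Γ.graph.len (top k)) :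
    loopDivisor Γ c a b d d' (Point.inner (top k) t h0 h1) = if a k = t then d k else 0 := by
  classical
  rw [loopDivisor_eq h]
  simp only [Finsupp.add_apply, Finsupp.finsetSum_apply, Finsupp.single_apply, reduceCtorEq,
    if_false, Finset.sum_const_zero, zero_add, Point.inner.injEq, Sum.inl.injEq, false_and,
    add_zero]
  rw [Finset.sum_eq_single k]
  · simp
  · intro j _ hj; simp [hj]
  · simp

theorem loopDivisor_bot (h : Inside Γ a b) (k : Fin g) (t : ℝ) (h0 : 0 < t)
    (h1 : t < Γ.graph.len (bot k)) :
    loopDivisor Γ c a b d d' (Point.inner (bot k) t h0 h1) = if b k = t then d' k else 0 := by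
  classical
  rw [loopDivisor_eq h]
  simp only [Finsupp.add_apply, Finsupp.finsetSum_apply, Finsupp.single_apply, reduceCtorEq,
    if_false, Finset.sum_const_zero, zero_add, Point.inner.injEq, Sum.inl.injEq, false_and,
    add_zero, Sum.inr.injEq]
  rw [Finset.sum_eq_single k]
  · simp
  · intro j _ hj; simp [hj]
  · simp

theorem loopDivisor_bridge (h : Inside Γ a b) (k : Fin (g + 1)) (t : ℝ) (h0 : 0 < t)
    (h1 : t < Γ.graph.len (bridge k)) :
    loopDivisor Γ c a b d d' (Point.inner (bridge k) t h0 h1) = 0 := by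
  classical
  rw [loopDivisor_eq h]
  simp [Finsupp.single_apply]

theorem loopDivisor_nonneg (h : Inside Γ a b) (hc : ∀ x, 0 ≤ c x) (hd : ∀ k, 0 ≤ d k)
    (hd' : ∀ k, 0 ≤ d' k) : 0 ≤ loopDivisor Γ c a b d d' := by
  intro p
  rcases p with x | ⟨k | k | k, t, h0, h1⟩
  · rw [loopDivisor_vertex h]; exact hc x
  · rw [loopDivisor_top h]; split_ifs
    exacts [hd k, le_rfl]
  · rw [loopDivisor_bot h]; split_ifs
    exacts [hd' k, le_rfl]
  · rw [loopDivisor_bridge h]; rfl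

theorem degOn_loopDivisor_top (h : Inside Γ a b) (k : Fin g) :
    degOn (loopDivisor Γ c a b d d') (top k) = d k := by
  rw [loopDivisor_eq h]
  simp [degOn_add, degOn_sum, degOn_single, onWeight]

theorem degOn_loopDivisor_bot (h : Inside Γ a b) (k : Fin g) :
    degOn (loopDivisor Γ c a b d d') (bot k) = d' k := by
  rw [loopDivisor_eq h]
  simp [degOn_add, degOn_sum, degOn_single, onWeight]

theorem degOn_loopDivisor_bridge (h : Inside Γ a b) (k : Fin (g + 1)) :
    degOn (loopDivisor Γ c a b d d') (bridge k) = 0 := by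
  rw [loopDivisor_eq h]
  simp [degOn_add, degOn_sum, degOn_single, onWeight]

theorem hinge_loopDivisor_top (h : Inside Γ a b) (k : Fin g) (t : ℝ) :
    hinge (loopDivisor Γ c a b d d') (top k) t = d k * max 0 (t - a k) := by
  rw [loopDivisor_eq h]
  simp [hinge_add, hinge_sum, hinge_single, hingeWeight]

theorem hinge_loopDivisor_bot (h : Inside Γ a b) (k : Fin g) (t : ℝ) :
    hinge (loopDivisor Γ c a b d d') (bot k) t = d' k * max 0 (t - b k) := by
  rw [loopDivisor_eq h]
  simp [hinge_add, hinge_sum, hinge_single, hingeWeight]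

theorem hinge_loopDivisor_bridge (h : Inside Γ a b) (k : Fin (g + 1)) (t : ℝ) :
    hinge (loopDivisor Γ c a b d d') (bridge k) t = 0 := by
  rw [loopDivisor_eq h]
  simp [hinge_add, hinge_sum, hinge_single, hingeWeight]

end loopDivisor

theorem deg_add (D D' : Γ.graph.Divisor) : deg (D + D') = deg D + deg D' :=
  Finsupp.sum_add_index' (by simp) (by simp)

theorem deg_sum {ι : Type*} (A : Finset ι) (D : ι → Γ.graph.Divisor) :
    deg (∑ i ∈ A, D i) = ∑ i ∈ A, deg (D i) := by
  classical
  induction A using Finset.induction_on with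
  | empty => simp [deg]
  | insert a s ha ih => rw [Finset.sum_insert ha, Finset.sum_insert ha, deg_add, ih]

theorem deg_single (p : Γ.graph.Point) (c : ℤ) : deg (Finsupp.single p c) = c := by simp [deg]

theorem deg_loopDivisor (c : Vertex g → ℤ) (a b : Fin g → ℝ) (d d' : Fin g → ℤ) :
    deg (loopDivisor Γ c a b d d') = ∑ x, c x + (∑ k, d k + ∑ k, d' k) := by
  simp only [loopDivisor, deg_add, deg_sum, deg_single]

/-- The degree of a divisor as a sum over the vertices and the edges. -/
theorem deg_eq_sum (D : Γ.graph.Divisor) :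
    deg D = ∑ x, D (Point.vertex x) + ∑ e, degOn D e := by
  classical
  induction D using Finsupp.induction_linear with
  | zero => simp [deg, degOn_zero]
  | add D D' h h' =>
    simp only [deg_add, h, h', Finsupp.add_apply, degOn_add, Finset.sum_add_distrib]; ring
  | single p c =>
    rw [deg_single]
    simp only [degOn_single, Finsupp.single_apply]
    cases p with
    | vertex x => simp [onWeight]
    | inner e t h0 h1 => simp [onWeight]

end ChainOfLoops

/-! ### Effective divisors of degree zero or one on an edge -/

namespace MetricGraph

variable {V E : Type} {Γ : MetricGraph V E}

theorem onWeight_nonneg (e : E) (p : Γ.Point) : 0 ≤ onWeight e p := by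
  cases p <;> simp only [onWeight]
  · exact le_rfl
  · split_ifs <;> simp

theorem apply_eq_zero_of_degOn_eq_zero {D : Γ.Divisor} (hD : 0 ≤ D) {e : E} (h : degOn D e = 0)
    (t : ℝ) (h0 : 0 < t) (h1 : t < Γ.len e) : D (Point.inner e t h0 h1) = 0 := by
  by_contra hne
  have h2 := (Finset.sum_eq_zero_iff_of_nonneg
    (fun p _ => mul_nonneg (hD p) (onWeight_nonneg e p))).1 h _ (Finsupp.mem_support_iff.2 hne)
  simp [onWeight] at h2
  exact hne h2

theorem hinge_eq_zero_of_degOn_eq_zero {D : Γ.Divisor} (hD : 0 ≤ D) {e : E} (h : degOn D e = 0)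
    (t : ℝ) : hinge D e t = 0 := by
  refine Finset.sum_eq_zero fun p _ => ?_
  cases p with
  | vertex x => simp [hingeWeight]
  | inner e' a h0 h1 =>
    by_cases he : e' = e
    · subst he
      rw [apply_eq_zero_of_degOn_eq_zero hD h]; simp
    · simp [hingeWeight, he]

theorem exists_of_degOn_eq_one {D : Γ.Divisor} (hD : 0 ≤ D) {e : E} (h : degOn D e = 1) :
    ∃ a, 0 < a ∧ a < Γ.len e ∧ (∀ t, hinge D e t = max 0 (t - a)) ∧
      ∀ t h0 h1, D (Point.inner e t h0 h1) = if a = t then 1 else 0 := by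
  classical
  obtain ⟨p, hp, hpos⟩ : ∃ p ∈ D.support, 0 < D p * onWeight e p := by
    by_contra! hcon
    have : degOn D e ≤ 0 := Finset.sum_nonpos hcon
    omega
  cases p with
  | vertex x => simp [onWeight] at hpos
  | inner e' a h0 h1 =>
    by_cases he : e' = e
    · subst he
      simp only [onWeight, if_true, mul_one] at hpos
      set D₂ : Γ.Divisor := D - Finsupp.single (Point.inner e' a h0 h1) 1 with hD₂
      have hdec : D = D₂ + Finsupp.single (Point.inner e' a h0 h1) 1 := by simp [hD₂]
      have hnn : 0 ≤ D₂ := by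
        intro q
        rw [hD₂, Finsupp.sub_apply, Finsupp.single_apply]
        split_ifs with hq
        · subst hq; simp only [Finsupp.coe_zero, Pi.zero_apply]; omega
        · simpa using hD q
      have hdeg : degOn D₂ e' = 0 := by
        rw [hD₂, degOn_sub, h, degOn_single]; simp [onWeight]
      refine ⟨a, h0, h1, fun t => ?_, fun t g0 g1 => ?_⟩
      · rw [hdec, hinge_add, hinge_eq_zero_of_degOn_eq_zero hnn hdeg, hinge_single]
        simp [hingeWeight]
      · rw [hdec, Finsupp.add_apply, apply_eq_zero_of_degOn_eq_zero hnn hdeg,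
          Finsupp.single_apply]
        simp
    · simp [onWeight, he] at hpos

end MetricGraph

/-- On a circle of length `ℓ + m`, a multiple of `m` with coefficient at most `G` is shorter than
one turn, so it closes up only if it is zero. This is the sole role of the shortness of bottom edges
in the rigidity of slopes at a loop without chips. -/
theorem eq_zero_of_mul_add_eq {κ x : ℤ} {ℓ m G : ℝ} (hm : 0 < m) (hℓ : G * m < ℓ)
    (hx : |(x : ℝ)| ≤ G) (h : κ * (ℓ + m) = x * m) : κ = 0 ∧ x = 0 := by
  have hG : 0 ≤ G := (abs_nonneg _).trans hx
  have hpos : 0 < ℓ + m := by nlinarith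
  have habs : |(κ : ℝ)| * (ℓ + m) = |(x : ℝ)| * m := by
    have := congrArg abs h
    rwa [abs_mul, abs_mul, abs_of_pos hpos, abs_of_pos hm] at this
  have h1 : |(κ : ℝ)| < 1 := by
    by_contra! hcon
    nlinarith
  have hκ : κ = 0 := by
    rw [← Int.cast_abs] at h1
    have : |κ| < 1 := by exact_mod_cast h1
    exact Int.abs_lt_one_iff.1 this
  refine ⟨hκ, ?_⟩
  rw [hκ, Int.cast_zero, zero_mul] at h
  have := (mul_eq_zero.1 h.symm).resolve_right hm.ne'
  exact_mod_cast this

/-- A family `p k i` of slopes on the bridges of a chain of loops, where the slopes equal to `P k`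
increase by one at the loop after the bridge `k`. -/
structure SlopePath (g r s : ℕ) (p : ℕ → ℕ → ℤ) (P : ℕ → ℤ) : Prop where
  start : ∀ i ≤ r, p 0 i = r - i
  finish : ∀ i ≤ r, p g i = r - i + s
  step : ∀ k < g, ∀ i ≤ r, p (k + 1) i = p k i + if p k i = P k then 1 else 0
  anti : ∀ k ≤ g, ∀ i j, i < j → j ≤ r → p k j < p k i
  skip : ∀ k < g, ∀ i ≤ r, p k i ≠ P k + 1
  nonneg : ∀ k ≤ g, ∀ i ≤ r, 0 ≤ p k i
  le : ∀ k ≤ g, ∀ i ≤ r, p k i ≤ r + s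
  special_nonneg : ∀ k < g, 0 ≤ P k
  special_le : ∀ k < g, P k ≤ r + s + 1
  genus : r + 1 ≤ g
  genus' : r + s ≤ g

/-! ### The class of a slope path and its end divisors -/

namespace ChainOfLoops

open MetricGraph

variable {g r s : ℕ} {Γ : ChainOfLoops g} {p : ℕ → ℕ → ℤ} {P : ℕ → ℤ}

/-- Bottom edges are much shorter than top edges. -/
def ShortBottoms (Γ : ChainOfLoops g) : Prop :=
  ∀ k : Fin g, 4 * g * Γ.botLen (k + 1) < Γ.topLen (k + 1)

theorem bot_pos (Γ : ChainOfLoops g) (k : Fin g) : 0 < Γ.botLen (k + 1) :=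
  Γ.botLen_pos _ (by omega) (by omega)

theorem top_pos (Γ : ChainOfLoops g) (k : Fin g) : 0 < Γ.topLen (k + 1) :=
  Γ.topLen_pos _ (by omega) (by omega)

/-- The multiplicities at the vertices of the divisor with slopes `p` and special slopes `P`. -/
def baseCoeff (g r s : ℕ) (P : ℕ → ℤ) : Vertex g → ℤ :=
  Sum.elim (Fin.cases r fun k : Fin g => 1 + P k)
    (Fin.lastCases (-(s : ℤ)) fun k : Fin g => -P k)

/-- The divisor supported at the vertices in the class given by the special slopes `P`. -/
noncomputable def baseDivisor (Γ : ChainOfLoops g) (r s : ℕ) (P : ℕ → ℤ) : Γ.graph.Divisor :=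
  loopDivisor Γ (baseCoeff g r s P) (fun k => Γ.topLen (k + 1) / 2)
    (fun k => Γ.botLen (k + 1) / 2) 0 0

theorem inside_half (Γ : ChainOfLoops g) :
    Inside Γ (fun k => Γ.topLen (k + 1) / 2) (fun k => Γ.botLen (k + 1) / 2) := fun k => by
  rw [len_top, len_bot]
  have := Γ.bot_pos k
  have := Γ.top_pos k
  constructor <;> constructor <;> linarith

theorem baseDivisor_w_zero : baseDivisor Γ r s P (Γ.wPoint 0) = r :=
  loopDivisor_vertex (inside_half Γ) _

theorem baseDivisor_w_succ (k : Fin g) : baseDivisor Γ r s P (Γ.wPoint k.succ) = 1 + P k :=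
  loopDivisor_vertex (inside_half Γ) _

theorem baseDivisor_v_castSucc (k : Fin g) :
    baseDivisor Γ r s P (Γ.vSuccPoint k.castSucc) = -P k := by
  refine (loopDivisor_vertex (inside_half Γ) _).trans ?_
  simp [baseCoeff]

theorem baseDivisor_v_last : baseDivisor Γ r s P (Γ.vSuccPoint (Fin.last g)) = -s := by
  refine (loopDivisor_vertex (inside_half Γ) _).trans ?_
  simp [baseCoeff]

theorem degOn_baseDivisor (e : Edge g) : degOn (baseDivisor Γ r s P) e = 0 := by
  rcases e with k | k | k
  · exact degOn_loopDivisor_top (inside_half Γ) k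
  · exact degOn_loopDivisor_bot (inside_half Γ) k
  · exact degOn_loopDivisor_bridge (inside_half Γ) k

theorem hinge_baseDivisor (e : Edge g) (t : ℝ) : hinge (baseDivisor Γ r s P) e t = 0 := by
  rcases e with k | k | k
  · rw [baseDivisor, hinge_loopDivisor_top (inside_half Γ) k]; simp
  · rw [baseDivisor, hinge_loopDivisor_bot (inside_half Γ) k]; simp
  · exact hinge_loopDivisor_bridge (inside_half Γ) k _

theorem deg_baseDivisor : deg (baseDivisor Γ r s P) = (g : ℤ) + r - s := by
  rw [baseDivisor, deg_loopDivisor, Fintype.sum_sum_type, Fin.sum_univ_succ,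
    Fin.sum_univ_castSucc (f := fun k => baseCoeff g r s P (Sum.inr k))]
  simp [baseCoeff, Finset.sum_add_distrib]
  ring

/-- The position on the top edge of the loop `k + 1` of the chip of the end divisor `i`. -/
noncomputable def endCoord (Γ : ChainOfLoops g) (p : ℕ → ℕ → ℤ) (P : ℕ → ℤ) (i : ℕ) (k : Fin g) :
    ℝ :=
  if p k i < P k then Γ.topLen (k + 1) - (P k - p k i) * Γ.botLen (k + 1)
  else if p k i = P k then Γ.topLen (k + 1) / 2
  else (p k i - P k - 1) * Γ.botLen (k + 1)

/-- The multiplicities at the ends. -/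
def endCoeff (g r i : ℕ) : Vertex g → ℤ :=
  Sum.elim (Fin.cases i fun _ : Fin g => 0) (Fin.lastCases ((r : ℤ) - i) fun _ : Fin g => 0)

/-- The effective divisor in the class with prescribed multiplicities at the two ends. -/
noncomputable def endDivisor (Γ : ChainOfLoops g) (r : ℕ) (p : ℕ → ℕ → ℤ) (P : ℕ → ℤ) (i : ℕ) :
    Γ.graph.Divisor :=
  loopDivisor Γ (endCoeff g r i) (endCoord Γ p P i) (fun k => Γ.botLen (k + 1) / 2)
    (fun k => if p k i = P k then 0 else 1) 0

/-- Differences of slopes times the bottom length stay within half of the top edge. Hence chips of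
functions steeper than `P k` lie in the first half and those of flatter functions in the second
half, and the middle of the top edge separates them. -/
theorem loop_bound (hP : SlopePath g r s p P) (hΓ : ShortBottoms Γ) (k : Fin g) (x : ℤ)
    (hx : |x| ≤ r + s + 1) : |(x : ℝ)| * Γ.botLen (k + 1) < Γ.topLen (k + 1) / 2 := by
  have hm := Γ.bot_pos k
  have h2 : |(x : ℝ)| ≤ 2 * g := by
    rw [← Int.cast_abs]
    have := hP.genus; have := hP.genus'
    have : |x| ≤ 2 * g := by omega
    exact_mod_cast this
  have := hΓ k
  nlinarith

theorem abs_sub_special_le (hP : SlopePath g r s p P) {k : ℕ} (hk : k < g) {i : ℕ} (hi : i ≤ r) :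
    |p k i - P k| ≤ r + s + 1 := by
  have := hP.nonneg k hk.le i hi
  have := hP.le k hk.le i hi
  have := hP.special_nonneg k hk
  have := hP.special_le k hk
  rw [abs_le]; constructor <;> omega

/-- A slope `P k + 1` would put the chip on the vertex `v_{k+1}`; the condition `skip` excludes it.
-/
theorem special_lt (hP : SlopePath g r s p P) {k : ℕ} (hk : k < g) {i : ℕ} (hi : i ≤ r)
    (h : ¬p k i < P k) (h' : p k i ≠ P k) : P k + 2 ≤ p k i := by
  have := hP.skip k hk i hi
  omega

theorem endCoord_of_gt (hP : SlopePath g r s p P) (hΓ : ShortBottoms Γ) {i : ℕ} (hi : i ≤ r)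
    (k : Fin g) (h : P k + 2 ≤ p k i) :
    endCoord Γ p P i k = (p k i - P k - 1) * Γ.botLen (k + 1) ∧ 0 < endCoord Γ p P i k ∧
      endCoord Γ p P i k < Γ.topLen (k + 1) / 2 := by
  have hm := Γ.bot_pos k
  have e : endCoord Γ p P i k = (p k i - P k - 1) * Γ.botLen (k + 1) := by
    rw [endCoord, if_neg (by omega), if_neg (by omega)]
  have hb := loop_bound hP hΓ k _ (abs_sub_special_le hP k.2 hi)
  have h' : (P k : ℝ) + 2 ≤ p k i := by exact_mod_cast h
  rw [Int.cast_sub, abs_of_nonneg (by linarith)] at hb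
  refine ⟨e, ?_, ?_⟩ <;> rw [e] <;> nlinarith

theorem endCoord_of_lt (hP : SlopePath g r s p P) (hΓ : ShortBottoms Γ) {i : ℕ} (hi : i ≤ r)
    (k : Fin g) (h : p k i < P k) :
    endCoord Γ p P i k = Γ.topLen (k + 1) - (P k - p k i) * Γ.botLen (k + 1) ∧
      Γ.topLen (k + 1) / 2 < endCoord Γ p P i k ∧ endCoord Γ p P i k < Γ.topLen (k + 1) := by
  have hm := Γ.bot_pos k
  have e : endCoord Γ p P i k = Γ.topLen (k + 1) - (P k - p k i) * Γ.botLen (k + 1) := by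
    rw [endCoord, if_pos h]
  have hb := loop_bound hP hΓ k _ (abs_sub_special_le hP k.2 hi)
  have h' : (p k i : ℝ) + 1 ≤ P k := by exact_mod_cast h
  rw [Int.cast_sub, abs_of_nonpos (by linarith)] at hb
  refine ⟨e, ?_, ?_⟩ <;> rw [e] <;> nlinarith

theorem inside_endCoord (hP : SlopePath g r s p P) (hΓ : ShortBottoms Γ) {i : ℕ} (hi : i ≤ r) :
    Inside Γ (endCoord Γ p P i) (fun k => Γ.botLen (k + 1) / 2) := fun k => by
  have hm := Γ.bot_pos k
  have hℓ := Γ.top_pos k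
  rw [len_top, len_bot]
  refine ⟨?_, by linarith, by linarith⟩
  by_cases h : p k i < P k
  · have := endCoord_of_lt hP hΓ hi k h
    constructor <;> linarith
  · by_cases h' : p k i = P k
    · have : endCoord Γ p P i k = Γ.topLen (k + 1) / 2 := by rw [endCoord, if_neg h, if_pos h']
      rw [this]; constructor <;> linarith
    · have := endCoord_of_gt hP hΓ hi k (special_lt hP k.2 hi h h')
      constructor <;> linarith

theorem endDivisor_nonneg (hP : SlopePath g r s p P) (hΓ : ShortBottoms Γ) {i : ℕ} (hi : i ≤ r) :
    0 ≤ endDivisor Γ r p P i := by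
  refine loopDivisor_nonneg (inside_endCoord hP hΓ hi) ?_ ?_ fun _ => le_rfl
  · rintro (k | k)
    · refine Fin.cases ?_ (fun k => ?_) k <;> simp [endCoeff]
    · refine Fin.lastCases ?_ (fun k => ?_) k <;> simp [endCoeff, hi]
  · intro k; split_ifs <;> simp

section endDivisor

variable (hP : SlopePath g r s p P) (hΓ : ShortBottoms Γ) {i : ℕ} (hi : i ≤ r)

include hP hΓ hi

theorem endDivisor_w_zero : endDivisor Γ r p P i (Γ.wPoint 0) = i :=
  loopDivisor_vertex (inside_endCoord hP hΓ hi) _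

theorem endDivisor_w_succ (k : Fin g) : endDivisor Γ r p P i (Γ.wPoint k.succ) = 0 :=
  loopDivisor_vertex (inside_endCoord hP hΓ hi) _

theorem endDivisor_v_castSucc (k : Fin g) :
    endDivisor Γ r p P i (Γ.vSuccPoint k.castSucc) = 0 := by
  refine (loopDivisor_vertex (inside_endCoord hP hΓ hi) _).trans ?_
  simp [endCoeff]

theorem endDivisor_v_last : endDivisor Γ r p P i (Γ.vSuccPoint (Fin.last g)) = (r : ℤ) - i := by
  refine (loopDivisor_vertex (inside_endCoord hP hΓ hi) _).trans ?_
  simp [endCoeff]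

/-- The slopes at the starts of the edges of the function relating `baseDivisor` and
`endDivisor`. -/
theorem balanced_endDivisor :
    Balanced (endDivisor Γ r p P i - baseDivisor Γ r s P) (fun k => if p k i ≤ P k then 0 else 1)
      (fun k => if p k i ≤ P k then p k i - P k else p k i - P k - 1) (fun k => p k i) := by
  have hI := inside_endCoord hP hΓ hi
  refine ⟨?_, fun k => ?_, fun k => ?_, ?_, fun k => ?_⟩
  · rw [Finsupp.sub_apply, endDivisor_w_zero hP hΓ hi, baseDivisor_w_zero, Fin.val_zero,
      hP.start i hi]
    ring
  · rw [Finsupp.sub_apply, endDivisor_v_castSucc hP hΓ hi, baseDivisor_v_castSucc, degOn_sub,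
      degOn_baseDivisor, endDivisor, degOn_loopDivisor_bridge hI, Fin.val_castSucc]
    split_ifs <;> ring
  · rw [Finsupp.sub_apply, endDivisor_w_succ hP hΓ hi, baseDivisor_w_succ, degOn_sub, degOn_sub,
      degOn_baseDivisor, degOn_baseDivisor, endDivisor, degOn_loopDivisor_top hI,
      degOn_loopDivisor_bot hI, Fin.val_succ, hP.step k k.2 i hi]
    have := hP.skip k k.2 i hi
    split_ifs <;> simp <;> omega
  · rw [Finsupp.sub_apply, endDivisor_v_last hP hΓ hi, baseDivisor_v_last, degOn_sub,
      degOn_baseDivisor, endDivisor, degOn_loopDivisor_bridge hI, Fin.val_last, hP.finish i hi]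
    ring
  · rw [hinge_sub, hinge_sub, hinge_baseDivisor, hinge_baseDivisor, endDivisor,
      hinge_loopDivisor_top hI, hinge_loopDivisor_bot hI]
    by_cases h : p k i < P k
    · obtain ⟨e, h1, h2⟩ := endCoord_of_lt hP hΓ hi k h
      rw [max_eq_right (by linarith), e]
      simp [h.le, h.ne]
      ring
    · by_cases h' : p k i = P k
      · simp [h']
      · have h3 := special_lt hP k.2 hi h h'
        have hℓ := Γ.top_pos k
        obtain ⟨e, h1, h2⟩ := endCoord_of_gt hP hΓ hi k h3
        rw [max_eq_right (by linarith), e]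
        have : ¬p k i ≤ P k := by omega
        simp [this, h']

/-- The function relating `baseDivisor` and `endDivisor`, with its slopes on the bridges, its
changes along the loops and its values at the middle points of the top edges. -/
theorem exists_movesTo_endDivisor :
    ∃ f : Γ.graph.Point → ℝ, MovesTo f (baseDivisor Γ r s P) (endDivisor Γ r p P i) ∧
      (∀ k t, 0 ≤ t → t ≤ Γ.bridgeLen (k : Fin (g + 1)) → f (Γ.graph.onEdge (bridge k) t) =
        f (Γ.wPoint k) + p k i * t) ∧
      (∀ k : Fin g, f (Γ.graph.onEdge (top k) (Γ.topLen (k + 1) / 2)) =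
        f (Γ.vSuccPoint k.castSucc) + Γ.botLen (k + 1) * (max 0 (p k i - P k - 1) : ℤ)) ∧
      ∀ k : Fin g, f (Γ.wPoint k.succ) = f (Γ.vSuccPoint k.castSucc) +
        Γ.botLen (k + 1) * (if p k i ≤ P k then p k i - P k else p k i - P k - 1 : ℤ) := by
  have hI := inside_endCoord hP hΓ hi
  obtain ⟨f, h1, h2, h3, h4, h5⟩ := (balanced_endDivisor hP hΓ hi).exists_ord_eq
  refine ⟨f, ⟨h1, fun q => by rw [h2, Finsupp.sub_apply]; ring⟩, fun k t ht0 ht1 => ?_, fun k => ?_,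
    fun k => ?_⟩
  · rw [h3 k t ht0 ht1, hinge_sub, hinge_baseDivisor, endDivisor, hinge_loopDivisor_bridge hI]
    ring
  · have hℓ := Γ.top_pos k
    rw [h4 k _ (by linarith) (by linarith), hinge_sub, hinge_baseDivisor, endDivisor,
      hinge_loopDivisor_top hI]
    by_cases h : p k i < P k
    · obtain ⟨e, g1, g2⟩ := endCoord_of_lt hP hΓ hi k h
      rw [max_eq_left (by linarith), max_eq_left (by omega)]
      simp [h.le]
    · by_cases h' : p k i = P k
      · simp [h']
      · have h3 := special_lt hP k.2 hi h h'
        obtain ⟨e, g1, g2⟩ := endCoord_of_gt hP hΓ hi k h3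
        rw [max_eq_right (by linarith), max_eq_right (by omega), e]
        have : ¬p k i ≤ P k := by omega
        simp [this, h']
        ring
  · rw [h5 k, hinge_sub, hinge_baseDivisor, endDivisor, hinge_loopDivisor_bot hI]
    simp [mul_comm]

end endDivisor

end ChainOfLoops

/-! ### Uniqueness of the end divisors, and the upper bound for the rank -/

namespace ChainOfLoops

open MetricGraph

variable {g r s : ℕ} {Γ : ChainOfLoops g} {p : ℕ → ℕ → ℤ} {P : ℕ → ℤ}

section uniqueness

variable {D : Γ.graph.Divisor} {κt κb : Fin g → ℤ} {σ : Fin (g + 1) → ℤ}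
  (hP : SlopePath g r s p P) (hΓ : ShortBottoms Γ) (hD : 0 ≤ D)
  (hb : Balanced (D - baseDivisor Γ r s P) κt κb σ)

include hb

theorem Balanced.start_eq : D (Γ.wPoint 0) = r - σ 0 := by
  have := hb.start
  rw [Finsupp.sub_apply, baseDivisor_w_zero] at this
  omega

theorem Balanced.left_eq (k : Fin g) : D (Γ.vSuccPoint k.castSucc) =
    σ k.castSucc - degOn D (bridge k.castSucc) - κt k - κb k - P k := by
  have := hb.left k
  rw [Finsupp.sub_apply, baseDivisor_v_castSucc, degOn_sub, degOn_baseDivisor] at this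
  omega

theorem Balanced.right_eq (k : Fin g) : D (Γ.wPoint k.succ) =
    1 + P k + κt k - degOn D (top k) + κb k - degOn D (bot k) - σ k.succ := by
  have := hb.right k
  rw [Finsupp.sub_apply, baseDivisor_w_succ, degOn_sub, degOn_sub, degOn_baseDivisor,
    degOn_baseDivisor] at this
  omega

theorem Balanced.finish_eq : D (Γ.vSuccPoint (Fin.last g)) =
    σ (Fin.last g) - degOn D (bridge (Fin.last g)) - s := by
  have := hb.finish
  rw [Finsupp.sub_apply, baseDivisor_v_last, degOn_sub, degOn_baseDivisor] at this
  omega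

theorem Balanced.loop_eq (k : Fin g) :
    κt k * Γ.topLen (k + 1) - hinge D (top k) (Γ.topLen (k + 1)) =
      κb k * Γ.botLen (k + 1) - hinge D (bot k) (Γ.botLen (k + 1)) := by
  have := hb.loop k
  rwa [hinge_sub, hinge_sub, hinge_baseDivisor, hinge_baseDivisor, sub_zero, sub_zero] at this

include hD

/-- The base divisor has degree one on each loop, so the slope drops by the number of chips on the
loop minus one. -/
theorem Balanced.succ_le (k : Fin g) :
    σ k.succ ≤ σ k.castSucc - degOn D (bridge k.castSucc) + 1 := by
  have h1 := hb.left_eq k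
  have h2 := hb.right_eq k
  have h3 : 0 ≤ D (Γ.vSuccPoint k.castSucc) := hD _
  have h4 : 0 ≤ D (Γ.wPoint k.succ) := hD _
  have h5 := degOn_nonneg hD (top k)
  have h6 := degOn_nonneg hD (bot k)
  omega

/-- Going back from the right end, each loop can have contributed at most one. This a priori bound
makes the torsion argument of `eq_zero_of_mul_add_eq` applicable in `eq_special`. -/
theorem Balanced.lower_bound (k : Fin (g + 1)) : (s : ℤ) - g + k ≤ σ k := by
  induction k using Fin.reverseInduction with
  | last =>
    have h1 := hb.finish_eq
    have h3 : 0 ≤ D (Γ.vSuccPoint (Fin.last g)) := hD _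
    have h5 := degOn_nonneg hD (bridge (Fin.last g))
    rw [Fin.val_last]
    omega
  | cast k ih =>
    have h1 := hb.succ_le hD k
    have h5 := degOn_nonneg hD (bridge k.castSucc)
    rw [Fin.val_succ] at ih
    rw [Fin.val_castSucc]
    push_cast at ih
    omega

include hP hΓ

/-- A slope that increases at a loop is the special one. -/
theorem Balanced.eq_special (k : Fin g)
    (hle : σ k.castSucc - degOn D (bridge k.castSucc) ≤ r + s)
    (h : σ k.succ = σ k.castSucc - degOn D (bridge k.castSucc) + 1) :
    σ k.castSucc - degOn D (bridge k.castSucc) = P k ∧ D (Γ.vSuccPoint k.castSucc) = 0 ∧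
      D (Γ.wPoint k.succ) = 0 ∧ degOn D (top k) = 0 ∧ degOn D (bot k) = 0 := by
  have h1 := hb.left_eq k
  have h2 := hb.right_eq k
  have h3 : 0 ≤ D (Γ.vSuccPoint k.castSucc) := hD _
  have h4 : 0 ≤ D (Γ.wPoint k.succ) := hD _
  have h5 := degOn_nonneg hD (top k)
  have h6 := degOn_nonneg hD (bot k)
  -- A gain of one uses up the whole degree of the loop, so the loop carries no chips and the
  -- function has no kinks inside its edges.
  have t0 : degOn D (top k) = 0 := by omega
  have b0 : degOn D (bot k) = 0 := by omega
  have hl := hb.loop_eq k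
  rw [hinge_eq_zero_of_degOn_eq_zero hD t0, hinge_eq_zero_of_degOn_eq_zero hD b0] at hl
  have low := hb.lower_bound hD k.succ
  have hg := hP.genus
  have hg' := hP.genus'
  have hP0 := hP.special_nonneg k k.2
  have hP1 := hP.special_le k k.2
  rw [Fin.val_succ] at low
  push_cast at low
  have hx : |κt k + κb k| ≤ 4 * g := by
    rw [abs_le]; constructor <;> omega
  have hm := Γ.bot_pos k
  obtain ⟨e1, e2⟩ := eq_zero_of_mul_add_eq (κ := κt k) (x := κt k + κb k) hm (hΓ k)
    (by rw [← Int.cast_abs]; exact_mod_cast hx) (by push_cast; linarith)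
  omega

/-- An arbitrary slope can overtake or catch up with the slope `i` only by rising from `P k` to `P k
+ 1`, and `skip` says that the slope `i` is not at `P k + 1`. -/
theorem Balanced.lt_of_lt (k : Fin g) {i : ℕ} (hi : i ≤ r)
    (h : σ k.castSucc - degOn D (bridge k.castSucc) < p k i) : σ k.succ < p (k + 1) i := by
  have h1 := hb.succ_le hD k
  have h2 := hP.le k k.2.le i hi
  have h3 := hP.step k k.2 i hi
  have h4 := hP.skip k k.2 i hi
  by_contra! hcon
  by_cases hs : σ k.succ = σ k.castSucc - degOn D (bridge k.castSucc) + 1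
  · have := (hb.eq_special hP hΓ hD k (by omega) hs).1
    split_ifs at h3 <;> omega
  · split_ifs at h3 <;> omega

/-- The chips at the right end give the bound on the last bridge. A violation on an earlier bridge
would persist to the right by `lt_of_lt`. -/
theorem Balanced.slope_ge {i : ℕ} (hi : i ≤ r)
    (hl : (r : ℤ) - i ≤ D (Γ.vSuccPoint (Fin.last g))) (k : Fin (g + 1)) :
    p k i ≤ σ k - degOn D (bridge k) := by
  induction k using Fin.reverseInduction with
  | last =>
    have h1 := hb.finish_eq
    rw [Fin.val_last, hP.finish i hi]
    omega
  | cast k ih =>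
    by_contra! hcon
    have h1 := hb.lt_of_lt hP hΓ hD k hi hcon
    have := degOn_nonneg hD (bridge k.succ)
    rw [Fin.val_succ] at ih
    omega

/-- The chips at the left end give the bound on the first bridge. A slope equal to that of `i` can
rise only from `P k`, and then the slope `i` rises as well. -/
theorem Balanced.slope_le {i : ℕ} (hi : i ≤ r) (hl : (i : ℤ) ≤ D (Γ.wPoint 0))
    (k : Fin (g + 1)) : σ k ≤ p k i := by
  induction k using Fin.induction with
  | zero =>
    have h1 := hb.start_eq
    rw [Fin.val_zero, hP.start i hi]
    omega
  | succ k ih =>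
    have h1 := hb.succ_le hD k
    have h5 := degOn_nonneg hD (bridge k.castSucc)
    have h2 := hP.le k k.2.le i hi
    rw [Fin.val_castSucc] at ih
    rw [Fin.val_succ]
    by_cases hs : σ k.castSucc - degOn D (bridge k.castSucc) < p k i
    · exact (hb.lt_of_lt hP hΓ hD k hi hs).le
    · have h3 := hP.step k k.2 i hi
      by_cases hs' : σ k.succ = σ k.castSucc - degOn D (bridge k.castSucc) + 1
      · have := (hb.eq_special hP hΓ hD k (by omega) hs').1
        rw [if_pos (by omega)] at h3
        omega
      · split_ifs at h3 <;> omega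

/-- The position of the chip on a loop is determined by the slopes on the adjacent bridges. -/
theorem Balanced.loop_chip (k : Fin g) {i : ℕ} (hi : i ≤ r)
    (h : σ k.castSucc - degOn D (bridge k.castSucc) = p k i) (h' : σ k.succ = p k i)
    (hne : p k i ≠ P k) :
    D (Γ.vSuccPoint k.castSucc) = 0 ∧ D (Γ.wPoint k.succ) = 0 ∧ degOn D (bot k) = 0 ∧
      ∀ t h0 h1, D (Point.inner (top k) t h0 h1) = if endCoord Γ p P i k = t then 1 else 0 := by
  have h1 := hb.left_eq k
  have h2 := hb.right_eq k
  have h3 : 0 ≤ D (Γ.vSuccPoint k.castSucc) := hD _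
  have h4 : 0 ≤ D (Γ.wPoint k.succ) := hD _
  have h5 := degOn_nonneg hD (top k)
  have h6 := degOn_nonneg hD (bot k)
  have hl := hb.loop_eq k
  have hm := Γ.bot_pos k
  have hskip := hP.skip k k.2 i hi
  have hb0 := abs_sub_special_le hP k.2 hi
  have hbd := loop_bound hP hΓ k _ hb0
  have hg := hP.genus
  have hg' := hP.genus'
  rw [abs_le] at hb0
  have hcast : ∀ x : ℤ, |x| ≤ 4 * g → |(x : ℝ)| ≤ 4 * g := fun x hx => by
    rw [← Int.cast_abs]; exact_mod_cast hx
  have hℓ := Γ.top_pos k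
  have hbig := hΓ k
  have hpos : 0 < Γ.topLen (k + 1) + Γ.botLen (k + 1) := by linarith
  rw [Int.cast_sub] at hbd
  obtain ⟨hbd1, hbd2⟩ : -(Γ.topLen (k + 1) / 2) < (p k i - P k) * Γ.botLen (k + 1) ∧
      ((p k i : ℝ) - P k) * Γ.botLen (k + 1) < Γ.topLen (k + 1) / 2 := by
    rw [← abs_lt, abs_mul, abs_of_pos hm]; exact hbd
  by_cases ht : degOn D (top k) = 1
  · have b0 : degOn D (bot k) = 0 := by omega
    obtain ⟨a, ha0, ha1, hah, hav⟩ := exists_of_degOn_eq_one hD ht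
    rw [len_top] at ha1
    rw [hah, hinge_eq_zero_of_degOn_eq_zero hD b0, max_eq_right (by linarith)] at hl
    have hκ : κb k = p k i - P k - κt k := by omega
    rw [hκ] at hl
    push_cast at hl
    refine ⟨by omega, by omega, b0, ?_⟩
    have hae : endCoord Γ p P i k = a := by
      rcases lt_or_gt_of_ne hne with hlt | hgt
      · have hq : (p k i : ℝ) + 1 ≤ P k := by exact_mod_cast hlt
        -- Both the chip and the multiples of the bottom length are confined to less than one turn,
        -- which leaves a single integer for the slope at the start of the top edge.
        have h0 : κt k = 0 := by
          have u1 : (κt k : ℝ) < 1 := by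
            by_contra! hcon
            nlinarith
          have u2 : (-1 : ℝ) < κt k := by
            by_contra! hcon
            nlinarith
          have u1' : κt k < 1 := by exact_mod_cast u1
          have u2' : -1 < κt k := by exact_mod_cast u2
          omega
        rw [h0] at hl
        rw [(endCoord_of_lt hP hΓ hi k hlt).1]
        push_cast at hl
        linarith
      · have h2' := special_lt hP k.2 hi (by omega) hne
        have hq : (P k : ℝ) + 2 ≤ p k i := by exact_mod_cast h2'
        have h0 : κt k = 1 := by
          have u1 : (κt k : ℝ) < 2 := by
            by_contra! hcon
            nlinarith
          have u2 : (0 : ℝ) < κt k := by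
            by_contra! hcon
            nlinarith
          have u1' : κt k < 2 := by exact_mod_cast u1
          have u2' : 0 < κt k := by exact_mod_cast u2
          omega
        rw [h0] at hl
        rw [(endCoord_of_gt hP hΓ hi k h2').1]
        push_cast at hl
        linarith
    rw [hae]
    exact hav
  -- A chip inside the bottom edge would make an integral multiple of the bottom length lie strictly
  -- between zero and that length; a loop without chips would force the special slope.
  · exfalso
    have t0 : degOn D (top k) = 0 := by omega
    rw [hinge_eq_zero_of_degOn_eq_zero hD t0] at hl
    by_cases hbt : degOn D (bot k) = 1
    · obtain ⟨b, hb0', hb1, hbh, -⟩ := exists_of_degOn_eq_one hD hbt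
      rw [len_bot] at hb1
      rw [hbh, max_eq_right (by linarith)] at hl
      have hκ : κb k = p k i - P k - κt k := by omega
      rw [hκ] at hl
      push_cast at hl
      have h0 : κt k = 0 := by
        have u1 : (κt k : ℝ) < 1 := by
          by_contra! hcon
          nlinarith
        have u2 : (-1 : ℝ) < κt k := by
          by_contra! hcon
          have : Γ.botLen (k + 1) ≤ Γ.topLen (k + 1) / 2 := by
            have : (1 : ℝ) ≤ g := by exact_mod_cast (by omega : 1 ≤ g)
            nlinarith
          nlinarith
        have u1' : κt k < 1 := by exact_mod_cast u1
        have u2' : -1 < κt k := by exact_mod_cast u2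
        omega
      rw [h0] at hl
      push_cast at hl
      rcases lt_or_ge (p k i - P k) 1 with hc | hc
      · have : ((p k i : ℝ) - P k) ≤ 0 := by exact_mod_cast (by omega : p k i - P k ≤ 0)
        nlinarith
      · have : (1 : ℝ) ≤ (p k i : ℝ) - P k := by exact_mod_cast hc
        nlinarith
    · have b0 : degOn D (bot k) = 0 := by omega
      rw [hinge_eq_zero_of_degOn_eq_zero hD b0] at hl
      obtain ⟨e1, e2⟩ := eq_zero_of_mul_add_eq (κ := κt k) (x := κt k + κb k) hm hbig
        (hcast _ (by rw [abs_le]; constructor <;> omega)) (by push_cast; linarith)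
      omega

/-- An effective divisor in the class is determined by its multiplicities at the ends. -/
theorem Balanced.eq_endDivisor {i : ℕ} (hi : i ≤ r) (h0 : D (Γ.wPoint 0) = i)
    (hl : D (Γ.vSuccPoint (Fin.last g)) = (r : ℤ) - i) : D = endDivisor Γ r p P i := by
  have hge := hb.slope_ge hP hΓ hD hi hl.ge
  have hle := hb.slope_le hP hΓ hD hi h0.ge
  have hbr : ∀ k, degOn D (bridge k) = 0 := fun k => by
    have := hge k; have := hle k; have := degOn_nonneg hD (bridge k); omega
  have hσ : ∀ k, σ k = p k i := fun k => by
    have := hge k; have := hle k; have := hbr k; omega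
  have hI := inside_endCoord hP hΓ hi
  have key : ∀ k : Fin g, D (Γ.vSuccPoint k.castSucc) = 0 ∧ D (Γ.wPoint k.succ) = 0 ∧
      degOn D (bot k) = 0 ∧ ∀ t h0 h1, D (Point.inner (top k) t h0 h1) =
        if endCoord Γ p P i k = t then (if p k i = P k then 0 else 1) else 0 := by
    intro k
    have e1 := hσ k.castSucc
    have e2 := hσ k.succ
    have e3 := hbr k.castSucc
    rw [Fin.val_castSucc] at e1
    rw [Fin.val_succ, hP.step k k.2 i hi] at e2
    by_cases hp : p k i = P k
    · rw [if_pos hp] at e2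
      obtain ⟨-, f1, f2, f3, f4⟩ := hb.eq_special hP hΓ hD k
        (by have := hP.le k k.2.le i hi; omega) (by omega)
      refine ⟨f1, f2, f4, fun t g0 g1 => ?_⟩
      rw [apply_eq_zero_of_degOn_eq_zero hD f3]
      simp [hp]
    · rw [if_neg hp] at e2
      rw [if_neg hp]
      exact hb.loop_chip hP hΓ hD k hi (by omega) (by omega) hp
  ext q
  rcases q with (k | k) | ⟨k | k | k, t, g0, g1⟩
  · refine Fin.cases ?_ (fun k => ?_) k
    · exact h0.trans (endDivisor_w_zero hP hΓ hi).symm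
    · exact (key k).2.1.trans (endDivisor_w_succ hP hΓ hi k).symm
  · refine Fin.lastCases ?_ (fun k => ?_) k
    · exact hl.trans (endDivisor_v_last hP hΓ hi).symm
    · exact (key k).1.trans (endDivisor_v_castSucc hP hΓ hi k).symm
  · rw [(key k).2.2.2, endDivisor, loopDivisor_top hI]
  · rw [apply_eq_zero_of_degOn_eq_zero hD (key k).2.2.1, endDivisor, loopDivisor_bot hI]
    simp
  · rw [apply_eq_zero_of_degOn_eq_zero hD (hbr k), endDivisor, loopDivisor_bridge hI]

end uniqueness

section

variable (hP : SlopePath g r s p P) (hΓ : ShortBottoms Γ)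

include hP hΓ

theorem isEndDivisor_endDivisor (i : Fin (r + 1)) :
    Γ.IsEndDivisor r (baseDivisor Γ r s P) i (endDivisor Γ r p P i) := by
  have hi : (i : ℕ) ≤ r := by omega
  exact ⟨endDivisor_nonneg hP hΓ hi, linEquiv_iff.2 ⟨_, _, _, balanced_endDivisor hP hΓ hi⟩,
    endDivisor_w_zero hP hΓ hi, endDivisor_v_last hP hΓ hi⟩

theorem vertexAvoiding_baseDivisor : Γ.VertexAvoiding r (baseDivisor Γ r s P) := by
  intro i
  have hi : (i : ℕ) ≤ r := by omega
  refine ⟨_, isEndDivisor_endDivisor hP hΓ i, ?_, fun k => ⟨endDivisor_v_castSucc hP hΓ hi k,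
    endDivisor_w_succ hP hΓ hi k⟩⟩
  rintro D ⟨h1, h2, h3, h4⟩
  obtain ⟨κt, κb, σ, hb⟩ := linEquiv_iff.1 h2
  exact hb.eq_endDivisor hP hΓ h1 hi h3 h4

/-- A representative with `r + 1` chips at `w_0` would start with a negative slope, but `slope_ge`
for `i = r`, which needs no chips at the right end, bounds this slope below by zero. -/
theorem not_rankAtLeast_baseDivisor : ¬RankAtLeast (baseDivisor Γ r s P) (r + 1) := by
  intro h
  obtain ⟨D', hD', hlin⟩ := h (Finsupp.single (Γ.wPoint 0) (r + 1))
    (Finsupp.single_nonneg.2 (by positivity)) (by rw [deg_single]; push_cast; rfl)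
  obtain ⟨κt, κb, σ, hb⟩ := linEquiv_iff.1 hlin
  set D := D' + Finsupp.single (Γ.wPoint 0) ((r : ℤ) + 1) with hDdef
  have hD : 0 ≤ D := add_nonneg hD' (Finsupp.single_nonneg.2 (by positivity))
  have hb' : Balanced (D - baseDivisor Γ r s P) κt κb σ := by
    convert hb using 1
    rw [hDdef]; abel
  have h0 : (r : ℤ) + 1 ≤ D (Γ.wPoint 0) := by
    rw [hDdef, Finsupp.add_apply, Finsupp.single_eq_same]
    have : 0 ≤ D' (Γ.wPoint 0) := hD' _
    omega
  have hl : 0 ≤ D (Γ.vSuccPoint (Fin.last g)) := hD _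
  have h1 := hb'.slope_ge hP hΓ hD le_rfl (by omega) 0
  have h2 := degOn_nonneg hD (bridge 0)
  have h3 := hb'.start_eq
  rw [Fin.val_zero, hP.start r le_rfl] at h1
  omega

end

end ChainOfLoops

/-! ### The lower bound for the rank -/

/-- A divisor of degree one on a circle made of arcs of lengths `ℓ` and `m` is equivalent to a
point of the circle. -/
theorem exists_loop_point {ℓ m : ℝ} (hℓ : 0 < ℓ) (hm : 0 < m) (R : ℝ) :
    ∃ (κ cv cw d d' : ℤ) (a b : ℝ), 0 ≤ cv ∧ 0 ≤ cw ∧ 0 ≤ d ∧ 0 ≤ d' ∧ cv + cw + d + d' = 1 ∧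
      (0 < a ∧ a < ℓ) ∧ (0 < b ∧ b < m) ∧
      κ * (ℓ + m) = R + d * (ℓ - a) - d' * (m - b) - cv * m := by
  have hL : 0 < ℓ + m := by linarith
  set κ := ⌈R / (ℓ + m)⌉ with hκ
  have h1 : R ≤ κ * (ℓ + m) := by
    have := Int.le_ceil (R / (ℓ + m))
    rwa [div_le_iff₀ hL] at this
  have h2 : κ * (ℓ + m) < R + (ℓ + m) := by
    have := Int.ceil_lt_add_one (R / (ℓ + m))
    rw [← hκ, ← sub_lt_iff_lt_add, lt_div_iff₀ hL] at this
    linarith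
  have ha : 0 < ℓ / 2 ∧ ℓ / 2 < ℓ := by constructor <;> linarith
  have hb : 0 < m / 2 ∧ m / 2 < m := by constructor <;> linarith
  -- The remainder of `R` modulo the circumference decides whether the point is `w`, inside the top
  -- edge, `v` or inside the bottom edge.
  rcases h1.eq_or_lt with h | h
  · exact ⟨κ, 0, 1, 0, 0, ℓ / 2, m / 2, by simp, by simp, by simp, by simp, by simp, ha, hb,
      by push_cast; linarith⟩
  rcases lt_trichotomy (κ * (ℓ + m)) (R + ℓ) with h3 | h3 | h3
  · exact ⟨κ, 0, 0, 1, 0, R + ℓ - κ * (ℓ + m), m / 2, by simp, by simp, by simp, by simp, by simp,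
      ⟨by linarith, by linarith⟩, hb, by push_cast; linarith⟩
  · exact ⟨κ - 1, 1, 0, 0, 0, ℓ / 2, m / 2, by simp, by simp, by simp, by simp, by simp, ha, hb,
      by push_cast; linarith⟩
  · exact ⟨κ - 1, 0, 0, 0, 1, ℓ / 2, κ * (ℓ + m) - ℓ - R, by simp, by simp, by simp, by simp,
      by simp, ha, ⟨by linarith, by linarith⟩, by push_cast; linarith⟩

theorem Fin.apply_last_eq_sum {n : ℕ} (u : Fin (n + 1) → ℤ) (d : Fin n → ℤ)
    (h : ∀ k : Fin n, u k.succ = u k.castSucc + d k) : u (Fin.last n) = u 0 + ∑ k, d k := by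
  induction n with
  | zero => simp
  | succ n ih =>
    have := ih (fun k => u k.castSucc) (fun k => d k.castSucc) fun k => h k.castSucc
    rw [Fin.sum_univ_castSucc, ← Fin.succ_last, h]
    simp only [Fin.castSucc_zero] at this
    rw [this]; ring

theorem SlopePath.gap {g r s : ℕ} {p : ℕ → ℕ → ℤ} {P : ℕ → ℤ} (hP : SlopePath g r s p P) {k : ℕ}
    (hk : k ≤ g) (i d : ℕ) (h : i + d ≤ r) : p k (i + d) + d ≤ p k i := by
  induction d with
  | zero => simp
  | succ d ih =>
    have h1 := ih (by omega)
    have h2 := hP.anti k hk (i + d) (i + (d + 1)) (by omega) h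
    push_cast
    omega

namespace ChainOfLoops

open MetricGraph

variable {g r s : ℕ} {Γ : ChainOfLoops g} {p : ℕ → ℕ → ℤ} {P : ℕ → ℤ}

theorem deg_eq_sum_chain (F : Γ.graph.Divisor) :
    deg F = F (Γ.wPoint 0) + ∑ k : Fin g, (degOn F (bridge k.castSucc) +
      (F (Γ.vSuccPoint k.castSucc) + degOn F (top k) + degOn F (bot k) + F (Γ.wPoint k.succ))) +
      degOn F (bridge (Fin.last g)) + F (Γ.vSuccPoint (Fin.last g)) := by
  rw [deg_eq_sum, Fintype.sum_sum_type, Fintype.sum_sum_type, Fintype.sum_sum_type,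
    Fin.sum_univ_succ, Fin.sum_univ_castSucc (f := fun k => F (Point.vertex (Sum.inr k))),
    Fin.sum_univ_castSucc (f := fun k => degOn F (Sum.inr (Sum.inr k)))]
  simp only [Finset.sum_add_distrib, wPoint, vSuccPoint]
  ring

/-- On each bridge take the slope of the path whose index is the number of chips of `F` already
passed. Since the slopes of the path are strictly decreasing in the index, passing a chip makes the
slope drop by at least one, as much as subtracting that chip requires. What remains on each loop has
nonnegative degree and can be made effective there. -/
theorem rankAtLeast_baseDivisor (hP : SlopePath g r s p P) :
    RankAtLeast (baseDivisor Γ r s P) r := by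
  intro F hF hdeg
  set Fb : Fin (g + 1) → ℤ := fun k => degOn F (bridge k) with hFb
  set Fl : Fin g → ℤ := fun k => F (Γ.vSuccPoint k.castSucc) + degOn F (top k) + degOn F (bot k) +
    F (Γ.wPoint k.succ) with hFl
  have hv0 : ∀ k, 0 ≤ F (Γ.vSuccPoint k) := fun k => hF _
  have hw0 : ∀ k, 0 ≤ F (Γ.wPoint k) := fun k => hF _
  have he0 : ∀ e : Edge g, 0 ≤ degOn F e := degOn_nonneg hF
  have hFb0 : ∀ k, 0 ≤ Fb k := fun k => he0 _
  have hFl0 : ∀ k, 0 ≤ Fl k := fun k => by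
    have := hv0 k.castSucc; have := hw0 k.succ; have := he0 (top k); have := he0 (bot k)
    simp only [hFl]; omega
  let acc : Fin (g + 1) → ℤ := Fin.induction (motive := fun _ => ℤ) (F (Γ.wPoint 0))
    (fun k x => x + (Fb k.castSucc + Fl k))
  have hacc : ∀ k : Fin g, acc k.succ = acc k.castSucc + (Fb k.castSucc + Fl k) := fun k => by
    simp only [acc, Fin.induction_succ]
  have hacc0 : acc 0 = F (Γ.wPoint 0) := by simp only [acc, Fin.induction_zero]
  have htot : acc (Fin.last g) + Fb (Fin.last g) + F (Γ.vSuccPoint (Fin.last g)) = r := by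
    rw [Fin.apply_last_eq_sum acc _ hacc, hacc0, ← hdeg, deg_eq_sum_chain]
  have hacc_nonneg : ∀ k, 0 ≤ acc k := fun k => by
    induction k using Fin.induction with
    | zero => rw [hacc0]; exact hw0 0
    | succ k ih => rw [hacc]; have := hFb0 k.castSucc; have := hFl0 k; omega
  have hacc_le : ∀ k, acc k + Fb k ≤ r := fun k => by
    induction k using Fin.reverseInduction with
    | last => have := hv0 (Fin.last g); omega
    | cast k ih => rw [hacc] at ih; have := hFb0 k.succ; have := hFl0 k; omega
  -- `acc k` counts the chips of `F` to the left of the bridge `k`, including those at `w_k`.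
  set n : Fin (g + 1) → ℕ := fun k => (acc k).toNat with hn
  have hnacc : ∀ k, (n k : ℤ) = acc k := fun k => Int.toNat_of_nonneg (hacc_nonneg k)
  set σ : Fin (g + 1) → ℤ := fun k => p k (n k) with hσ
  -- The number of chips that must be placed on the loop. If it is zero, the slope is special and
  -- `F` misses the loop, so the zero solution closes up; if it is positive, one chip can be moved
  -- so as to close the loop.
  set e : Fin g → ℤ := fun k => σ k.castSucc - Fb k.castSucc - σ k.succ + 1 - Fl k with he
  have hekey : ∀ k : Fin g, 0 ≤ e k ∧
      (e k = 0 → σ k.castSucc - Fb k.castSucc = P k ∧ Fl k = 0) := by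
    intro k
    have h1 := hacc_le k.castSucc
    have h2 := hnacc k.castSucc
    have h3 := hnacc k.succ
    have h4 := hacc k
    have h5 := hFb0 k.castSucc
    have h6 := hFl0 k
    have h7 := hacc_le k.succ
    have h8 := hFb0 k.succ
    obtain ⟨nb, hnb⟩ := Int.eq_ofNat_of_zero_le h5
    obtain ⟨nl, hnl⟩ := Int.eq_ofNat_of_zero_le h6
    have h9 : n k.succ = n k.castSucc + nb + nl := by omega
    have g1 := hP.gap k.2.le (n k.castSucc) nb (by omega)
    have g2 := hP.gap (k := k + 1) k.2 (n k.castSucc + nb) nl (by omega)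
    have g3 := hP.step k k.2 (n k.castSucc + nb) (by omega)
    have g4 := hP.gap k.2.le (n k.castSucc + nb) nl (by omega)
    have g5 := hP.step k k.2 (n k.castSucc + nb + nl) (by omega)
    have e1 : σ k.castSucc = p k (n k.castSucc) := rfl
    have e2 : σ k.succ = p (k + 1) (n k.castSucc + nb + nl) := by rw [← h9]; rfl
    simp only [he]
    rw [e1, e2]
    rcases Nat.eq_zero_or_pos nl with hz | hz
    · subst hz
      simp only [Nat.cast_zero, add_zero] at *
      split_ifs at g3 with hs <;> constructor <;> omega
    · by_cases hs : p k (n k.castSucc + nb) = P k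
      · have : p k (n k.castSucc + nb + nl) ≠ P k := by omega
        rw [if_neg this] at g5
        constructor <;> omega
      · rw [if_neg hs] at g3
        constructor <;> omega
  have hloop : ∀ k : Fin g, ∃ (κ cv cw d d' : ℤ) (a b : ℝ), 0 ≤ cv ∧ 0 ≤ cw ∧ 0 ≤ d ∧ 0 ≤ d' ∧
      cv + cw + d + d' = e k ∧ (0 < a ∧ a < Γ.topLen (k + 1)) ∧ (0 < b ∧ b < Γ.botLen (k + 1)) ∧
      κ * (Γ.topLen (k + 1) + Γ.botLen (k + 1)) =
        ((σ k.castSucc - Fb k.castSucc - cv - P k - F (Γ.vSuccPoint k.castSucc) : ℤ) : ℝ) *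
          Γ.botLen (k + 1) + d * (Γ.topLen (k + 1) - a) - d' * (Γ.botLen (k + 1) - b) +
        hinge F (top k) (Γ.topLen (k + 1)) - hinge F (bot k) (Γ.botLen (k + 1)) := by
    intro k
    have hm := Γ.bot_pos k
    have hℓ := Γ.top_pos k
    obtain ⟨hk0, hk1⟩ := hekey k
    rcases hk0.eq_or_lt with hk | hk
    · obtain ⟨h1, h2⟩ := hk1 hk.symm
      have := hv0 k.castSucc
      have := hw0 k.succ
      have := he0 (top k)
      have := he0 (bot k)
      simp only [hFl] at h2
      have hv : F (Γ.vSuccPoint k.castSucc) = 0 := by omega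
      refine ⟨0, 0, 0, 0, 0, Γ.topLen (k + 1) / 2, Γ.botLen (k + 1) / 2, le_rfl, le_rfl, le_rfl,
        le_rfl, by omega, by constructor <;> linarith, by constructor <;> linarith, ?_⟩
      rw [hinge_eq_zero_of_degOn_eq_zero hF (by omega : degOn F (top k) = 0),
        hinge_eq_zero_of_degOn_eq_zero hF (by omega : degOn F (bot k) = 0), h1, hv]
      simp
    -- All but one of the chips are put at the left vertex of the loop; the last one is placed by
    -- inversion on the circle.
    · obtain ⟨κ, cv, cw, d, d', a, b, h1, h2, h3, h4, h5, h6, h7, h8⟩ := exists_loop_point hℓ hm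
        (((σ k.castSucc - Fb k.castSucc - (e k - 1) - P k - F (Γ.vSuccPoint k.castSucc) : ℤ) : ℝ) *
          Γ.botLen (k + 1) +
        hinge F (top k) (Γ.topLen (k + 1)) - hinge F (bot k) (Γ.botLen (k + 1)))
      refine ⟨κ, e k - 1 + cv, cw, d, d', a, b, by omega, h2, h3, h4, by omega, h6, h7, ?_⟩
      rw [h8]
      push_cast
      ring
  choose κ cv cw d d' a b h1 h2 h3 h4 h5 h6 h7 h8 using hloop
  have hI : Inside Γ a b := fun k => ⟨h6 k, h7 k⟩
  set c : Vertex g → ℤ := Sum.elim (Fin.cases (r - σ 0 - F (Γ.wPoint 0)) cw)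
    (Fin.lastCases (σ (Fin.last g) - Fb (Fin.last g) - s - F (Γ.vSuccPoint (Fin.last g))) cv) with hc
  have hc0 : 0 ≤ r - σ 0 - F (Γ.wPoint 0) := by
    have h1 := hnacc 0
    have h2 := hacc_le 0
    have h3 := hFb0 0
    have : σ 0 = r - n 0 := hP.start _ (by omega)
    omega
  have hcl : 0 ≤ σ (Fin.last g) - Fb (Fin.last g) - s - F (Γ.vSuccPoint (Fin.last g)) := by
    have h1 := hnacc (Fin.last g)
    have h2 := hacc_le (Fin.last g)
    have h3 := hFb0 (Fin.last g)
    have : σ (Fin.last g) = r - n (Fin.last g) + s := hP.finish _ (by omega)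
    omega
  refine ⟨loopDivisor Γ c a b d d', loopDivisor_nonneg hI ?_ h3 h4, linEquiv_iff.2
    ⟨κ, fun k => σ k.castSucc - Fb k.castSucc - cv k - P k - F (Γ.vSuccPoint k.castSucc) - κ k, σ,
      ?_, fun k => ?_, fun k => ?_, ?_, fun k => ?_⟩⟩
  · rintro (k | k)
    · refine Fin.cases ?_ (fun k => ?_) k
      · exact hc0
      · exact h2 k
    · refine Fin.lastCases ?_ (fun k => ?_) k
      · simpa [hc] using hcl
      · simpa [hc] using h1 k
  · have : loopDivisor Γ c a b d d' (Γ.wPoint 0) = r - σ 0 - F (Γ.wPoint 0) :=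
      loopDivisor_vertex hI _
    rw [Finsupp.sub_apply, Finsupp.sub_apply, baseDivisor_w_zero, this]
    ring
  · have : loopDivisor Γ c a b d d' (Γ.vSuccPoint k.castSucc) = cv k := by
      refine (loopDivisor_vertex hI _).trans ?_
      simp [hc]
    rw [Finsupp.sub_apply, Finsupp.sub_apply, baseDivisor_v_castSucc, this, degOn_sub, degOn_sub,
      degOn_baseDivisor, degOn_loopDivisor_bridge hI]
    simp only [hFb]
    ring
  · have : loopDivisor Γ c a b d d' (Γ.wPoint k.succ) = cw k := loopDivisor_vertex hI _
    have h5k := h5 k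
    simp only [he, hFl] at h5k
    rw [Finsupp.sub_apply, Finsupp.sub_apply, baseDivisor_w_succ, this, degOn_sub, degOn_sub,
      degOn_sub, degOn_sub, degOn_baseDivisor, degOn_baseDivisor, degOn_loopDivisor_top hI,
      degOn_loopDivisor_bot hI]
    omega
  · have : loopDivisor Γ c a b d d' (Γ.vSuccPoint (Fin.last g)) =
        σ (Fin.last g) - Fb (Fin.last g) - s - F (Γ.vSuccPoint (Fin.last g)) := by
      refine (loopDivisor_vertex hI _).trans ?_
      simp [hc]
    rw [Finsupp.sub_apply, Finsupp.sub_apply, baseDivisor_v_last, this, degOn_sub, degOn_sub,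
      degOn_baseDivisor, degOn_loopDivisor_bridge hI]
    simp only [hFb]
    ring
  · rw [hinge_sub, hinge_sub, hinge_sub, hinge_sub, hinge_baseDivisor, hinge_baseDivisor,
      hinge_loopDivisor_top hI, hinge_loopDivisor_bot hI, max_eq_right (by linarith [(h6 k).2]),
      max_eq_right (by linarith [(h7 k).2])]
    have := h8 k
    push_cast at this ⊢
    linarith

theorem hasRank_baseDivisor (hP : SlopePath g r s p P) (hΓ : ShortBottoms Γ) :
    HasRank (baseDivisor Γ r s P) r :=
  ⟨rankAtLeast_baseDivisor hP, not_rankAtLeast_baseDivisor hP hΓ⟩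

end ChainOfLoops

/-! ### Dependences along the chain, and the block on which they are concentrated -/

section MinTwice

variable {ι : Type*} {A : Finset ι} {f : ι → ℝ}

/-- The minimum of `f` on `A` is attained at least twice. -/
def MinTwice (A : Finset ι) (f : ι → ℝ) : Prop :=
  ∃ i ∈ A, ∃ j ∈ A, i ≠ j ∧ f i = f j ∧ ∀ k ∈ A, f i ≤ f k

/-- The minimum of `f` on `A` is attained at `i`. -/
def AttainsMin (A : Finset ι) (f : ι → ℝ) (i : ι) : Prop := i ∈ A ∧ ∀ k ∈ A, f i ≤ f k

theorem MinTwice.exists_attainsMin (h : MinTwice A f) :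
    ∃ i j, i ≠ j ∧ AttainsMin A f i ∧ AttainsMin A f j := by
  obtain ⟨i, hi, j, hj, hne, he, hk⟩ := h
  exact ⟨i, j, hne, ⟨hi, hk⟩, ⟨hj, fun k hk' => he ▸ hk k hk'⟩⟩

theorem minTwice_of_attainsMin {i j : ι} (hne : i ≠ j) (hi : AttainsMin A f i)
    (hj : AttainsMin A f j) : MinTwice A f :=
  ⟨i, hi.1, j, hj.1, hne, le_antisymm (hi.2 j hj.1) (hj.2 i hi.1), hi.2⟩

/-- At a general point of an interval, all the minimal ones of finitely many affine functions have
the same slope. -/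
theorem exists_common_slope (w : ι → ℝ) (S : ι → ℤ) {a b : ℝ} (hab : a < b) (hA : A.Nonempty) :
    ∃ x, a < x ∧ x < b ∧ ∃ σ : ℤ, ∀ i, AttainsMin A (fun i => w i + S i * x) i → S i = σ := by
  classical
  -- The finitely many crossings of functions of different slopes.
  set bad : Set ℝ := ⋃ i ∈ A, ⋃ j ∈ A, {x | S i ≠ S j ∧ w i + S i * x = w j + S j * x} with hbad
  have hfin : bad.Finite := by
    refine A.finite_toSet.biUnion fun i _ => A.finite_toSet.biUnion fun j _ => ?_
    refine Set.Subsingleton.finite ?_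
    rintro x ⟨h1, h2⟩ y ⟨-, h3⟩
    have h4 : ((S i : ℝ) - S j) * (x - y) = 0 := by linarith
    rcases mul_eq_zero.1 h4 with h | h
    · exact absurd (by exact_mod_cast sub_eq_zero.1 h) h1
    · linarith
  obtain ⟨x, hx, hxb⟩ := (Set.Ioo_infinite hab).exists_notMem_finite hfin
  obtain ⟨i, hi, hmin⟩ := A.exists_min_image (fun i => w i + S i * x) hA
  refine ⟨x, hx.1, hx.2, S i, fun j hj => ?_⟩
  by_contra hne
  refine hxb (Set.mem_biUnion hj.1 (Set.mem_biUnion hi ⟨hne, ?_⟩))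
  exact le_antisymm (hj.2 i hi) (hmin j hj.1)

end MinTwice

/-- Functions on a chain of loops that are affine on the bridges: `S k I` is the slope of the
function `I` on the bridge `k` of length `n k`, `w k I` its value at the start of that bridge, and
`m (k + 1) * U k I`, `m (k + 1) * H k I` are its changes from the start of the loop `k + 1` to its
end and to the middle of its top edge.  At all these points the minimum occurs twice. -/
structure DependentChain {ι : Type*} (A : Finset ι) (g : ℕ) (n m : ℕ → ℝ) (S U H : ℕ → ι → ℤ)
    (w : ℕ → ι → ℝ) (Λ : ℝ) : Prop where
  step : ∀ k < g, ∀ I ∈ A, w (k + 1) I = w k I + S k I * n k + m (k + 1) * U k I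
  bridge : ∀ k ≤ g, ∀ x, 0 ≤ x → x ≤ n k → MinTwice A fun I => w k I + S k I * x
  loop : ∀ k < g, MinTwice A fun I => w k I + S k I * n k + m (k + 1) * H k I
  boundS : ∀ k ≤ g, ∀ I ∈ A, |(S k I : ℝ)| ≤ Λ
  boundU : ∀ k < g, ∀ I ∈ A, |(U k I : ℝ)| ≤ Λ
  boundH : ∀ k < g, ∀ I ∈ A, |(H k I : ℝ)| ≤ Λ

theorem abs_mul_sub_mul_le {a b x Λ : ℝ} (ha : |a| ≤ Λ) (hb : |b| ≤ Λ) (hx : 0 ≤ x) :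
    |x * a - x * b| ≤ 2 * Λ * x := by
  rw [← mul_sub, abs_mul, abs_of_nonneg hx]
  have := abs_sub a b
  nlinarith [abs_nonneg (a - b)]

namespace DependentChain

variable {ι : Type*} {A : Finset ι} {g : ℕ} {n m ℓ : ℕ → ℝ} {S U H : ℕ → ι → ℤ} {w : ℕ → ι → ℝ}
  {Λ : ℝ}

/-- The total length of the first `t` loops after the bridge `a` and of the bridges between them. -/
def partLen (n ℓ : ℕ → ℝ) (a t : ℕ) : ℝ :=
  ∑ i ∈ Finset.range t, ℓ (a + 1 + i) + ∑ i ∈ Finset.range (t - 1), n (a + 1 + i)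

/-- Differences of two functions change at rate at most `2 * Λ` along bridges and bottom edges, so
they hardly vary over a block compared with the long bridges around it. -/
theorem abs_diff_le (h : DependentChain A g n m S U H w Λ) {a s : ℕ} (has : a + s ≤ g)
    (hn : ∀ k ≤ g, 0 < n k) (hm : ∀ k, 1 ≤ k → k ≤ g → 0 < m k ∧ m k < ℓ k) {I J : ι}
    (hI : I ∈ A) (hJ : J ∈ A) (t : ℕ) (ht : t < s) :
    |(w (a + (t + 1)) I - w (a + (t + 1)) J) -
      ((w a I + S a I * n a) - (w a J + S a J * n a))| ≤ 2 * Λ * partLen n ℓ a (t + 1) := by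
  have hΛ : 0 ≤ Λ := (abs_nonneg _).trans (h.boundS a (by omega) I hI)
  induction t with
  | zero =>
    obtain ⟨hm0, hm1⟩ := hm (a + 1) (by omega) (by omega)
    have hU := abs_mul_sub_mul_le (h.boundU a (by omega) I hI) (h.boundU a (by omega) J hJ) hm0.le
    rw [zero_add, h.step a (by omega) I hI, h.step a (by omega) J hJ]
    have e : partLen n ℓ a 1 = ℓ (a + 1) := by simp [partLen]
    rw [e]
    refine le_trans (le_of_eq ?_) (hU.trans (by gcongr))
    congr 1; ring
  | succ t ih =>
    have ih' := ih (by omega)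
    obtain ⟨hm0, hm1⟩ := hm (a + (t + 1) + 1) (by omega) (by omega)
    have hU := abs_mul_sub_mul_le (h.boundU (a + (t + 1)) (by omega) I hI)
      (h.boundU (a + (t + 1)) (by omega) J hJ) hm0.le
    have hS := abs_mul_sub_mul_le (h.boundS (a + (t + 1)) (by omega) I hI)
      (h.boundS (a + (t + 1)) (by omega) J hJ) (hn (a + (t + 1)) (by omega)).le
    have e1 : partLen n ℓ a (t + 1 + 1) =
        partLen n ℓ a (t + 1) + n (a + (t + 1)) + ℓ (a + (t + 1) + 1) := by
      simp only [partLen, Nat.add_sub_cancel]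
      rw [Finset.sum_range_succ (n := t + 1), Finset.sum_range_succ (n := t) (f := fun i => n _),
        show a + 1 + t = a + (t + 1) by ring, show a + 1 + (t + 1) = a + (t + 1) + 1 by ring]
      ring
    rw [e1, show a + (t + 1 + 1) = a + (t + 1) + 1 by ring, h.step _ (by omega) I hI,
      h.step _ (by omega) J hJ]
    rw [abs_le] at ih' hU hS ⊢
    have : 2 * Λ * m (a + (t + 1) + 1) ≤ 2 * Λ * ℓ (a + (t + 1) + 1) := by gcongr
    constructor <;> nlinarith

set_option maxHeartbeats 1600000 in
/-- On some block, only functions whose class is the index of the block attain the minimum, and the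
slopes of those that attain it are monotone in the expected sense. -/
theorem exists_block (h : DependentChain A g n m S U H w Λ) {r s : ℕ} (hs : 1 ≤ s)
    (hg : (r + 1) * s ≤ g) (hn : ∀ k ≤ g, 0 < n k)
    (hm : ∀ k, 1 ≤ k → k ≤ g → 0 < m k ∧ m k < ℓ k)
    (hℓ : ∀ k, 1 ≤ k → k ≤ g → 100 * (Λ + 1) ^ 2 * ℓ k ≤ min (n (k - 1)) (n k))
    (hblock : ∀ α ≤ r, 100 * (Λ + 1) ^ 2 * partLen n ℓ (α * s) s ≤
      min (n (α * s)) (n ((α + 1) * s)))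
    (κ : ι → ℕ) (hκ : ∀ I ∈ A, κ I ≤ r)
    (hsep : ∀ α, 1 ≤ α → α ≤ r → ∀ I ∈ A, ∀ J ∈ A, κ I < α → α ≤ κ J →
      S (α * s) J + 1 ≤ S (α * s) I) :
    ∃ α ≤ r, ∃ (x : ℕ → ℝ) (σ : ℕ → ℤ),
      (∀ t ≤ s, MinTwice A (fun I => w (α * s + t) I + S (α * s + t) I * x t) ∧
        ∀ I, AttainsMin A (fun I => w (α * s + t) I + S (α * s + t) I * x t) I →
          κ I = α ∧ S (α * s + t) I = σ t) ∧
      ∀ t < s, ∀ I, AttainsMin A (fun I => w (α * s + t) I + S (α * s + t) I * n (α * s + t) +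
          m (α * s + t + 1) * H (α * s + t) I) I →
        κ I = α ∧ S (α * s + t) I ≤ σ t ∧ σ (t + 1) ≤ S (α * s + (t + 1)) I := by
  classical
  have hbr : ∀ β ≤ r + 1, β * s ≤ g := fun β hβ => le_trans (Nat.mul_le_mul_right s hβ) hg
  obtain ⟨I₀, hI₀⟩ : ∃ I, I ∈ A := by
    obtain ⟨i, j, -, hi, -⟩ := (h.bridge 0 (by omega) 0 le_rfl (hn 0 (by omega)).le).exists_attainsMin
    exact ⟨i, hi.1⟩
  have hΛ : 0 ≤ Λ := (abs_nonneg _).trans (h.boundS 0 (by omega) I₀ hI₀)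
  have hmid : ∀ β ≤ r + 1, ∃ I, AttainsMin A
      (fun I => w (β * s) I + S (β * s) I * (n (β * s) / 2)) I := by
    intro β hβ
    have := hn _ (hbr β hβ)
    obtain ⟨i, j, -, hi, -⟩ := (h.bridge _ (hbr β hβ) (n (β * s) / 2) (by linarith)
      (by linarith)).exists_attainsMin
    exact ⟨i, hi⟩
  -- the block
  obtain ⟨α, hα, ⟨L, hL, hLκ⟩, R, hR, hRκ⟩ : ∃ α ≤ r,
      (∃ L, AttainsMin A (fun I => w (α * s) I + S (α * s) I * (n (α * s) / 2)) L ∧ α ≤ κ L) ∧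
      ∃ R, AttainsMin A
        (fun I => w ((α + 1) * s) I + S ((α + 1) * s) I * (n ((α + 1) * s) / 2)) R ∧ κ R ≤ α := by
    have hex : ∃ β, β ≤ r ∧ ∃ R, AttainsMin A
        (fun I => w ((β + 1) * s) I + S ((β + 1) * s) I * (n ((β + 1) * s) / 2)) R ∧ κ R ≤ β := by
      obtain ⟨I, hI⟩ := hmid (r + 1) le_rfl
      exact ⟨r, le_rfl, I, hI, hκ I hI.1⟩
    -- The first block after which a minimal function has class at most the index of the block. By
    -- minimality, on the bridge before this block every function that is minimal at the midpoint
    -- has class at least the index.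
    refine ⟨Nat.find hex, (Nat.find_spec hex).1, ?_, (Nat.find_spec hex).2⟩
    have hle := (Nat.find_spec hex).1
    obtain ⟨L, hL⟩ := hmid (Nat.find hex) (by omega)
    refine ⟨L, hL, ?_⟩
    by_contra! hcon
    have h1 : 1 ≤ Nat.find hex := by omega
    have h2 : Nat.find hex - 1 + 1 = Nat.find hex := by omega
    refine Nat.find_min hex (m := Nat.find hex - 1) (by omega) ⟨by omega, L, ?_, by omega⟩
    rw [h2]; exact hL
  set a := α * s with ha
  have has : (α + 1) * s = a + s := by rw [ha]; ring
  have hasg : a + s ≤ g := has ▸ hbr (α + 1) (by omega)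
  have hbl := hblock α hα
  rw [← ha, has] at hbl
  rw [has] at hR
  set Q := partLen n ℓ a s with hQ
  have hℓpos : ∀ i < s, 0 < ℓ (a + 1 + i) := fun i hi => by
    have := hm (a + 1 + i) (by omega) (by omega); linarith
  have hnpos : ∀ i < s - 1, 0 < n (a + 1 + i) := fun i hi => hn _ (by omega)
  have hpart_mono : ∀ t ≤ s, partLen n ℓ a t ≤ Q := by
    intro t ht
    refine add_le_add ?_ ?_
    · exact Finset.sum_le_sum_of_subset_of_nonneg (Finset.range_mono ht)
        fun i hi _ => (hℓpos i (Finset.mem_range.1 hi)).le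
    · exact Finset.sum_le_sum_of_subset_of_nonneg (Finset.range_mono (by omega))
        fun i hi _ => (hnpos i (Finset.mem_range.1 hi)).le
  have hn_le : ∀ t, 1 ≤ t → t < s → n (a + t) ≤ Q := by
    intro t h1 h2
    have e : n (a + t) = (fun i => n (a + 1 + i)) (t - 1) := by
      simp only; congr 1; omega
    have h3 := Finset.single_le_sum (f := fun i => n (a + 1 + i))
      (fun i hi => (hnpos i (Finset.mem_range.1 hi)).le)
      (Finset.mem_range.2 (by omega : t - 1 < s - 1))
    have h4 : 0 ≤ ∑ i ∈ Finset.range s, ℓ (a + 1 + i) :=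
      Finset.sum_nonneg fun i hi => (hℓpos i (Finset.mem_range.1 hi)).le
    rw [e]
    simp only [hQ, partLen]
    linarith
  have hℓ_le : ∀ t < s, ℓ (a + t + 1) ≤ Q := by
    intro t h2
    have e : ℓ (a + t + 1) = (fun i => ℓ (a + 1 + i)) t := by
      simp only; congr 1; omega
    have h3 := Finset.single_le_sum (f := fun i => ℓ (a + 1 + i))
      (fun i hi => (hℓpos i (Finset.mem_range.1 hi)).le) (Finset.mem_range.2 h2)
    have h4 : 0 ≤ ∑ i ∈ Finset.range (s - 1), n (a + 1 + i) :=
      Finset.sum_nonneg fun i hi => (hnpos i (Finset.mem_range.1 hi)).le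
    rw [e]
    simp only [hQ, partLen]
    linarith
  have hQpos : 0 < Q := lt_of_lt_of_le (by simpa using hℓpos 0 (by omega)) (hℓ_le 0 (by omega))
  have hm_le : ∀ t < s, 0 < m (a + t + 1) ∧ m (a + t + 1) ≤ Q := fun t ht => by
    have h1 := hm (a + t + 1) (by omega) (by omega)
    exact ⟨h1.1, h1.2.le.trans (hℓ_le t ht)⟩
  -- A distance after which a difference of one in slope outweighs all changes on a loop, namely `2
  -- * Λ` for `H` plus `2 * Λ` for `U` per unit of bottom length. The bound `B` covers the drift
  -- inside the block and over a stretch of length `2 * X` of the outer bridges.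
  set X := (4 * Λ + 1) * Q with hX
  have hXpos : 0 < X := by positivity
  set B := 6 * Λ * Q + 4 * Λ * X with hB
  have hna : 100 * (Λ + 1) ^ 2 * Q ≤ n a := hbl.trans (min_le_left _ _)
  have hnb : 100 * (Λ + 1) ^ 2 * Q ≤ n (a + s) := hbl.trans (min_le_right _ _)
  have hbig : 4 * B < 100 * (Λ + 1) ^ 2 * Q := by
    simp only [hB, hX]
    have : 0 ≤ Λ * Q := by positivity
    nlinarith [mul_nonneg hΛ this]
  have hbigX : 4 * X < 100 * (Λ + 1) ^ 2 * Q := by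
    simp only [hX]
    have : 0 ≤ Λ * Q := by positivity
    nlinarith [mul_nonneg hΛ this]
  have hB0 : 0 ≤ B := by positivity
  -- values close to those at the start of the block
  have hnear : ∀ val : ι → ℝ, (∀ I ∈ A, ∀ J ∈ A, |(val I - val J) -
      ((w a I + S a I * n a) - (w a J + S a J * n a))| ≤ B) →
      ∀ I, AttainsMin A val I → κ I = α := by
    intro val hval I hI
    rcases lt_trichotomy (κ I) α with hlt | heq | hgt
    · exfalso
      -- On the bridge before the block `I` is steeper than `L`, which is minimal at the midpoint;
      -- over the second half of the bridge `I` rises above `L` by more than `B`.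
      have h1 := hsep α (by omega) hα I hI.1 L hL.1 hlt hLκ
      rw [← ha] at h1
      have h1' : (S a L : ℝ) + 1 ≤ S a I := by exact_mod_cast h1
      have h2 := hL.2 I hI.1
      have h3 := (abs_le.1 (hval I hI.1 L hL.1)).1
      have h4 := hI.2 L hL.1
      have h5 : 0 < n a := hn _ (by omega)
      simp only at h2
      nlinarith
    · exact heq
    · exfalso
      have hαr : α + 1 ≤ r := by have := hκ I hI.1; omega
      -- Symmetrically, `I` is flatter than `R` on the bridge after the block, so going back from
      -- the midpoint it lies far above `R`.
      have h1 := hsep (α + 1) (by omega) hαr R hR.1 I hI.1 (by omega) hgt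
      rw [has] at h1
      have h1' : (S (a + s) I : ℝ) + 1 ≤ S (a + s) R := by exact_mod_cast h1
      have h2 := hR.2 I hI.1
      have h3 := (abs_le.1 (hval I hI.1 R hR.1)).1
      have h4 := hI.2 R hR.1
      have h5 : 0 < n (a + s) := hn _ (by omega)
      have h6 := h.abs_diff_le hasg hn hm hI.1 hR.1 (s - 1) (by omega)
      rw [show s - 1 + 1 = s by omega, ← hQ] at h6
      have h7 := (abs_le.1 h6).2
      have h8 : 2 * Λ * Q ≤ B := by
        simp only [hB]
        have : 0 ≤ Λ * Q := by positivity
        have : 0 ≤ Λ * X := by positivity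
        linarith
      simp only at h2
      nlinarith
  have hBX : 2 * Λ * (2 * X) ≤ B := by
    simp only [hB]
    have : 0 ≤ Λ * Q := by positivity
    linarith
  have hnear_w : ∀ t, 1 ≤ t → t ≤ s → ∀ I ∈ A, ∀ J ∈ A, |(w (a + t) I - w (a + t) J) -
      ((w a I + S a I * n a) - (w a J + S a J * n a))| ≤ 2 * Λ * Q := by
    intro t h1 h2 I hI J hJ
    have h3 := h.abs_diff_le hasg hn hm hI hJ (t - 1) (by omega)
    rw [show t - 1 + 1 = t by omega] at h3
    exact h3.trans (by have := hpart_mono t h2; gcongr)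
  -- general points on the bridges
  have hpts : ∀ t, ∃ (x : ℝ) (σ : ℤ), t ≤ s → (0 ≤ x ∧ x ≤ n (a + t)) ∧
      (t < s → (4 * Λ + 1) * m (a + t + 1) ≤ n (a + t) - x) ∧
      (1 ≤ t → (4 * Λ + 1) * m (a + t) ≤ x) ∧
      ∀ I, AttainsMin A (fun I => w (a + t) I + S (a + t) I * x) I → κ I = α ∧ S (a + t) I = σ := by
    intro t
    by_cases hts : t ≤ s
    swap
    · exact ⟨0, 0, fun h => absurd h hts⟩
    rcases Nat.eq_zero_or_pos t with ht0 | ht0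
    · subst ht0
      -- On the two outer bridges the point is taken at distance between `X` and `2 * X` from the
      -- block: far enough to compare slopes, near enough for `hnear`. On inner bridges any point of
      -- the middle third will do.
      obtain ⟨x, hx1, hx2, σ, hσ⟩ := exists_common_slope (w a) (S a)
        (show n a - 2 * X < n a - X by linarith) ⟨I₀, hI₀⟩
      have hx0 : 0 ≤ x := by linarith
      have hm0 := hm_le 0 (by omega)
      refine ⟨x, σ, fun _ => ⟨⟨hx0, by simp only [add_zero]; linarith⟩, fun _ => ?_, by omega,
        fun I hI => ⟨hnear _ ?_ I hI, hσ I hI⟩⟩⟩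
      · have : (4 * Λ + 1) * m (a + 0 + 1) ≤ X := by
          simp only [hX]; have := hm0.2; gcongr
        simp only [add_zero] at this ⊢
        linarith
      · intro I hI J hJ
        have h1 := abs_mul_sub_mul_le (h.boundS a (by omega) I hI) (h.boundS a (by omega) J hJ)
          (show 0 ≤ n a - x by linarith)
        refine le_trans (le_of_eq ?_) (h1.trans (le_trans ?_ hBX))
        · rw [← abs_neg]; congr 1; simp only [add_zero]; ring
        · have : n a - x ≤ 2 * X := by linarith
          gcongr
    rcases hts.eq_or_lt with hts' | hts'
    · subst hts'
      obtain ⟨x, hx1, hx2, σ, hσ⟩ := exists_common_slope (w (a + t)) (S (a + t))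
        (show X < 2 * X by linarith) ⟨I₀, hI₀⟩
      have hm0 := hm_le (t - 1) (by omega)
      rw [show a + (t - 1) + 1 = a + t by omega] at hm0
      refine ⟨x, σ, fun _ => ⟨⟨by linarith, by linarith⟩, by omega, fun _ => ?_,
        fun I hI => ⟨hnear _ ?_ I hI, hσ I hI⟩⟩⟩
      · have : (4 * Λ + 1) * m (a + t) ≤ X := by
          simp only [hX]; have := hm0.2; gcongr
        linarith
      · intro I hI J hJ
        have h1 := abs_mul_sub_mul_le (h.boundS (a + t) (by omega) I hI)
          (h.boundS (a + t) (by omega) J hJ) (show 0 ≤ x by linarith)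
        have h2 := hnear_w t ht0 le_rfl I hI J hJ
        have h3 : 2 * Λ * x ≤ 2 * Λ * (2 * X) := by gcongr
        have h4 : 0 ≤ Λ * Q := by positivity
        rw [abs_le] at h1 h2 ⊢
        simp only [hB]
        constructor <;> nlinarith
    · have hnt := hn (a + t) (by omega)
      obtain ⟨x, hx1, hx2, σ, hσ⟩ := exists_common_slope (w (a + t)) (S (a + t))
        (show n (a + t) / 3 < 2 * n (a + t) / 3 by linarith) ⟨I₀, hI₀⟩
      have hlen : ∀ k, 1 ≤ k → k ≤ g → (k = a + t ∨ k = a + t + 1) →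
          (4 * Λ + 1) * m k ≤ n (a + t) / 3 := by
        intro k h1 h2 h3
        obtain ⟨h4, h5⟩ := hm k h1 h2
        have h6 := hℓ k h1 h2
        have h7 : 100 * (Λ + 1) ^ 2 * ℓ k ≤ n (a + t) := by
          rcases h3 with rfl | rfl
          · exact h6.trans (min_le_right _ _)
          · have h6' := h6.trans (min_le_left _ _)
            rwa [Nat.add_sub_cancel] at h6'
        have h8 : 3 * (4 * Λ + 1) ≤ 100 * (Λ + 1) ^ 2 := by nlinarith
        have h9 : 3 * (4 * Λ + 1) * m k ≤ 100 * (Λ + 1) ^ 2 * ℓ k := by gcongr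
        linarith
      refine ⟨x, σ, fun _ => ⟨⟨by linarith, by linarith⟩, fun _ => ?_, fun _ => ?_,
        fun I hI => ⟨hnear _ ?_ I hI, hσ I hI⟩⟩⟩
      · have := hlen (a + t + 1) (by omega) (by omega) (Or.inr rfl)
        linarith
      · have := hlen (a + t) (by omega) (by omega) (Or.inl rfl)
        linarith
      · intro I hI J hJ
        have h1 := abs_mul_sub_mul_le (h.boundS (a + t) (by omega) I hI)
          (h.boundS (a + t) (by omega) J hJ) (show 0 ≤ x by linarith)
        have h2 := hnear_w t ht0 hts I hI J hJ
        have h5 := hn_le t ht0 hts'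
        have h3 : 2 * Λ * x ≤ 2 * Λ * Q := by
          have : x ≤ Q := by linarith
          gcongr
        have h4 : 0 ≤ Λ * Q := by positivity
        have h6 : 0 ≤ Λ * X := by positivity
        rw [abs_le] at h1 h2 ⊢
        simp only [hB]
        constructor <;> nlinarith
  choose x σ hxσ using hpts
  refine ⟨α, hα, x, σ, ?_⟩
  rw [← ha]
  refine ⟨fun t ht => ?_, fun t ht I hI => ?_⟩
  · obtain ⟨⟨h1, h2⟩, -, -, h3⟩ := hxσ t ht
    exact ⟨h.bridge _ (by omega) _ h1 h2, h3⟩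
  · obtain ⟨hm0, hmQ⟩ := hm_le t ht
    have hH : ∀ J ∈ A, |(m (a + t + 1) * H (a + t) I - m (a + t + 1) * H (a + t) J)| ≤
        2 * Λ * m (a + t + 1) := fun J hJ => abs_mul_sub_mul_le (h.boundH (a + t) (by omega) I hI.1)
          (h.boundH (a + t) (by omega) J hJ) hm0.le
    refine ⟨hnear _ ?_ I hI, ?_, ?_⟩
    · intro I hI J hJ
      have h0 := abs_mul_sub_mul_le (h.boundH (a + t) (by omega) I hI)
          (h.boundH (a + t) (by omega) J hJ) hm0.le
      have h4 : 0 ≤ Λ * Q := by positivity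
      have h6 : 0 ≤ Λ * X := by positivity
      have h3 : 2 * Λ * m (a + t + 1) ≤ 2 * Λ * Q := by gcongr
      rcases Nat.eq_zero_or_pos t with ht0 | ht0
      · subst ht0
        simp only [add_zero] at h0 h3 ⊢
        rw [abs_le] at h0 ⊢
        simp only [hB]
        constructor <;> nlinarith
      · have h1 := abs_mul_sub_mul_le (h.boundS (a + t) (by omega) I hI)
          (h.boundS (a + t) (by omega) J hJ) (hn (a + t) (by omega)).le
        have h2 := hnear_w t ht0 ht.le I hI J hJ
        have h5 := hn_le t ht0 ht
        have h7 : 2 * Λ * n (a + t) ≤ 2 * Λ * Q := by gcongr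
        rw [abs_le] at h0 h1 h2 ⊢
        simp only [hB]
        constructor <;> nlinarith
    · obtain ⟨⟨h1, h2⟩, h3, -, h4⟩ := hxσ t ht.le
      obtain ⟨K, -, -, hK, -⟩ := (h.bridge _ (by omega) _ h1 h2).exists_attainsMin
      obtain ⟨-, hKσ⟩ := h4 K hK
      rw [← hKσ]
      by_contra! hcon
      have hcon' : (S (a + t) K : ℝ) + 1 ≤ S (a + t) I := by exact_mod_cast hcon
      have h5 := hK.2 I hI.1
      have h6 := hI.2 K hK.1
      have h7 := (abs_le.1 (hH K hK.1)).1
      have h8 := h3 ht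
      simp only at h5 h6
      -- A function steeper than the minimal ones at `x t` would lose more on the rest of the bridge
      -- than it can regain on half of the top edge.
      have h9 : n (a + t) - x t ≤ (S (a + t) I - S (a + t) K) * (n (a + t) - x t) := by
        nlinarith
      nlinarith
    · obtain ⟨⟨h1, h2⟩, -, h3, h4⟩ := hxσ (t + 1) ht
      obtain ⟨K, -, -, hK, -⟩ := (h.bridge _ (by omega) _ h1 h2).exists_attainsMin
      obtain ⟨-, hKσ⟩ := h4 K hK
      rw [← hKσ]
      by_contra! hcon
      have hcon' : (S (a + (t + 1)) I : ℝ) + 1 ≤ S (a + (t + 1)) K := by exact_mod_cast hcon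
      have h5 := hK.2 I hI.1
      have h6 := hI.2 K hK.1
      have h7 := (abs_le.1 (hH K hK.1)).1
      have h8 := h3 (by omega)
      have h10 := (abs_le.1 (abs_mul_sub_mul_le (h.boundU (a + t) (by omega) I hI.1)
          (h.boundU (a + t) (by omega) K hK.1) hm0.le)).2
      have e1 := h.step (a + t) (by omega) I hI.1
      have e2 := h.step (a + t) (by omega) K hK.1
      simp only at h5 h6
      rw [show a + (t + 1) = a + t + 1 by ring] at *
      have h9 : x (t + 1) ≤ (S (a + t + 1) K - S (a + t + 1) I) * x (t + 1) := by
        nlinarith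
      nlinarith

end DependentChain

/-! ### Sums of piecewise linear functions, and the functions attached to triples -/

namespace MetricGraph

variable {V E : Type} {Γ : MetricGraph V E}

theorem IsPL.add {f f' : Γ.Point → ℝ} (hf : Γ.IsPL f) (hf' : Γ.IsPL f') :
    Γ.IsPL fun x => f x + f' x := by
  refine fun e => ⟨fun t h0 h1 => ?_, fun t h0 h1 => ?_⟩
  · obtain ⟨k, hk⟩ := (hf e).1 t h0 h1
    obtain ⟨l, hl⟩ := (hf' e).1 t h0 h1
    refine ⟨k + l, ?_⟩
    filter_upwards [hk, hl] with h h1 h2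
    rw [h1, h2]; push_cast; ring
  · obtain ⟨k, hk⟩ := (hf e).2 t h0 h1
    obtain ⟨l, hl⟩ := (hf' e).2 t h0 h1
    refine ⟨k + l, ?_⟩
    filter_upwards [hk, hl] with h h1 h2
    rw [h1, h2]; push_cast; ring

theorem isPL_const (c : ℝ) : Γ.IsPL fun _ => c :=
  fun _ => ⟨fun _ _ _ => ⟨0, Eventually.of_forall fun _ => by simp⟩,
    fun _ _ _ => ⟨0, Eventually.of_forall fun _ => by simp⟩⟩

variable [Fintype E]

theorem ord_add {f f' : Γ.Point → ℝ} (hf : Γ.IsPL f) (hf' : Γ.IsPL f') (q : Γ.Point) :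
    Γ.ord (fun x => f x + f' x) q = Γ.ord f q + Γ.ord f' q := by
  have hF : ∀ e t, 0 ≤ t → t < Γ.len e → Γ.slopeForward (fun x => f x + f' x) e t =
      Γ.slopeForward f e t + Γ.slopeForward f' e t := by
    intro e t h0 h1
    obtain ⟨k, hk⟩ := (hf e).1 t h0 h1
    obtain ⟨l, hl⟩ := (hf' e).1 t h0 h1
    rw [slopeForward_eq hk, slopeForward_eq hl]
    refine slopeForward_eq ?_
    filter_upwards [hk, hl] with h h1 h2
    rw [h1, h2]; push_cast; ring
  have hB : ∀ e t, 0 < t → t ≤ Γ.len e → Γ.slopeBackward (fun x => f x + f' x) e t =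
      Γ.slopeBackward f e t + Γ.slopeBackward f' e t := by
    intro e t h0 h1
    obtain ⟨k, hk⟩ := (hf e).2 t h0 h1
    obtain ⟨l, hl⟩ := (hf' e).2 t h0 h1
    rw [slopeBackward_eq hk, slopeBackward_eq hl]
    refine slopeBackward_eq ?_
    filter_upwards [hk, hl] with h h1 h2
    rw [h1, h2]; push_cast; ring
  cases q with
  | vertex x =>
    simp only [ord]
    rw [← neg_add, ← Finset.sum_add_distrib]
    congr 1
    refine Finset.sum_congr rfl fun e _ => ?_
    rw [hF e 0 le_rfl (Γ.len_pos e), hB e _ (Γ.len_pos e) le_rfl]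
    split_ifs <;> ring
  | inner e t h0 h1 =>
    simp only [ord]
    rw [hF e t h0.le h1, hB e t h0 h1.le]
    ring

theorem ord_const (c : ℝ) (q : Γ.Point) : Γ.ord (fun _ => c) q = 0 := by
  have hF : ∀ e t, Γ.slopeForward (fun _ => c) e t = 0 := fun e t =>
    slopeForward_eq (Eventually.of_forall fun _ => by simp)
  have hB : ∀ e t, Γ.slopeBackward (fun _ => c) e t = 0 := fun e t =>
    slopeBackward_eq (Eventually.of_forall fun _ => by simp)
  cases q <;> simp [ord, hF, hB]

theorem MovesTo.add {f f' : Γ.Point → ℝ} {D D' F F' : Γ.Divisor} (h : MovesTo f D F)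
    (h' : MovesTo f' D' F') : MovesTo (fun x => f x + f' x) (D + D') (F + F') := by
  refine ⟨h.1.add h'.1, fun q => ?_⟩
  rw [ord_add h.1 h'.1, Finsupp.add_apply, Finsupp.add_apply, h.2, h'.2]
  ring

theorem MovesTo.multiset_sum {ι : Type*} {f : ι → Γ.Point → ℝ} {D : Γ.Divisor} {F : ι → Γ.Divisor}
    (h : ∀ i, MovesTo (f i) D (F i)) (I : Multiset ι) :
    MovesTo (fun x => (I.map fun i => f i x).sum) (Multiset.card I • D) (I.map F).sum := by
  induction I using Multiset.induction_on with
  | empty => exact ⟨by simpa using isPL_const 0, fun q => by simp [ord_const]⟩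
  | cons i I ih =>
    simp only [Multiset.map_cons, Multiset.sum_cons, Multiset.card_cons]
    rw [add_smul, one_smul, add_comm (Multiset.card I • D)]
    exact (h i).add ih

end MetricGraph

/-- The sum of the values of `q` at the entries of a triple. -/
def tripleSum (q : ℕ → ℤ) (I : ℕ × ℕ × ℕ) : ℤ := q I.1 + q I.2.1 + q I.2.2

/-- The multiset of the entries of a triple. -/
def tripleSym (r : ℕ) (I : ℕ × ℕ × ℕ) : Sym (Fin (r + 1)) 3 :=
  ⟨{Fin.ofNat (r + 1) I.1, Fin.ofNat (r + 1) I.2.1, Fin.ofNat (r + 1) I.2.2}, rfl⟩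

/-- Weakly increasing triples of integers between `0` and `r`. -/
def IsTriple (r : ℕ) (I : ℕ × ℕ × ℕ) : Prop := I.1 ≤ I.2.1 ∧ I.2.1 ≤ I.2.2 ∧ I.2.2 ≤ r

theorem tripleSym_injOn (r : ℕ) : Set.InjOn (tripleSym r) {I | IsTriple r I} := by
  rintro ⟨i, j, k⟩ ⟨h1, h2, h3⟩ ⟨i', j', k'⟩ ⟨h1', h2', h3'⟩ h
  simp only at h1 h2 h3 h1' h2' h3'
  have h4 := congrArg (fun x : Sym (Fin (r + 1)) 3 =>
    (x : Multiset (Fin (r + 1))).map (fun x : Fin (r + 1) => (x : ℕ))) h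
  simp only [tripleSym, Sym.coe_mk, Multiset.insert_eq_cons, Multiset.map_cons,
    Multiset.map_singleton, Fin.val_ofNat] at h4
  rw [Nat.mod_eq_of_lt (by omega), Nat.mod_eq_of_lt (by omega), Nat.mod_eq_of_lt (by omega),
    Nat.mod_eq_of_lt (by omega), Nat.mod_eq_of_lt (by omega), Nat.mod_eq_of_lt (by omega)] at h4
  have h5 : [i, j, k].Perm [i', j', k'] := Multiset.coe_eq_coe.1 h4
  have h6 := h5.eq_of_pairwise (le := (· ≤ ·)) (fun a b _ _ h h' => le_antisymm h h')
    (by simp; omega) (by simp; omega)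
  simp only [List.cons.injEq, and_true] at h6
  obtain ⟨rfl, rfl, rfl⟩ := h6
  rfl

theorem exists_tripleSym_eq (r : ℕ) (I : Sym (Fin (r + 1)) 3) :
    ∃ J, IsTriple r J ∧ tripleSym r J = I := by
  obtain ⟨I, hI⟩ := I
  have hlen : (I.sort (· ≤ ·)).length = 3 := by rw [Multiset.length_sort, hI]
  have hsorted := Multiset.pairwise_sort I (· ≤ ·)
  obtain ⟨a, b, c, habc⟩ := List.length_eq_three.1 hlen
  rw [habc] at hsorted
  simp only [List.pairwise_cons, List.mem_cons, List.not_mem_nil, or_false, forall_eq_or_imp,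
    forall_eq] at hsorted
  refine ⟨(a, b, c), ⟨hsorted.1.1, hsorted.2.1, by simp only; omega⟩, Subtype.ext ?_⟩
  have h1 := Multiset.sort_eq I (· ≤ ·)
  rw [habc] at h1
  simp only [tripleSym, Fin.ofNat_eq_cast, Fin.cast_val_eq_self]
  exact h1

namespace ChainOfLoops

open MetricGraph

variable {g r s : ℕ} {Γ : ChainOfLoops g} {p : ℕ → ℕ → ℤ} {P : ℕ → ℤ}

/-- The change of the function `i` on the loop `k + 1`, in units of the bottom length. -/
def loopChange (p : ℕ → ℕ → ℤ) (P : ℕ → ℤ) (k i : ℕ) : ℤ :=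
  if p k i ≤ P k then p k i - P k else p k i - P k - 1

/-- The change of the function `i` from the start of the loop `k + 1` to the middle of its top
edge, in units of the bottom length. -/
def halfChange (p : ℕ → ℕ → ℤ) (P : ℕ → ℤ) (k i : ℕ) : ℤ := max 0 (p k i - P k - 1)

/-- The functions attached to the triples of end divisors, and the chain of their values if they
are tropically dependent. -/
theorem exists_tripleFunctions (hP : SlopePath g r s p P) (hΓ : ShortBottoms Γ) :
    ∃ ψ : Sym (Fin (r + 1)) 3 → Γ.graph.Point → ℝ,
      (∀ I, MovesTo (ψ I) (3 • baseDivisor Γ r s P) ((I : Multiset (Fin (r + 1))).map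
        fun i : Fin (r + 1) => endDivisor Γ r p P i).sum) ∧
      ∀ T : Finset (ℕ × ℕ × ℕ), (∀ I ∈ T, IsTriple r I) →
        TropicallyDependent (T.image (tripleSym r)) ψ →
        ∃ w, DependentChain T g Γ.bridgeLen Γ.botLen (fun k => tripleSum (p k))
          (fun k => tripleSum (loopChange p P k)) (fun k => tripleSum (halfChange p P k)) w
          (3 * (r + s + 1)) := by
  choose f hf1 hf2 hf3 hf4 using fun i : Fin (r + 1) =>
    exists_movesTo_endDivisor hP hΓ (i := i) (by omega)
  refine ⟨fun I x => ((I : Multiset (Fin (r + 1))).map fun i => f i x).sum, fun I => ?_, ?_⟩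
  · have := MovesTo.multiset_sum hf1 (I : Multiset (Fin (r + 1)))
    rwa [show Multiset.card (I : Multiset (Fin (r + 1))) = 3 from I.2] at this
  rintro T hT ⟨b, hb⟩
  -- `Fin.ofNat` reduces modulo `r + 1`, which changes nothing for entries of triples.
  set F : ℕ → Γ.graph.Point → ℝ := fun i => f (Fin.ofNat (r + 1) i) with hF
  set G : ℕ × ℕ × ℕ → Γ.graph.Point → ℝ :=
    fun I x => F I.1 x + F I.2.1 x + F I.2.2 x + b (tripleSym r I) with hG
  have hmin : ∀ x, MinTwice T fun I => G I x := by
    intro x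
    obtain ⟨I, hI, J, hJ, hne, heq, hle⟩ := hb x
    obtain ⟨I, hI', rfl⟩ := Finset.mem_image.1 hI
    obtain ⟨J, hJ', rfl⟩ := Finset.mem_image.1 hJ
    refine ⟨I, hI', J, hJ', fun h => hne (by rw [h]), ?_, fun K hK => ?_⟩
    · simpa [tripleSym, hG, hF, add_assoc] using heq
    · simpa [tripleSym, hG, hF, add_assoc] using hle _ (Finset.mem_image_of_mem _ hK)
  have hFb : ∀ i ≤ r, ∀ k : Fin (g + 1), ∀ t, 0 ≤ t → t ≤ Γ.bridgeLen k →
      F i (Γ.graph.onEdge (bridge k) t) = F i (Γ.wPoint k) + p k i * t := by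
    intro i hi k t h0 h1
    simp only [hF]
    rw [hf2 _ k t h0 h1, Fin.val_ofNat, Nat.mod_eq_of_lt (by omega)]
  have hFv : ∀ i ≤ r, ∀ k : Fin (g + 1),
      F i (Γ.vSuccPoint k) = F i (Γ.wPoint k) + p k i * Γ.bridgeLen k := by
    intro i hi k
    have h1 := hFb i hi k _ (Γ.bridgeLen_pos k (by omega)).le le_rfl
    rw [← h1, ← len_bridge, onEdge_len]
    rfl
  have hFt : ∀ i ≤ r, ∀ k : Fin g, F i (Γ.graph.onEdge (top k) (Γ.topLen (k + 1) / 2)) =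
      F i (Γ.vSuccPoint k.castSucc) + Γ.botLen (k + 1) * halfChange p P k i := by
    intro i hi k
    simp only [hF, halfChange]
    rw [hf3 _ k, Fin.val_ofNat, Nat.mod_eq_of_lt (by omega)]
  have hFw : ∀ i ≤ r, ∀ k : Fin g, F i (Γ.wPoint k.succ) =
      F i (Γ.vSuccPoint k.castSucc) + Γ.botLen (k + 1) * loopChange p P k i := by
    intro i hi k
    simp only [hF, loopChange]
    rw [hf4 _ k, Fin.val_ofNat, Nat.mod_eq_of_lt (by omega)]
  have hsum : ∀ (q : ℕ → ℤ), (∀ i ≤ r, |q i| ≤ r + s + 1) → ∀ I ∈ T,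
      |(tripleSum q I : ℝ)| ≤ 3 * (r + s + 1) := by
    intro q hq I hI
    obtain ⟨h1, h2, h3⟩ := hT I hI
    have a1 := abs_le.1 (hq _ (show I.1 ≤ r by omega))
    have a2 := abs_le.1 (hq _ (show I.2.1 ≤ r by omega))
    have a3 := abs_le.1 (hq _ h3)
    have : |tripleSum q I| ≤ 3 * (r + s + 1) := by
      rw [abs_le]; simp only [tripleSum]; constructor <;> linarith
    exact_mod_cast this
  refine ⟨fun k I => G I (Γ.wPoint (Fin.ofNat (g + 1) k)), ⟨fun k hk I hI => ?_,
    fun k hk x h0 h1 => ?_, fun k hk => ?_, fun k hk => hsum _ fun i hi => ?_,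
    fun k hk => hsum _ fun i hi => ?_, fun k hk => hsum _ fun i hi => ?_⟩⟩
  · obtain ⟨h1, h2, h3⟩ := hT I hI
    have e1 : Fin.ofNat (g + 1) (k + 1) = (⟨k, hk⟩ : Fin g).succ := by
      ext; simp [Nat.mod_eq_of_lt (show k + 1 < g + 1 by omega)]
    have e2 : Fin.ofNat (g + 1) k = (⟨k, hk⟩ : Fin g).castSucc := by
      ext; simp [Nat.mod_eq_of_lt (show k < g + 1 by omega)]
    simp only [e1, e2, hG]
    rw [hFw _ (by omega), hFw _ (by omega), hFw _ (by omega), hFv _ (by omega), hFv _ (by omega),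
      hFv _ (by omega)]
    simp only [tripleSum, Fin.val_castSucc]
    push_cast
    ring
  · have e2 : Fin.ofNat (g + 1) k = (⟨k, by omega⟩ : Fin (g + 1)) := by
      ext; simp [Nat.mod_eq_of_lt (show k < g + 1 by omega)]
    obtain ⟨I, hI, J, hJ, hne, heq, hle⟩ := hmin (Γ.graph.onEdge (bridge ⟨k, by omega⟩) x)
    have hval : ∀ I ∈ T, G I (Γ.wPoint (Fin.ofNat (g + 1) k)) + tripleSum (p k) I * x =
        G I (Γ.graph.onEdge (bridge ⟨k, by omega⟩) x) := by
      intro I hI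
      obtain ⟨h1', h2, h3⟩ := hT I hI
      simp only [hG, e2]
      rw [hFb _ (by omega) _ x h0 h1, hFb _ (by omega) _ x h0 h1, hFb _ (by omega) _ x h0 h1]
      simp only [tripleSum]
      push_cast
      ring
    refine ⟨I, hI, J, hJ, hne, ?_, fun K hK => ?_⟩
    · simp only [hval I hI, hval J hJ, heq]
    · simp only [hval I hI, hval K hK]; exact hle K hK
  · have e2 : Fin.ofNat (g + 1) k = (⟨k, hk⟩ : Fin g).castSucc := by
      ext; simp [Nat.mod_eq_of_lt (show k < g + 1 by omega)]
    obtain ⟨I, hI, J, hJ, hne, heq, hle⟩ :=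
      hmin (Γ.graph.onEdge (top ⟨k, hk⟩) (Γ.topLen (k + 1) / 2))
    have hval : ∀ I ∈ T, G I (Γ.wPoint (Fin.ofNat (g + 1) k)) + tripleSum (p k) I * Γ.bridgeLen k +
        Γ.botLen (k + 1) * tripleSum (halfChange p P k) I =
        G I (Γ.graph.onEdge (top ⟨k, hk⟩) (Γ.topLen (k + 1) / 2)) := by
      intro I hI
      obtain ⟨h1', h2, h3⟩ := hT I hI
      have ht := fun i hi => hFt i hi ⟨k, hk⟩
      simp only at ht
      simp only [hG, e2]
      rw [ht _ (by omega), ht _ (by omega), ht _ (by omega), hFv _ (by omega), hFv _ (by omega),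
        hFv _ (by omega)]
      simp only [tripleSum, Fin.val_castSucc]
      push_cast
      ring
    refine ⟨I, hI, J, hJ, hne, ?_, fun K hK => ?_⟩
    · simp only [hval I hI, hval J hJ, heq]
    · simp only [hval I hI, hval K hK]; exact hle K hK
  · have a1 := hP.nonneg k hk i hi
    have a2 := hP.le k hk i hi
    rw [abs_le]; constructor <;> omega
  · have a1 := hP.nonneg k hk.le i hi
    have a2 := hP.le k hk.le i hi
    have a3 := hP.special_nonneg k hk
    have a4 := hP.special_le k hk
    rw [abs_le, loopChange]; split_ifs <;> constructor <;> omega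
  · have a1 := hP.nonneg k hk.le i hi
    have a2 := hP.le k hk.le i hi
    have a3 := hP.special_nonneg k hk
    have a4 := hP.special_le k hk
    rw [abs_le, halfChange]; constructor <;> omega

end ChainOfLoops

/-! ### The path by blocks and the local data in one block -/

/-- The slope of the function `i` on the bridge `k`: it increases by one at each loop of the block
with index `i`. -/
def blockSlope (r s k i : ℕ) : ℤ := r - i + (min s (k - i * s) : ℕ)

/-- The slope that increases at the loop after the bridge `k`. -/
def blockSpecial (r s k : ℕ) : ℤ :=
  if k < (r + 1) * s then (r : ℤ) - (k / s : ℕ) + (k % s : ℕ) else r + s + 1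

/-- The slope of the function `i` on the bridge `t` of the block `α`. -/
def localSlope (r s α t i : ℕ) : ℤ := r - i + if i < α then (s : ℤ) else if i = α then t else 0

/-- The change of the function `i` on the first half of the top edge of the loop after the bridge
`t` of the block `α`. -/
def localRise (s α t i : ℕ) : ℤ := if i < α then (α : ℤ) - i + s - t - 1 else 0

/-- The change of the function `i` between the middle of the top edge and the end of the loop after
the bridge `t` of the block `α`. -/
def localFall (α t i : ℕ) : ℤ := if α < i then (α : ℤ) - i - t else 0

theorem blockSlope_block {r s α t : ℕ} (ht : t ≤ s) (i : ℕ) :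
    blockSlope r s (α * s + t) i = localSlope r s α t i := by
  unfold blockSlope localSlope
  rcases lt_trichotomy i α with h | h | h
  · obtain ⟨d, rfl⟩ := Nat.exists_eq_add_of_lt h
    have e : (i + d + 1) * s + t - i * s = d * s + s + t := by
      rw [show (i + d + 1) * s + t = i * s + (d * s + s + t) by ring, Nat.add_sub_cancel_left]
    rw [e, min_eq_left (by omega), if_pos h]
  · subst h
    rw [Nat.add_sub_cancel_left, min_eq_right ht]
    simp
  · obtain ⟨d, rfl⟩ := Nat.exists_eq_add_of_lt h
    have e : α * s + t - (α + d + 1) * s = 0 := by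
      rw [show (α + d + 1) * s = α * s + d * s + s by ring]; omega
    rw [e, if_neg (by omega), if_neg (by omega)]
    simp

theorem blockSpecial_block {r s α t : ℕ} (hα : α ≤ r) (ht : t < s) :
    blockSpecial r s (α * s + t) = (r : ℤ) - α + t := by
  have h1 : α * s + t < (r + 1) * s := by
    have : (α + 1) * s ≤ (r + 1) * s := Nat.mul_le_mul_right _ (by omega)
    rw [add_mul, one_mul] at this
    omega
  rw [blockSpecial, if_pos h1]
  congr 3
  · rw [mul_comm, Nat.mul_add_div (by omega), Nat.div_eq_of_lt ht, add_zero]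
  · rw [mul_comm, Nat.mul_add_mod, Nat.mod_eq_of_lt ht]

theorem blockSlope_of_le {r s k i : ℕ} (hi : i ≤ r) (hk : (r + 1) * s ≤ k) :
    blockSlope r s k i = r - i + s := by
  have h1 : (i + 1) * s ≤ (r + 1) * s := Nat.mul_le_mul_right _ (by omega)
  rw [add_mul, one_mul] at h1
  rw [blockSlope, min_eq_left (by omega)]

theorem exists_eq_block {r s k : ℕ} (hs : 1 ≤ s) (hk : k < (r + 1) * s) :
    ∃ α ≤ r, ∃ t < s, k = α * s + t :=
  ⟨k / s, Nat.le_of_lt_succ (Nat.div_lt_of_lt_mul (by rwa [mul_comm])), k % s,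
    Nat.mod_lt _ (by omega), by rw [mul_comm, Nat.div_add_mod]⟩

/-- Inside the block `α`, smaller indices already have their full increase by `s` and so stay at
least two above the rising slope until it moves. On the last `ρ` loops the special value `r + s + 1`
lies above all slopes, and nothing rises. -/
theorem slopePath_blockSlope {r s ρ : ℕ} (hr : 3 ≤ r) (hs : 1 ≤ s) :
    SlopePath (genusOf r s ρ) r s (blockSlope r s) (blockSpecial r s) where
  start i _ := by simp [blockSlope]
  finish i hi := blockSlope_of_le hi (by simp [genusOf])
  step k _ i hi := by
    rcases lt_or_ge k ((r + 1) * s) with h | h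
    · obtain ⟨α, hα, t, ht, rfl⟩ := exists_eq_block hs h
      rw [add_assoc, blockSlope_block (by omega), blockSlope_block ht.le, blockSpecial_block hα ht]
      unfold localSlope
      split_ifs <;> push_cast <;> omega
    · rw [blockSlope_of_le hi h, blockSlope_of_le hi (by omega), blockSpecial, if_neg (not_lt.2 h),
        if_neg (by omega), add_zero]
  anti k _ i j hij hj := by
    rcases lt_or_ge k ((r + 1) * s) with h | h
    · obtain ⟨α, hα, t, ht, rfl⟩ := exists_eq_block hs h
      rw [blockSlope_block ht.le, blockSlope_block ht.le]
      unfold localSlope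
      split_ifs <;> omega
    · rw [blockSlope_of_le (i := i) (by omega) h, blockSlope_of_le hj h]; omega
  skip k _ i hi := by
    rcases lt_or_ge k ((r + 1) * s) with h | h
    · obtain ⟨α, hα, t, ht, rfl⟩ := exists_eq_block hs h
      rw [blockSlope_block ht.le, blockSpecial_block hα ht]
      unfold localSlope
      split_ifs <;> omega
    · rw [blockSlope_of_le (by omega) h, blockSpecial, if_neg (by omega)]; omega
  nonneg k _ i hi := by unfold blockSlope; omega
  le k _ i hi := by unfold blockSlope; omega
  special_nonneg k _ := by
    rcases lt_or_ge k ((r + 1) * s) with h | h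
    · obtain ⟨α, hα, t, ht, rfl⟩ := exists_eq_block hs h
      rw [blockSpecial_block hα ht]; omega
    · rw [blockSpecial, if_neg (by omega)]; omega
  special_le k _ := by
    rcases lt_or_ge k ((r + 1) * s) with h | h
    · obtain ⟨α, hα, t, ht, rfl⟩ := exists_eq_block hs h
      rw [blockSpecial_block hα ht]; omega
    · rw [blockSpecial, if_neg (by omega)]
  genus := by unfold genusOf; nlinarith
  genus' := by unfold genusOf; nlinarith

open ChainOfLoops in
theorem halfChange_block {r s α t : ℕ} (hα : α ≤ r) (ht : t < s) (i : ℕ) :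
    halfChange (blockSlope r s) (blockSpecial r s) (α * s + t) i = localRise s α t i := by
  rw [halfChange, blockSlope_block ht.le, blockSpecial_block hα ht]
  unfold localSlope localRise
  split_ifs <;> omega

open ChainOfLoops in
theorem loopChange_block {r s α t : ℕ} (hα : α ≤ r) (ht : t < s) (i : ℕ) :
    loopChange (blockSlope r s) (blockSpecial r s) (α * s + t) i =
      localRise s α t i + localFall α t i := by
  rw [loopChange, blockSlope_block ht.le, blockSpecial_block hα ht]
  unfold localSlope localRise localFall
  split_ifs <;> omega

/-- A block of a chain of loops on which the minimum of the functions in `T` occurs twice: `y t I`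
is the value of the function `I` at a point at distances `x t` and `z t` from the ends of the
bridge `t` of the block, where all minimal functions have the slope `σ t`, and `q t` is the bottom
length of the loop after that bridge. -/
structure MinimalBlock (T : Finset (ℕ × ℕ × ℕ)) (r s α : ℕ) (y : ℕ → ℕ × ℕ × ℕ → ℝ)
    (x z q : ℕ → ℝ) (σ : ℕ → ℤ) : Prop where
  minTwice_bridge : ∀ t ≤ s, MinTwice T (y t)
  of_bridge : ∀ t ≤ s, ∀ I, AttainsMin T (y t) I →
    I.2.1 = α ∧ tripleSum (localSlope r s α t) I = σ t
  minTwice_loop : ∀ t < s, MinTwice T fun I =>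
    y t I + tripleSum (localSlope r s α t) I * z t + q t * tripleSum (localRise s α t) I
  of_loop : ∀ t < s, ∀ I, AttainsMin T (fun I =>
    y t I + tripleSum (localSlope r s α t) I * z t + q t * tripleSum (localRise s α t) I) I →
    I.2.1 = α ∧ tripleSum (localSlope r s α t) I ≤ σ t ∧
      σ (t + 1) ≤ tripleSum (localSlope r s α (t + 1)) I
  next : ∀ t < s, ∀ I ∈ T, y (t + 1) I = y t I + tripleSum (localSlope r s α t) I * z t +
    q t * (tripleSum (localRise s α t) I + tripleSum (localFall α t) I) +
      tripleSum (localSlope r s α (t + 1)) I * x (t + 1)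
  pos : ∀ t < s, 0 < q t
  inj : ∀ t < s, ∀ t' < s, q t = q t' → t = t'

theorem tripleSum_add (f h : ℕ → ℤ) (I : ℕ × ℕ × ℕ) :
    tripleSum (fun i => f i + h i) I = tripleSum f I + tripleSum h I := by
  simp only [tripleSum]; ring

namespace ChainOfLoops

variable {r s ρ : ℕ} {Γ : ChainOfLoops (genusOf r s ρ)}

/-- Two equal bottom lengths would be a relation with coefficients `1` and `-1`. Distinctness keeps
the breakpoints of different loops apart. -/
theorem Admissible.botLen_injOn {g : ℕ} {Γ : ChainOfLoops g} {C : ℝ} (h : Γ.Admissible r s C)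
    {k l : ℕ} (hk : 1 ≤ k ∧ k ≤ g) (hl : 1 ≤ l ∧ l ≤ g) (hkl : Γ.botLen k = Γ.botLen l) : k = l := by
  by_contra hne
  have hsum : ∑ i ∈ Finset.Icc 1 g, (((if i = k then 1 else 0) - (if i = l then 1 else 0) : ℤ) : ℝ) *
      Γ.botLen i = 0 := by
    push_cast
    simp only [sub_mul, ite_mul, one_mul, zero_mul, Finset.sum_sub_distrib, Finset.sum_ite_eq',
      Finset.mem_Icc, hk, hl, and_self, if_true, hkl, sub_self]
  have := h.no_relation (fun i => (if i = k then 1 else 0) - (if i = l then 1 else 0)) (fun i => by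
    split_ifs <;> simp <;> omega) hsum k (Finset.mem_Icc.2 hk)
  simp [hne] at this

/-- The constant in the definition of admissible edge lengths. -/
def admissibleConst (r s : ℕ) : ℝ := 100 * (3 * (r + s + 1) + 1) ^ 2

theorem Admissible.shortBottoms {g : ℕ} {Γ : ChainOfLoops g} {C : ℝ} (h : Γ.Admissible r s C) :
    ShortBottoms Γ := fun k => h.bot_lt_top _ (by omega) (by omega)

/-- Specializes `exists_block` to the median as class. The condition `hsep` compensates for the
large third entry of a triple: with it, a median below `α` makes the triple strictly steeper at the
start of the block `α` than any triple of median at least `α`. -/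
theorem exists_minimalBlock (hs : 1 ≤ s)
    (hΓ : Γ.Admissible r s (admissibleConst r s)) {T : Finset (ℕ × ℕ × ℕ)}
    (hT : ∀ I ∈ T, IsTriple r I) (hsep : ∀ I ∈ T, I.1 + I.2.2 ≤ I.2.1 + s + 1 ∨ I.2.1 = r)
    {w : ℕ → ℕ × ℕ × ℕ → ℝ}
    (hw : DependentChain T (genusOf r s ρ) Γ.bridgeLen Γ.botLen
      (fun k => tripleSum (blockSlope r s k))
      (fun k => tripleSum (loopChange (blockSlope r s) (blockSpecial r s) k))
      (fun k => tripleSum (halfChange (blockSlope r s) (blockSpecial r s) k)) w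
      (3 * (r + s + 1))) :
    ∃ α ≤ r, ∃ y x z q σ, MinimalBlock T r s α y x z q σ := by
  have hg : (r + 1) * s ≤ genusOf r s ρ := by simp [genusOf]
  have hm : ∀ k, 1 ≤ k → k ≤ genusOf r s ρ → 0 < Γ.botLen k ∧ Γ.botLen k < Γ.topLen k := by
    intro k h1 h2
    have h3 := Γ.botLen_pos k h1 h2
    have h4 := hΓ.bot_lt_top k h1 h2
    have h5 : (1 : ℝ) ≤ genusOf r s ρ := by exact_mod_cast h1.trans h2
    exact ⟨h3, by nlinarith⟩
  have hblock : ∀ α ≤ r, 100 * ((3 * (r + s + 1) : ℝ) + 1) ^ 2 *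
      DependentChain.partLen Γ.bridgeLen Γ.topLen (α * s) s ≤
        min (Γ.bridgeLen (α * s)) (Γ.bridgeLen ((α + 1) * s)) := by
    intro α hα
    refine le_trans (le_of_eq ?_) (hΓ.block_ll_bridge α hα)
    rw [admissibleConst, DependentChain.partLen]
    congr 2
    · rw [← Finset.sum_image (s := Finset.range s) (g := fun i => α * s + 1 + i)
        (f := fun i => Γ.topLen i) (fun a _ b _ hab => by simpa using hab)]
      congr 1
      ext i
      simp only [Finset.mem_image, Finset.mem_range, Finset.mem_Icc, add_mul, one_mul]
      exact ⟨by rintro ⟨a, ha, rfl⟩; omega, fun h => ⟨i - (α * s + 1), by omega, by omega⟩⟩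
    · rw [← Finset.sum_image (s := Finset.range (s - 1)) (g := fun i => α * s + 1 + i)
        (f := fun i => Γ.bridgeLen i) (fun a _ b _ hab => by simpa using hab)]
      congr 1
      ext i
      simp only [Finset.mem_image, Finset.mem_range, Finset.mem_Icc, add_mul, one_mul]
      exact ⟨by rintro ⟨a, ha, rfl⟩; omega, fun h => ⟨i - (α * s + 1), by omega, by omega⟩⟩
  have hslope : ∀ α, 1 ≤ α → α ≤ r → ∀ I ∈ T, ∀ J ∈ T, I.2.1 < α → α ≤ J.2.1 →
      tripleSum (blockSlope r s (α * s)) J + 1 ≤ tripleSum (blockSlope r s (α * s)) I := by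
    intro α h1 h2 I hI J hJ hIα hJα
    have hb := fun i => blockSlope_block (r := r) (α := α) (Nat.zero_le s) i
    simp only [add_zero] at hb
    obtain ⟨a1, a2, a3⟩ := hT I hI
    obtain ⟨b1, b2, b3⟩ := hT J hJ
    have hc := hsep I hI
    simp only [tripleSum, hb, localSlope]
    split_ifs <;> omega
  obtain ⟨α, hα, x, σ, h1, h2⟩ := hw.exists_block (ℓ := Γ.topLen) hs hg Γ.bridgeLen_pos hm
    (fun k h1 h2 => hΓ.top_ll_bridge k h1 h2) hblock
    (fun I => I.2.1) (fun I hI => (hT I hI).2.1.trans (hT I hI).2.2) hslope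
  have hαs : (α + 1) * s ≤ (r + 1) * s := Nat.mul_le_mul_right _ (by omega)
  rw [add_mul, one_mul] at hαs
  have hS : ∀ t ≤ s, tripleSum (blockSlope r s (α * s + t)) = tripleSum (localSlope r s α t) :=
    fun t ht => by funext I; simp only [tripleSum, blockSlope_block ht]
  have hH : ∀ t < s, tripleSum (halfChange (blockSlope r s) (blockSpecial r s) (α * s + t)) =
      tripleSum (localRise s α t) :=
    fun t ht => by funext I; simp only [tripleSum, halfChange_block hα ht]
  have hU : ∀ t < s, ∀ I, tripleSum (loopChange (blockSlope r s) (blockSpecial r s) (α * s + t)) I =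
      tripleSum (localRise s α t) I + tripleSum (localFall α t) I :=
    fun t ht I => by rw [← tripleSum_add]; simp only [tripleSum, loopChange_block hα ht]
  have hz : ∀ t < s, (fun I => w (α * s + t) I +
      tripleSum (blockSlope r s (α * s + t)) I * Γ.bridgeLen (α * s + t) + Γ.botLen (α * s + t + 1) *
        tripleSum (halfChange (blockSlope r s) (blockSpecial r s) (α * s + t)) I) =
      fun I => (w (α * s + t) I + tripleSum (blockSlope r s (α * s + t)) I * x t) +
        tripleSum (localSlope r s α t) I * (Γ.bridgeLen (α * s + t) - x t) +
        Γ.botLen (α * s + t + 1) * tripleSum (localRise s α t) I := by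
    intro t ht
    funext I
    rw [hS t ht.le, hH t ht]
    ring
  refine ⟨α, hα, fun t I => w (α * s + t) I + tripleSum (blockSlope r s (α * s + t)) I * x t, x,
    fun t => Γ.bridgeLen (α * s + t) - x t, fun t => Γ.botLen (α * s + t + 1), σ, ⟨fun t ht => ?_,
    fun t ht I hI => ?_, fun t ht => ?_, fun t ht I hI => ?_, fun t ht I hI => ?_,
    fun t ht => Γ.botLen_pos _ (by omega) (by omega), fun t ht t' ht' h => ?_⟩⟩
  · exact (h1 t ht).1
  · rw [← hS t ht]; exact (h1 t ht).2 I hI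
  · rw [← hz t ht]; exact hw.loop _ (by omega)
  · rw [← hS t ht.le, ← hS (t + 1) ht]
    rw [← hz t ht] at hI
    exact h2 t ht I hI
  · have e := hw.step (α * s + t) (by omega) I hI
    rw [hU t ht, hS t ht.le] at e
    rw [← add_assoc, e, ← hS (t + 1) ht, hS t ht.le, ← add_assoc]
    push_cast
    ring
  · have := hΓ.botLen_injOn ⟨by omega, by omega⟩ ⟨by omega, by omega⟩ h
    omega

end ChainOfLoops

/-- The coefficient of `t` is the multiplicity of `α` in the triple; this is what separates strict
triples, triples with `α` doubled, and `(α, α, α)`. -/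
theorem tripleSum_localSlope {r s α t i k : ℕ} (hi : i ≤ α) (hk : α ≤ k) :
    tripleSum (localSlope r s α t) (i, α, k) = 3 * r - i - α - k + t +
      (if i < α then (s : ℤ) else t) + if α < k then 0 else (t : ℤ) := by
  simp only [tripleSum, localSlope, lt_irrefl, if_false, if_true]
  split_ifs <;> omega

/-! ### Ties on a block force `0 < α < r` -/

namespace MinimalBlock

variable {T : Finset (ℕ × ℕ × ℕ)} {r s α : ℕ} {y : ℕ → ℕ × ℕ × ℕ → ℝ} {x z q : ℕ → ℝ} {σ : ℕ → ℤ}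

/-- On each bridge of the block, two functions have the common slope. -/
theorem exists_bridge (h : MinimalBlock T r s α y x z q σ) (hT : ∀ I ∈ T, IsTriple r I) {t : ℕ}
    (ht : t ≤ s) : ∃ i k i' k', (i, k) ≠ (i', k') ∧ (i, α, k) ∈ T ∧ (i', α, k') ∈ T ∧
      (i ≤ α ∧ α ≤ k ∧ k ≤ r) ∧ (i' ≤ α ∧ α ≤ k' ∧ k' ≤ r) ∧
      tripleSum (localSlope r s α t) (i, α, k) = σ t ∧
      tripleSum (localSlope r s α t) (i', α, k') = σ t := by
  obtain ⟨⟨i, j, k⟩, ⟨i', j', k'⟩, hne, hI, hJ⟩ := (h.minTwice_bridge t ht).exists_attainsMin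
  obtain ⟨h1, h2⟩ := h.of_bridge t ht _ hI
  obtain ⟨h3, h4⟩ := h.of_bridge t ht _ hJ
  simp only at h1 h3
  subst h1 h3
  have a1 := hT _ hI.1
  have a2 := hT _ hJ.1
  exact ⟨i, k, i', k', fun h => hne (by simp_all), hI.1, hJ.1, a1, a2, h2, h4⟩

theorem exists_loop (h : MinimalBlock T r s α y x z q σ) (hT : ∀ I ∈ T, IsTriple r I) {t : ℕ}
    (ht : t < s) : ∃ i k i' k', (i, k) ≠ (i', k') ∧ (i, α, k) ∈ T ∧ (i', α, k') ∈ T ∧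
      (i ≤ α ∧ α ≤ k ∧ k ≤ r) ∧ (i' ≤ α ∧ α ≤ k' ∧ k' ≤ r) ∧
      (tripleSum (localSlope r s α t) (i, α, k) ≤ σ t ∧
        σ (t + 1) ≤ tripleSum (localSlope r s α (t + 1)) (i, α, k)) ∧
      tripleSum (localSlope r s α t) (i', α, k') ≤ σ t ∧
        σ (t + 1) ≤ tripleSum (localSlope r s α (t + 1)) (i', α, k') := by
  obtain ⟨⟨i, j, k⟩, ⟨i', j', k'⟩, hne, hI, hJ⟩ := (h.minTwice_loop t ht).exists_attainsMin
  obtain ⟨h1, h2⟩ := h.of_loop t ht _ hI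
  obtain ⟨h3, h4⟩ := h.of_loop t ht _ hJ
  simp only at h1 h3
  subst h1 h3
  have a1 := hT _ hI.1
  have a2 := hT _ hJ.1
  exact ⟨i, k, i', k', fun h => hne (by simp_all), hI.1, hJ.1, a1, a2, h2, h4⟩

/-- The slopes on the first bridge of the first block are distinct. -/
theorem ne_zero (h : MinimalBlock T r s α y x z q σ) (hT : ∀ I ∈ T, IsTriple r I) : α ≠ 0 := by
  rintro rfl
  obtain ⟨i, k, i', k', hne, -, -, h1, h2, h3, h4⟩ := h.exists_bridge hT (Nat.zero_le s)
  rw [tripleSum_localSlope (by omega) (by omega)] at h3 h4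
  rw [Ne, Prod.mk.injEq] at hne
  split_ifs at h3 h4 <;> omega

/-- The slopes on the last bridge of the last block are distinct. -/
theorem ne_last (h : MinimalBlock T r s α y x z q σ) (hT : ∀ I ∈ T, IsTriple r I) : α ≠ r := by
  rintro rfl
  obtain ⟨i, k, i', k', hne, -, -, h1, h2, h3, h4⟩ := h.exists_bridge hT le_rfl
  rw [tripleSum_localSlope (by omega) (by omega)] at h3 h4
  rw [Ne, Prod.mk.injEq] at hne
  split_ifs at h3 h4 <;> omega

end MinimalBlock

/-! ### The surjective range -/

/-- The number of triples with median `α` in `surjectiveTriples`. -/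
def fiberCard (r s α : ℕ) : ℕ := if α = 0 then s + 2 else if α = r then r + 1 else 2 * s + 2

/-- The number of triples with median `α` and a repeated entry `α` in `surjectiveTriples`. -/
def doubleCard (r s α : ℕ) : ℕ :=
  if α = 0 then s + 2 else if α = r then r + 1 else if α ≤ s then s + 2 else s + 1

/-- The triple with median `α` and the given label. -/
def labelTriple (r s α e : ℕ) : ℕ × ℕ × ℕ :=
  if e < doubleCard r s α then (min e α, α, max e α)
  else (α + 1 + (e - doubleCard r s α) - r, α, min (α + 1 + (e - doubleCard r s α)) r)

/-- A set of triples whose functions are independent in the surjective range. -/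
def surjectiveTriples (r s : ℕ) : Finset (ℕ × ℕ × ℕ) :=
  ((Finset.range (r + 1)).sigma fun α => Finset.range (fiberCard r s α)).image
    fun a => labelTriple r s a.1 a.2

section

variable {r s : ℕ}

theorem mem_surjectiveTriples {I : ℕ × ℕ × ℕ} (hI : I ∈ surjectiveTriples r s) :
    ∃ α e, α ≤ r ∧ e < fiberCard r s α ∧ labelTriple r s α e = I := by
  obtain ⟨⟨α, e⟩, h, rfl⟩ := Finset.mem_image.1 hI
  simp only [Finset.mem_sigma, Finset.mem_range] at h
  exact ⟨α, e, by omega, h.2, rfl⟩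

/-- A description of the chosen set in linear inequalities. For `0 < α < r` there is only one strict
triple for each sum of outer entries, the one with `i = 0` or `k = r`. -/
theorem surjectiveTriples_cases (hr : 3 ≤ r) (hrs : s + 1 ≤ r) {i j k : ℕ}
    (hI : (i, j, k) ∈ surjectiveTriples r s) :
    i ≤ j ∧ j ≤ k ∧ k ≤ r ∧ ((j = 0 ∧ k ≤ s + 1) ∨ j = r ∨ (j < r ∧
      ((i < j ∧ k = j ∧ i ≤ s) ∨ (i = j ∧ k ≤ s + 1 ∧ j ≤ s) ∨
        (i < j ∧ j < k ∧ (i = 0 ∨ k = r) ∧ i + k ≤ j + s + 1 ∧ (j ≤ s → i + k ≤ j + s))))) := by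
  obtain ⟨α, e, h1, h2, h3⟩ := mem_surjectiveTriples hI
  unfold labelTriple doubleCard at h3
  unfold fiberCard at h2
  split_ifs at h2 h3 <;> simp only [Prod.mk.injEq] at h3 <;> obtain ⟨h4, h5, h6⟩ := h3 <;> omega

theorem isTriple_of_mem_surjectiveTriples (hr : 3 ≤ r) (hrs : s + 1 ≤ r) :
    ∀ I ∈ surjectiveTriples r s, IsTriple r I := by
  rintro ⟨i, j, k⟩ hI
  obtain ⟨h1, h2, h3, -⟩ := surjectiveTriples_cases hr hrs hI
  exact ⟨h1, h2, h3⟩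

theorem card_surjectiveTriples (hr : 3 ≤ r) (hrs : s + 1 ≤ r) :
    (surjectiveTriples r s).card = s + 2 + (r - 1) * (2 * s + 2) + (r + 1) := by
  rw [surjectiveTriples, Finset.card_image_of_injOn, Finset.card_sigma]
  · simp only [Finset.card_range]
    obtain ⟨r, rfl⟩ := Nat.exists_eq_add_of_le' (show 1 ≤ r by omega)
    rw [Finset.sum_range_succ, Finset.sum_range_succ', Finset.sum_congr rfl
      (g := fun _ => 2 * s + 2) fun i hi => ?_]
    · simp [fiberCard]; ring
    · have := Finset.mem_range.1 hi
      rw [fiberCard, if_neg (by omega), if_neg (by omega)]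
  · rintro ⟨α, e⟩ h ⟨α', e'⟩ h' heq
    simp only [Finset.coe_sigma, Set.mem_sigma_iff, Finset.coe_range, Set.mem_Iio] at h h' heq
    have hα : α = α' := by
      have := congrArg (fun I => I.2.1) heq
      unfold labelTriple at this
      split_ifs at this <;> exact this
    subst hα
    obtain ⟨h1, h2⟩ := h
    obtain ⟨-, h3⟩ := h'
    have : e = e' := by
      unfold labelTriple doubleCard at heq
      unfold fiberCard at h2 h3
      split_ifs at h2 h3 heq <;> simp only [Prod.mk.injEq] at heq <;> obtain ⟨h4, h5, h6⟩ := heq <;>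
        omega
    rw [this]

/-- The slopes of the chosen triples of median `α` nearly fill intervals without overlap on suitable
bridges, the only possible coincidence being with `(α, α, α)`. -/
theorem not_minimalBlock_surjectiveTriples (hr : 3 ≤ r) (hrs : s + 1 ≤ r) {α : ℕ} (hα : α ≤ r)
    {y : ℕ → ℕ × ℕ × ℕ → ℝ} {x z q : ℕ → ℝ} {σ : ℕ → ℤ} :
    ¬MinimalBlock (surjectiveTriples r s) r s α y x z q σ := by
  intro h
  have hT := isTriple_of_mem_surjectiveTriples (s := s) hr hrs
  have h0 := h.ne_zero hT
  have h1 := h.ne_last hT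
  rcases le_or_gt α s with hs | hs
  -- On the bridge `α` the strict and the doubled triples have pairwise distinct slopes, so a tie
  -- must involve `(α, α, α)`, of slope `3 * r`. On the bridge before it the same holds with slope
  -- `3 * r - 3`.
  · have e1 : σ α = 3 * r := by
      obtain ⟨i, k, i', k', hne, hI, hJ, -, -, h3, h4⟩ := h.exists_bridge hT hs
      obtain ⟨a1, a2, a3, a4⟩ := surjectiveTriples_cases hr hrs hI
      obtain ⟨b1, b2, b3, b4⟩ := surjectiveTriples_cases hr hrs hJ
      rw [tripleSum_localSlope (by omega) (by omega)] at h3 h4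
      rw [Ne, Prod.mk.injEq] at hne
      split_ifs at h3 h4 <;> omega
    have e2 : σ (α - 1) = 3 * r - 3 := by
      obtain ⟨i, k, i', k', hne, hI, hJ, -, -, h3, h4⟩ :=
        h.exists_bridge hT (show α - 1 ≤ s by omega)
      obtain ⟨a1, a2, a3, a4⟩ := surjectiveTriples_cases hr hrs hI
      obtain ⟨b1, b2, b3, b4⟩ := surjectiveTriples_cases hr hrs hJ
      rw [tripleSum_localSlope (by omega) (by omega)] at h3 h4
      rw [Ne, Prod.mk.injEq] at hne
      split_ifs at h3 h4 <;> omega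
    -- A function minimal at this loop has to gain three in slope, so `α` occurs three times in its
    -- triple; there is no second one.
    obtain ⟨i, k, i', k', hne, hI, hJ, a1, b1, ⟨h3, h4⟩, h5, h6⟩ :=
      h.exists_loop hT (show α - 1 < s by omega)
    rw [show α - 1 + 1 = α by omega] at h4 h6
    rw [tripleSum_localSlope (by omega) (by omega)] at h3 h4 h5 h6
    rw [Ne, Prod.mk.injEq] at hne
    split_ifs at h3 h4 h5 h6 <;> omega
  -- For `α > s` the strict triples and the triples `(e, α, α)` occupy adjacent disjoint ranges of
  -- slopes on the last bridge.
  · obtain ⟨i, k, i', k', hne, hI, hJ, -, -, h3, h4⟩ := h.exists_bridge hT le_rfl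
    obtain ⟨a1, a2, a3, a4⟩ := surjectiveTriples_cases hr hrs hI
    obtain ⟨b1, b2, b3, b4⟩ := surjectiveTriples_cases hr hrs hJ
    rw [tripleSum_localSlope (by omega) (by omega)] at h3 h4
    rw [Ne, Prod.mk.injEq] at hne
    split_ifs at h3 h4 <;> omega

end

/-! ### The injective range: counting breakpoints -/

section MinTwice

variable {ι κ : Type*} {A : Finset ι} {G : Finset κ}

theorem MinTwice.of_eq_add_const {f f' : ι → ℝ} (h : MinTwice A f) (c : ℝ)
    (hc : ∀ i ∈ A, f i = f' i + c) : MinTwice A f' := by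
  obtain ⟨i, hi, j, hj, hne, he, hk⟩ := h
  refine ⟨i, hi, j, hj, hne, ?_, fun k hk' => ?_⟩
  · have := hc i hi; have := hc j hj; linarith
  · have := hc i hi; have := hc k hk'; have := hk k hk'; linarith

theorem MinTwice.comp {f : ι → ℝ} (h : MinTwice A f) {φ : κ → ι} (hφ : ∀ i ∈ G, φ i ∈ A)
    (hG : ∀ I, AttainsMin A f I → ∃ i ∈ G, I = φ i) : MinTwice G fun i => f (φ i) := by
  obtain ⟨I, J, hne, hI, hJ⟩ := h.exists_attainsMin
  obtain ⟨i, hi, rfl⟩ := hG I hI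
  obtain ⟨j, hj, rfl⟩ := hG J hJ
  exact minTwice_of_attainsMin (i := i) (j := j) (fun h => hne (by rw [h]))
    ⟨hi, fun k hk => hI.2 _ (hφ k hk)⟩ ⟨hj, fun k hk => hJ.2 _ (hφ k hk)⟩

/-- If the minimum of `f` is attained twice, at functions in the image of `φ` or at `K`, then
either the minimum over the image of `φ` is attained twice or it is equal to the value at `K`. -/
theorem MinTwice.comp_or {f : ι → ℝ} (h : MinTwice A f) {φ : κ → ι} (hφ : ∀ i ∈ G, φ i ∈ A) (K : ι)
    (hG : ∀ I, AttainsMin A f I → I = K ∨ ∃ i ∈ G, I = φ i) :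
    (MinTwice G fun i => f (φ i)) ∨
      (∃ i ∈ G, f K = f (φ i)) ∧ ∀ i ∈ G, f K ≤ f (φ i) := by
  obtain ⟨I, J, hne, hI, hJ⟩ := h.exists_attainsMin
  have heq : f I = f J := le_antisymm (hI.2 _ hJ.1) (hJ.2 _ hI.1)
  rcases hG I hI with rfl | ⟨i, hi, rfl⟩
  · rcases hG J hJ with rfl | ⟨j, hj, rfl⟩
    · exact absurd rfl hne
    · exact Or.inr ⟨⟨j, hj, heq⟩, fun k hk => hI.2 _ (hφ k hk)⟩
  · rcases hG J hJ with rfl | ⟨j, hj, rfl⟩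
    · exact Or.inr ⟨⟨i, hi, heq.symm⟩, fun k hk => hJ.2 _ (hφ k hk)⟩
    · exact Or.inl (minTwice_of_attainsMin (i := i) (j := j) (fun h => hne (by rw [h]))
        ⟨hi, fun k hk => hI.2 _ (hφ k hk)⟩ ⟨hj, fun k hk => hJ.2 _ (hφ k hk)⟩)

/-- The minimum of `n` affine functions of distinct slopes has at most `n - 1` breakpoints. -/
theorem card_breakpoints_lt {G : Finset ℕ} (hG : G.Nonempty) (B : ℕ → ℝ) (M : Finset ℝ)
    (hM : ∀ m ∈ M, MinTwice G fun i => B i - i * m) : M.card + 1 ≤ G.card := by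
  have hpair : ∀ m, ∃ i j, m ∈ M → i < j ∧ AttainsMin G (fun i => B i - i * m) i ∧
      AttainsMin G (fun i => B i - i * m) j := by
    intro m
    by_cases hm : m ∈ M
    · obtain ⟨i, j, hne, hi, hj⟩ := (hM m hm).exists_attainsMin
      rcases lt_or_gt_of_ne hne with h | h
      · exact ⟨i, j, fun _ => ⟨h, hi, hj⟩⟩
      · exact ⟨j, i, fun _ => ⟨h, hj, hi⟩⟩
    · exact ⟨0, 0, fun h => absurd h hm⟩
  choose a b hab using hpair
  -- As `m` grows, larger indices win. The larger index `b m` of a tie therefore increases strictly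
  -- with `m`, and it is never the least element of `G`.
  have hmono : ∀ m ∈ M, ∀ m' ∈ M, m < m' → b m < b m' := by
    intro m hm m' hm' hlt
    obtain ⟨-, -, h1⟩ := hab m hm
    obtain ⟨h2, h3, -⟩ := hab m' hm'
    have h4 := h1.2 _ h3.1
    have h5 := h3.2 _ h1.1
    simp only at h4 h5
    refine lt_of_le_of_lt ?_ h2
    by_contra! hcon
    have : (a m' : ℝ) < b m := by exact_mod_cast hcon
    nlinarith
  have hcard : M.card ≤ (G.erase (G.min' hG)).card := by
    refine Finset.card_le_card_of_injOn b (fun m hm => ?_) fun m hm m' hm' heq => ?_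
    · obtain ⟨h1, h2, h3⟩ := hab m hm
      have h4 := G.min'_le _ h2.1
      exact Finset.mem_coe.2 (Finset.mem_erase.2 ⟨by omega, h3.1⟩)
    · rcases lt_trichotomy m m' with h | h | h
      · have := hmono m hm m' hm' h; omega
      · exact h
      · have := hmono m' hm' m hm h; omega
  rw [Finset.card_erase_of_mem (G.min'_mem hG)] at hcard
  have := hG.card_pos
  omega

end MinTwice

/-- All weakly increasing triples of integers between `0` and `r`. -/
def allTriples (r : ℕ) : Finset (ℕ × ℕ × ℕ) :=
  (Finset.range (r + 1) ×ˢ Finset.range (r + 1) ×ˢ Finset.range (r + 1)).filter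
    fun I => I.1 ≤ I.2.1 ∧ I.2.1 ≤ I.2.2

theorem mem_allTriples {r : ℕ} {I : ℕ × ℕ × ℕ} : I ∈ allTriples r ↔ IsTriple r I := by
  simp only [allTriples, Finset.mem_filter, Finset.mem_product, Finset.mem_range, IsTriple]
  omega

/-- The smallest entries `i` of the triples `i < α < c - i ≤ r`. -/
def medianGroup (r α c : ℕ) : Finset ℕ :=
  (Finset.range α).filter fun i => α + i < c ∧ c ≤ r + i

theorem mem_medianGroup {r α c i : ℕ} : i ∈ medianGroup r α c ↔ i < α ∧ α + i < c ∧ c ≤ r + i := by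
  simp [medianGroup]

theorem medianGroup_nonempty {r α c : ℕ} (h0 : 1 ≤ α) (hr : α < r) (h1 : α + 1 ≤ c)
    (h2 : c + 1 ≤ α + r) : (medianGroup r α c).Nonempty :=
  ⟨c - r, mem_medianGroup.2 ⟨by omega, by omega, by omega⟩⟩

/-- Counts the pairs `i < α < k ≤ r` by their sum; for each `i` there are `r - α` of them. -/
theorem sum_card_medianGroup (r α : ℕ) :
    ∑ c ∈ Finset.Icc (α + 1) (α + r - 1), (medianGroup r α c).card = α * (r - α) := by
  have h := Finset.sum_card_bipartiteAbove_eq_sum_card_bipartiteBelow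
    (s := Finset.Icc (α + 1) (α + r - 1)) (t := Finset.range α)
    (fun c i => α + i < c ∧ c ≤ r + i)
  refine h.trans ((Finset.sum_congr (g := fun _ => r - α) rfl fun i hi => ?_).trans (by simp))
  have hi' := Finset.mem_range.1 hi
  have : (Finset.Icc (α + 1) (α + r - 1)).bipartiteBelow (fun c i => α + i < c ∧ c ≤ r + i) i =
      Finset.Ioc (α + i) (r + i) := by
    ext c
    simp only [Finset.bipartiteBelow, Finset.mem_filter, Finset.mem_Icc, Finset.mem_Ioc]
    omega
  rw [this, Nat.card_Ioc]
  omega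

section

variable {r s α t i k : ℕ}

theorem tripleSum_localRise_of_lt (hi : i < α) (hk : α < k) :
    tripleSum (localRise s α t) (i, α, k) = (α : ℤ) - i + s - t - 1 := by
  simp only [tripleSum, localRise, lt_irrefl, if_false, if_pos hi, if_neg hk.le.not_gt]
  ring

theorem tripleSum_localFall_of_lt (hi : i < α) (hk : α < k) :
    tripleSum (localFall α t) (i, α, k) = (α : ℤ) - k - t := by
  simp only [tripleSum, localFall, lt_irrefl, if_false, if_pos hk, if_neg hi.le.not_gt]
  ring

theorem tripleSum_localRise_self : tripleSum (localRise s α t) (α, α, α) = 0 := by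
  simp [tripleSum, localRise]

theorem tripleSum_localFall_self : tripleSum (localFall α t) (α, α, α) = 0 := by
  simp [tripleSum, localFall]

end

namespace MinimalBlock

variable {r s α : ℕ} {y : ℕ → ℕ × ℕ × ℕ → ℝ} {x z q : ℕ → ℝ} {σ : ℕ → ℤ}

/-- The sum of the outer entries of a triple `i < α < k` with the slope `σ t` on the bridge `t`. -/
def outerSum (r s α : ℕ) (σ : ℕ → ℤ) (t : ℕ) : ℤ := 3 * r + s - α + t - σ t

theorem mem_allTriples_of_mem_medianGroup {c i : ℕ} (hi : i ∈ medianGroup r α c) :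
    (i, α, c - i) ∈ allTriples r := by
  obtain ⟨h1, h2, h3⟩ := mem_medianGroup.1 hi
  exact mem_allTriples.2 ⟨h1.le, by simp only; omega, by simp only; omega⟩

section

variable (h : MinimalBlock (allTriples r) r s α y x z q σ)

include h

/-- A decrease would mean that the common slope jumps by at least two. Then only triples with a
repeated `α` qualify at the loop, and their slopes are too far apart for two of them to do so. -/
theorem outerSum_le_succ {t : ℕ} (ht : t < s) :
    outerSum r s α σ t ≤ outerSum r s α σ (t + 1) := by
  obtain ⟨i, k, i', k', hne, -, -, a1, b1, ⟨h3, h4⟩, h5, h6⟩ :=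
    h.exists_loop (fun I => mem_allTriples.1) ht
  rw [tripleSum_localSlope (by omega) (by omega)] at h3 h4 h5 h6
  rw [Ne, Prod.mk.injEq] at hne
  unfold outerSum
  by_contra! hcon
  split_ifs at h3 h4 h5 h6 <;> omega

theorem outerSum_mono {t t' : ℕ} (htt : t ≤ t') (ht : t' ≤ s) :
    outerSum r s α σ t ≤ outerSum r s α σ t' := by
  induction t', htt using Nat.le_induction with
  | base => exact le_rfl
  | succ n _ ih => exact (ih (by omega)).trans (h.outerSum_le_succ (by omega))

/-- On the first bridge only `(0, α, α)` could have a larger slope than the bound allows, and a tie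
needs two functions. The last bridge is symmetric, with `(α, α, r)`. -/
theorem lt_outerSum_zero : (α : ℤ) + 1 ≤ outerSum r s α σ 0 := by
  obtain ⟨i, k, i', k', hne, -, -, a1, b1, h3, h4⟩ :=
    h.exists_bridge (fun I => mem_allTriples.1) (Nat.zero_le s)
  rw [tripleSum_localSlope (by omega) (by omega)] at h3 h4
  rw [Ne, Prod.mk.injEq] at hne
  unfold outerSum
  split_ifs at h3 h4 <;> omega

theorem outerSum_last_lt : outerSum r s α σ s + 1 ≤ (α : ℤ) + r := by
  obtain ⟨i, k, i', k', hne, -, -, a1, b1, h3, h4⟩ :=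
    h.exists_bridge (fun I => mem_allTriples.1) le_rfl
  rw [tripleSum_localSlope (by omega) (by omega)] at h3 h4
  rw [Ne, Prod.mk.injEq] at hne
  unfold outerSum
  split_ifs at h3 h4 <;> omega

theorem lt_outerSum {t : ℕ} (ht : t ≤ s) : (α : ℤ) + 1 ≤ outerSum r s α σ t :=
  h.lt_outerSum_zero.trans (h.outerSum_mono (Nat.zero_le t) ht)

theorem outerSum_lt {t : ℕ} (ht : t ≤ s) : outerSum r s α σ t + 1 ≤ (α : ℤ) + r := by
  have := h.outerSum_mono ht le_rfl
  have := h.outerSum_last_lt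
  omega

/-- For small `t` the triples `(i, α, α)`, and for large `t` the triples `(α, α, k)`, could have the
common slope. The bounds on `t` exclude both, leaving the strict triples of sum `c` and `(α, α, α)`.
-/
theorem bridge_cases {t c : ℕ} (h1 : α ≤ t + 1) (h2 : t + r ≤ s + α + 1) (hα : α < r)
    (hc : outerSum r s α σ t = c) {I : ℕ × ℕ × ℕ} (hI : AttainsMin (allTriples r) (y t) I) :
    (I = (α, α, α) ∧ 2 * t + c = 2 * α + s) ∨ ∃ i ∈ medianGroup r α c, I = (i, α, c - i) := by
  have ht : t ≤ s := by omega
  obtain ⟨h3, h4⟩ := h.of_bridge t ht I hI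
  have h5 := h.lt_outerSum ht
  have h6 := h.outerSum_lt ht
  obtain ⟨i, j, k⟩ := I
  obtain ⟨a1, a2, a3⟩ := mem_allTriples.1 hI.1
  simp only at h3 a1 a2 a3
  subst h3
  rw [tripleSum_localSlope a1 a2] at h4
  rw [hc] at h5 h6
  unfold outerSum at hc
  rcases a1.lt_or_eq with h7 | rfl <;> rcases a2.lt_or_eq with h8 | rfl
  · rw [if_pos h7, if_pos h8] at h4
    exact Or.inr ⟨i, mem_medianGroup.2 ⟨by omega, by omega, by omega⟩, by
      rw [Prod.mk.injEq, Prod.mk.injEq]; omega⟩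
  · rw [if_pos h7, if_neg (lt_irrefl _)] at h4
    omega
  · rw [if_neg (lt_irrefl _), if_pos h8] at h4
    omega
  · rw [if_neg (lt_irrefl _)] at h4
    exact Or.inl ⟨rfl, by omega⟩

theorem loop_cases {t c : ℕ} (h1 : α ≤ t + 1) (h2 : t + 1 + r ≤ s + α + 1) (hα : α < r)
    (hc : outerSum r s α σ t = c) (hc' : outerSum r s α σ (t + 1) = c) {I : ℕ × ℕ × ℕ}
    (hI : AttainsMin (allTriples r) (fun I => y t I + tripleSum (localSlope r s α t) I * z t +
      q t * tripleSum (localRise s α t) I) I) :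
    (I = (α, α, α) ∧ 2 * t + c ≤ 2 * α + s ∧ 2 * α + s ≤ 2 * t + c + 2) ∨
      ∃ i ∈ medianGroup r α c, I = (i, α, c - i) := by
  have ht : t < s := by omega
  obtain ⟨h3, h4, h4'⟩ := h.of_loop t ht I hI
  have h5 := h.lt_outerSum ht.le
  have h6 := h.outerSum_lt ht.le
  obtain ⟨i, j, k⟩ := I
  obtain ⟨a1, a2, a3⟩ := mem_allTriples.1 hI.1
  simp only at h3 a1 a2 a3
  subst h3
  rw [tripleSum_localSlope a1 a2] at h4 h4'
  rw [hc] at h5 h6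
  unfold outerSum at hc hc'
  rcases a1.lt_or_eq with h7 | rfl <;> rcases a2.lt_or_eq with h8 | rfl
  · rw [if_pos h7, if_pos h8] at h4 h4'
    exact Or.inr ⟨i, mem_medianGroup.2 ⟨by omega, by omega, by omega⟩, by
      rw [Prod.mk.injEq, Prod.mk.injEq]; omega⟩
  · rw [if_pos h7, if_neg (lt_irrefl _)] at h4 h4'
    omega
  · rw [if_neg (lt_irrefl _), if_pos h8] at h4 h4'
    omega
  · rw [if_neg (lt_irrefl _)] at h4 h4'
    exact Or.inl ⟨rfl, by omega, by omega⟩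

/-- For strict triples of sum `c`, the slopes on the bridges and the total changes on the loops
depend on `c` only, so relative values are the same on all bridges of the block. -/
theorem exists_value_eq (c : ℕ) {t : ℕ} (ht : t ≤ s) :
    ∃ b, ∀ i ∈ medianGroup r α c, y t (i, α, c - i) = y 0 (i, α, c - i) + b := by
  induction t with
  | zero => exact ⟨0, fun i _ => by simp⟩
  | succ t ih =>
    obtain ⟨b, hb⟩ := ih (by omega)
    refine ⟨b + ((3 * r - c - α + t + s : ℤ) : ℝ) * z t +
      q t * ((2 * α - c + s - 2 * t - 1 : ℤ) : ℝ) +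
      ((3 * r - c - α + (t + 1) + s : ℤ) : ℝ) * x (t + 1), fun i hi => ?_⟩
    obtain ⟨h1, h2, h3⟩ := mem_medianGroup.1 hi
    rw [h.next t (by omega) _ (mem_allTriples_of_mem_medianGroup hi), hb i hi,
      tripleSum_localSlope (by omega) (by omega), tripleSum_localSlope (by omega) (by omega),
      tripleSum_localRise_of_lt h1 (by omega), tripleSum_localFall_of_lt h1 (by omega), if_pos h1,
      if_pos (by omega), if_pos h1, if_pos (by omega)]
    push_cast [show i ≤ c by omega]
    ring

theorem minTwice_group_bridge {c t : ℕ} (ht : t ≤ s)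
    (hm : MinTwice (medianGroup r α c) fun i => y t (i, α, c - i)) :
    MinTwice (medianGroup r α c) fun i => y 0 (i, α, c - i) - i * (0 : ℝ) := by
  obtain ⟨b, hb⟩ := h.exists_value_eq c ht
  exact hm.of_eq_add_const b fun i hi => by rw [hb i hi]; ring

/-- Up to the middle of the top edge only the smaller outer entry contributes, with `-i * q t`; so a
tie is a breakpoint at `q t`. -/
theorem minTwice_group_loop {c t : ℕ} (ht : t < s)
    (hm : MinTwice (medianGroup r α c) fun i => y t (i, α, c - i) +
      tripleSum (localSlope r s α t) (i, α, c - i) * z t +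
        q t * tripleSum (localRise s α t) (i, α, c - i)) :
    MinTwice (medianGroup r α c) fun i => y 0 (i, α, c - i) - i * q t := by
  obtain ⟨b, hb⟩ := h.exists_value_eq c ht.le
  refine hm.of_eq_add_const (b + ((3 * r - c - α + t + s : ℤ) : ℝ) * z t +
    q t * ((α + s - t - 1 : ℤ) : ℝ)) fun i hi => ?_
  obtain ⟨h1, h2, h3⟩ := mem_medianGroup.1 hi
  rw [hb i hi, tripleSum_localSlope (by omega) (by omega),
    tripleSum_localRise_of_lt h1 (by omega), if_pos h1, if_pos (by omega)]
  push_cast [show i ≤ c by omega]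
  ring

/-- If the function of the triple `(α, α, α)` has the common slope on a bridge, then it does not
interfere with the breakpoints of the group at one of the two adjacent loops. -/
theorem minTwice_group_of_tie {c t : ℕ} (h1 : α ≤ t + 1) (h2 : t + 2 + r ≤ s + α + 1) (hα : α < r)
    (hc0 : outerSum r s α σ t = c) (hc1 : outerSum r s α σ (t + 1) = c)
    (hc2 : outerSum r s α σ (t + 2) = c) (htie : 2 * (t + 1) + c = 2 * α + s) :
    (MinTwice (medianGroup r α c) fun i => y 0 (i, α, c - i) - i * q t) ∨
      MinTwice (medianGroup r α c) fun i => y 0 (i, α, c - i) - i * q (t + 1) := by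
  by_contra! hcon
  obtain ⟨hn1, hn2⟩ := hcon
  have hmem := fun i => mem_allTriples_of_mem_medianGroup (r := r) (α := α) (c := c) (i := i)
  have hK : (α, α, α) ∈ allTriples r := mem_allTriples.2 ⟨le_rfl, le_rfl, hα.le⟩
  obtain ⟨⟨i, hi, ei⟩, fi⟩ := ((h.minTwice_loop t (by omega)).comp_or hmem (α, α, α) fun I hI =>
    (h.loop_cases h1 (by omega) hα hc0 hc1 hI).imp_left And.left).resolve_left
      fun hm => hn1 (h.minTwice_group_loop (by omega) hm)
  obtain ⟨⟨j, hj, ej⟩, fj⟩ := ((h.minTwice_loop (t + 1) (by omega)).comp_or hmem (α, α, α) fun I hI =>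
    (h.loop_cases (by omega) (by omega) hα hc1 hc2 hI).imp_left And.left).resolve_left
      fun hm => hn2 (h.minTwice_group_loop (by omega) hm)
  have hval : ∀ i ∈ medianGroup r α c,
      (y t (i, α, c - i) + tripleSum (localSlope r s α t) (i, α, c - i) * z t +
        q t * tripleSum (localRise s α t) (i, α, c - i)) -
      (y t (α, α, α) + tripleSum (localSlope r s α t) (α, α, α) * z t +
        q t * tripleSum (localRise s α t) (α, α, α)) =
      y (t + 1) (i, α, c - i) - y (t + 1) (α, α, α) + q t * (α + s - t - 2 - i) := by
    intro i hi
    obtain ⟨g1, g2, g3⟩ := mem_medianGroup.1 hi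
    rw [h.next t (by omega) _ (hmem i hi), h.next t (by omega) _ hK,
      tripleSum_localFall_of_lt g1 (by omega), tripleSum_localFall_self,
      tripleSum_localSlope (t := t + 1) (by omega) (by omega),
      tripleSum_localSlope (t := t + 1) le_rfl le_rfl, if_pos g1, if_pos (by omega),
      if_neg (lt_irrefl _), if_neg (lt_irrefl _)]
    have htie' : (2 : ℝ) * (t + 1) + c = 2 * α + s := by exact_mod_cast htie
    -- The tie makes `(α, α, α)` parallel to the group on the bridge `t + 1`, and turns the fall
    -- after the loop `t` and the rise at the loop `t + 1` into the same coefficient.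
    have hcr : (c : ℝ) = 2 * α + s - 2 * (t + 1) := by linarith
    push_cast [show i ≤ c by omega]
    rw [hcr]
    ring
  have hval' : ∀ i ∈ medianGroup r α c,
      (y (t + 1) (i, α, c - i) + tripleSum (localSlope r s α (t + 1)) (i, α, c - i) * z (t + 1) +
        q (t + 1) * tripleSum (localRise s α (t + 1)) (i, α, c - i)) -
      (y (t + 1) (α, α, α) + tripleSum (localSlope r s α (t + 1)) (α, α, α) * z (t + 1) +
        q (t + 1) * tripleSum (localRise s α (t + 1)) (α, α, α)) =
      y (t + 1) (i, α, c - i) - y (t + 1) (α, α, α) + q (t + 1) * (α + s - t - 2 - i) := by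
    intro i hi
    obtain ⟨g1, g2, g3⟩ := mem_medianGroup.1 hi
    rw [tripleSum_localRise_of_lt g1 (by omega), tripleSum_localRise_self,
      tripleSum_localSlope (by omega) (by omega), tripleSum_localSlope le_rfl le_rfl, if_pos g1,
      if_pos (by omega), if_neg (lt_irrefl _), if_neg (lt_irrefl _)]
    have htie' : (2 : ℝ) * (t + 1) + c = 2 * α + s := by exact_mod_cast htie
    have hcr : (c : ℝ) = 2 * α + s - 2 * (t + 1) := by linarith
    push_cast [show i ≤ c by omega]
    rw [hcr]
    ring
  have hpos : ∀ i ∈ medianGroup r α c, (0 : ℝ) < α + s - t - 2 - i := by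
    intro i hi
    obtain ⟨g1, g2, g3⟩ := mem_medianGroup.1 hi
    have : ((t + 2 + i : ℕ) : ℝ) < ((α + s : ℕ) : ℝ) := by exact_mod_cast (by omega)
    push_cast at this
    linarith
  have v1 := hval i hi
  have v2 := hval j hj
  have v3 := hval' i hi
  have v4 := hval' j hj
  have p1 := hpos i hi
  have p2 := hpos j hj
  have w1 := fi j hj
  have w2 := fj i hi
  -- At both loops `(α, α, α)` equals the minimum of the group, which relative to it is the minimum
  -- of `b i + q * a i` with all `a i > 0`. That minimum is strictly increasing in `q`, and the two
  -- values of `q` differ.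
  rcases lt_trichotomy (q t) (q (t + 1)) with hq | hq | hq
  · have := mul_lt_mul_of_pos_right hq p2
    linarith
  · have := h.inj t (by omega) (t + 1) (by omega) hq
    omega
  · have := mul_lt_mul_of_pos_right hq p1
    linarith

end

end MinimalBlock

namespace MinimalBlock

variable {r s α : ℕ} {y : ℕ → ℕ × ℕ × ℕ → ℝ} {x z q : ℕ → ℝ} {σ : ℕ → ℤ}

/-- The bridges in the middle of the block on which the outer entries have sum `c`. -/
def fiber (r s α : ℕ) (σ : ℕ → ℤ) (c : ℕ) : Finset ℕ :=
  (Finset.Icc (α - 1) (s + α + 1 - r)).filter fun t => outerSum r s α σ t = c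

/-- The triple `(α, α, α)` interferes with the breakpoints of the group with sum `c`. -/
def Contaminated (r s α : ℕ) (σ : ℕ → ℤ) (c : ℕ) : Prop :=
  ∃ t ∈ fiber r s α σ c, 2 * t + c = 2 * α + s ∨
    (t + 1 ∈ fiber r s α σ c ∧ 2 * t + c + 1 = 2 * α + s)

theorem mem_fiber {c t : ℕ} : t ∈ fiber r s α σ c ↔
    (α ≤ t + 1 ∧ t ≤ s + α + 1 - r) ∧ outerSum r s α σ t = c := by
  simp [fiber]

section

variable (h : MinimalBlock (allTriples r) r s α y x z q σ)

include h

/-- The number of bridges with a given sum is bounded by the number of breakpoints of the group. -/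
theorem card_fiber_add_two_le {c : ℕ} (hs : r ≤ s + 1) (h0 : 1 ≤ α) (hα : α < r) {t₀ : ℕ}
    (ht₀ : t₀ ∈ fiber r s α σ c)
    (hbr : MinTwice (medianGroup r α c) fun i => y t₀ (i, α, c - i)) (L : Finset ℕ)
    (hL : ∀ t ∈ L, t < s ∧ MinTwice (medianGroup r α c) fun i => y 0 (i, α, c - i) - i * q t) :
    L.card + 2 ≤ (medianGroup r α c).card := by
  classical
  obtain ⟨⟨h1, h2⟩, h3⟩ := mem_fiber.1 ht₀
  have h4 := h.lt_outerSum (show t₀ ≤ s by omega)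
  have h5 := h.outerSum_lt (show t₀ ≤ s by omega)
  have hne : (medianGroup r α c).Nonempty :=
    medianGroup_nonempty h0 hα (by omega) (by omega)
  -- The bridge gives the breakpoint `0`, and each loop a further positive one.
  have hM := card_breakpoints_lt hne (fun i => y 0 (i, α, c - i)) (insert 0 (L.image q)) ?_
  · rwa [Finset.card_insert_of_notMem, Finset.card_image_of_injOn] at hM
    · exact fun a ha b hb hab => h.inj a (hL a ha).1 b (hL b hb).1 hab
    · intro hmem
      obtain ⟨t, ht, hq⟩ := Finset.mem_image.1 hmem
      exact (h.pos t (hL t ht).1).ne' hq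
  · intro m hm
    rcases Finset.mem_insert.1 hm with rfl | hm
    · exact h.minTwice_group_bridge (show t₀ ≤ s by omega) hbr
    · obtain ⟨t, ht, rfl⟩ := Finset.mem_image.1 hm
      exact (hL t ht).2

-- By monotonicity the `N` bridges of a fiber are consecutive, with `N - 1` loops between them.
-- Together with one bridge they give `N` breakpoints of the group, hence `N + 1` at most its size.
-- Interference by `(α, α, α)` spoils at most one of them.
open Classical in
theorem card_fiber_le {c : ℕ} (hs : r ≤ s + 1) (h0 : 1 ≤ α) (hα : α < r) (hc1 : α + 1 ≤ c)
    (hc2 : c + 1 ≤ α + r) : (fiber r s α σ c).card + 1 ≤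
      (medianGroup r α c).card + if Contaminated r s α σ c then 1 else 0 := by
  have hG := (medianGroup_nonempty h0 hα hc1 hc2).card_pos
  rcases (fiber r s α σ c).eq_empty_or_nonempty with hemp | hne
  · rw [hemp, Finset.card_empty]; omega
  have hmem := fun i => mem_allTriples_of_mem_medianGroup (r := r) (α := α) (c := c) (i := i)
  have hmax := Finset.max'_mem _ hne
  set b := (fiber r s α σ c).max' hne with hb
  set F := (fiber r s α σ c).erase b with hF
  have hcard : F.card + 1 = (fiber r s α σ c).card := Finset.card_erase_add_one hmax
  have hsucc : ∀ t ∈ F, t ∈ fiber r s α σ c ∧ t + 1 ∈ fiber r s α σ c := by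
    intro t ht
    obtain ⟨h1, h2⟩ := Finset.mem_erase.1 ht
    have h3 := Finset.le_max' _ _ h2
    rw [← hb] at h3
    obtain ⟨⟨a1, a2⟩, a3⟩ := mem_fiber.1 h2
    obtain ⟨⟨b1, b2⟩, b3⟩ := mem_fiber.1 hmax
    have e1 := h.outerSum_mono (show t ≤ t + 1 by omega) (show t + 1 ≤ s by omega)
    have e2 := h.outerSum_mono (show t + 1 ≤ b by omega) (show b ≤ s by omega)
    exact ⟨h2, mem_fiber.2 ⟨⟨by omega, by omega⟩, by omega⟩⟩
  have hbridge : ∀ t ∈ fiber r s α σ c, 2 * t + c ≠ 2 * α + s →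
      MinTwice (medianGroup r α c) fun i => y t (i, α, c - i) := by
    intro t ht htc
    obtain ⟨⟨a1, a2⟩, a3⟩ := mem_fiber.1 ht
    exact (h.minTwice_bridge t (by omega)).comp hmem fun I hI =>
      (h.bridge_cases a1 (by omega) hα a3 hI).resolve_left fun hk => htc hk.2
  have hloop : ∀ t ∈ F, ¬(2 * t + c ≤ 2 * α + s ∧ 2 * α + s ≤ 2 * t + c + 2) →
      MinTwice (medianGroup r α c) fun i => y 0 (i, α, c - i) - i * q t := by
    intro t ht htc
    obtain ⟨⟨a1, a2⟩, a3⟩ := mem_fiber.1 (hsucc t ht).1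
    obtain ⟨⟨b1, b2⟩, b3⟩ := mem_fiber.1 (hsucc t ht).2
    exact h.minTwice_group_loop (by omega) ((h.minTwice_loop t (by omega)).comp hmem fun I hI =>
      (h.loop_cases a1 (by omega) hα a3 b3 hI).resolve_left fun hk => htc hk.2)
  have hFs : ∀ t ∈ F, t < s := by
    intro t ht
    obtain ⟨⟨b1, b2⟩, b3⟩ := mem_fiber.1 (hsucc t ht).2
    omega
  by_cases hcon : Contaminated r s α σ c
  swap
  · rw [if_neg hcon]
    have hclean : ∀ t ∈ fiber r s α σ c, 2 * t + c ≠ 2 * α + s :=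
      fun t ht htc => hcon ⟨t, ht, Or.inl htc⟩
    have := h.card_fiber_add_two_le hs h0 hα hmax (hbridge _ hmax (hclean _ hmax)) F
      fun t ht => ⟨hFs t ht, hloop t ht fun htc => ?_⟩
    · omega
    · obtain ⟨h1, h2⟩ := hsucc t ht
      have h3 := hclean _ h1
      have h4 := hclean _ h2
      exact hcon ⟨t, h1, Or.inr ⟨h2, by omega⟩⟩
  rw [if_pos hcon]
  by_cases hone : (fiber r s α σ c).card ≤ 1
  · omega
  -- a bridge without interference, and a loop away from which there is no interference
  suffices hsuff : (∃ t₀ ∈ fiber r s α σ c, 2 * t₀ + c ≠ 2 * α + s) ∧ ∃ u, ∀ t ∈ F, t ≠ u →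
      MinTwice (medianGroup r α c) fun i => y 0 (i, α, c - i) - i * q t by
    obtain ⟨⟨t₀, ht₀, hc₀⟩, u, hu⟩ := hsuff
    have h1 := h.card_fiber_add_two_le hs h0 hα ht₀ (hbridge _ ht₀ hc₀) (F.erase u)
      fun t ht => ⟨hFs t (Finset.mem_of_mem_erase ht),
        hu t (Finset.mem_of_mem_erase ht) (Finset.ne_of_mem_erase ht)⟩
    have h2 := Finset.pred_card_le_card_erase (s := F) (a := u)
    omega
  refine ⟨?_, ?_⟩
  · obtain ⟨t₁, ht₁, t₂, ht₂, hne'⟩ := Finset.one_lt_card.1 (not_le.1 hone)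
    by_cases htc : 2 * t₁ + c = 2 * α + s
    · exact ⟨t₂, ht₂, by omega⟩
    · exact ⟨t₁, ht₁, htc⟩
  -- A crossing inside a loop affects that loop only. A tie on the bridge `t` may affect the loops
  -- `t - 1` and `t`; if both are in `F`, `minTwice_group_of_tie` keeps one of them usable.
  · obtain ⟨t, ht, htc | ⟨ht', htc⟩⟩ := hcon
    swap
    · exact ⟨t, fun t' h1 h2 => hloop t' h1 (by omega)⟩
    rcases Nat.eq_zero_or_pos t with ht0 | ht0
    · exact ⟨t, fun t' h1 h2 => hloop t' h1 (by omega)⟩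
    by_cases h1 : t - 1 ∈ F
    swap
    · exact ⟨t, fun t' h2 h3 => hloop t' h2 fun h4 => h1 (by rwa [show t - 1 = t' by omega])⟩
    by_cases h2 : t ∈ F
    swap
    · exact ⟨t - 1, fun t' h3 h4 => hloop t' h3 fun h5 => h2 (by rwa [show t = t' by omega])⟩
    obtain ⟨u, rfl⟩ := Nat.exists_eq_add_of_le' ht0
    rw [Nat.add_sub_cancel] at h1
    obtain ⟨⟨a1, a2⟩, a3⟩ := mem_fiber.1 (hsucc _ h1).1
    obtain ⟨⟨b1, b2⟩, b3⟩ := mem_fiber.1 (hsucc _ h2).1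
    obtain ⟨⟨c1, c2⟩, c3⟩ := mem_fiber.1 (hsucc _ h2).2
    rcases h.minTwice_group_of_tie a1 (by omega) hα a3 b3 c3 htc with h3 | h3
    · refine ⟨u + 1, fun t' h4 h5 => ?_⟩
      by_cases h6 : t' = u
      · rw [h6]; exact h3
      · exact hloop t' h4 (by omega)
    · refine ⟨u, fun t' h4 h5 => ?_⟩
      by_cases h6 : t' = u + 1
      · rw [h6]; exact h3
      · exact hloop t' h4 (by omega)

/-- For a larger sum the bridge is further to the right, so `2 * t + c` differs by at least three,
while interference fixes it up to one. -/
theorem contaminated_unique {c c' : ℕ} (hs : r ≤ s + 1) (hα : α < r) (hc : Contaminated r s α σ c)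
    (hc' : Contaminated r s α σ c') : c ≤ c' := by
  by_contra! hlt
  obtain ⟨t, ht, htc⟩ := hc
  obtain ⟨t', ht', htc'⟩ := hc'
  obtain ⟨⟨a1, a2⟩, a3⟩ := mem_fiber.1 ht
  obtain ⟨⟨b1, b2⟩, b3⟩ := mem_fiber.1 ht'
  rcases le_or_gt t t' with hle | hgt
  · have := h.outerSum_mono hle (by omega)
    omega
  · omega

/-- Sum `card_fiber_le` over the `r - 1` possible values of `c`. There are `s + 3 - r` middle
bridges, so the left side is `s + 2`; the right side is at most `α * (r - α) + 1`. -/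
theorem lt_mul_of_allTriples (hr : 3 ≤ r) (hs : r ≤ s + 1) (h0 : 1 ≤ α) (hα : α < r) :
    s < α * (r - α) := by
  classical
  have hmaps : ∀ t ∈ Finset.Icc (α - 1) (s + α + 1 - r),
      (outerSum r s α σ t).toNat ∈ Finset.Icc (α + 1) (α + r - 1) := by
    intro t ht
    have ht' := Finset.mem_Icc.1 ht
    have h1 := h.lt_outerSum (show t ≤ s by omega)
    have h2 := h.outerSum_lt (show t ≤ s by omega)
    rw [Finset.mem_Icc]
    omega
  have hfib := Finset.card_eq_sum_card_fiberwise hmaps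
  have hfib' : ∀ c ∈ Finset.Icc (α + 1) (α + r - 1),
      ((Finset.Icc (α - 1) (s + α + 1 - r)).filter fun t => (outerSum r s α σ t).toNat = c).card =
        (fiber r s α σ c).card := by
    intro c hc
    have hc' := Finset.mem_Icc.1 hc
    rw [fiber]
    congr 1
    refine Finset.filter_congr fun t _ => ?_
    omega
  rw [Finset.sum_congr rfl hfib'] at hfib
  have hle : ∑ c ∈ Finset.Icc (α + 1) (α + r - 1), ((fiber r s α σ c).card + 1) ≤
      ∑ c ∈ Finset.Icc (α + 1) (α + r - 1), ((medianGroup r α c).card +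
        if Contaminated r s α σ c then 1 else 0) := by
    refine Finset.sum_le_sum fun c hc => ?_
    have hc' := Finset.mem_Icc.1 hc
    exact h.card_fiber_le hs h0 hα hc'.1 (by omega)
  have hone : ∑ c ∈ Finset.Icc (α + 1) (α + r - 1),
      (if Contaminated r s α σ c then 1 else 0) ≤ 1 := by
    rw [← Finset.card_filter]
    refine Finset.card_le_one.2 fun c hc c' hc' => ?_
    exact le_antisymm
      (h.contaminated_unique hs hα (Finset.mem_filter.1 hc).2 (Finset.mem_filter.1 hc').2)
      (h.contaminated_unique hs hα (Finset.mem_filter.1 hc').2 (Finset.mem_filter.1 hc).2)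
  rw [Finset.sum_add_distrib, Finset.sum_add_distrib, ← hfib, sum_card_medianGroup,
    Finset.sum_const, Nat.card_Icc, Nat.card_Icc, smul_eq_mul, mul_one] at hle
  omega

end

end MinimalBlock

theorem not_minimalBlock_allTriples {r s α : ℕ} (hr : 3 ≤ r) (hrs : r ^ 2 ≤ 4 * s) (hα : α ≤ r)
    {y : ℕ → ℕ × ℕ × ℕ → ℝ} {x z q : ℕ → ℝ} {σ : ℕ → ℤ} :
    ¬MinimalBlock (allTriples r) r s α y x z q σ := by
  intro h
  have h0 := h.ne_zero fun I => mem_allTriples.1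
  have h1 := h.ne_last fun I => mem_allTriples.1
  -- From `(r - 2) ^ 2 ≥ 0` one gets `4 * (r - 1) ≤ r ^ 2 ≤ 4 * s`.
  have hs : r ≤ s + 1 := by nlinarith [sq_nonneg ((r : ℤ) - 2)]
  have h2 := h.lt_mul_of_allTriples hr hs (by omega) (by omega)
  obtain ⟨d, rfl⟩ := Nat.exists_eq_add_of_le hα
  rw [Nat.add_sub_cancel_left] at h2
  zify at *
  nlinarith [sq_nonneg ((α : ℤ) - d)]

/-! ### Reduction to blocks, cardinalities and conclusion -/

namespace ChainOfLoops

open MetricGraph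

theorem tropicalMaximalRank_of_not_minimalBlock {r s ρ : ℕ} (hr : 3 ≤ r) (hs : 1 ≤ s)
    {T : Finset (ℕ × ℕ × ℕ)} (hT : ∀ I ∈ T, IsTriple r I)
    (hsep : ∀ I ∈ T, I.1 + I.2.2 ≤ I.2.1 + s + 1 ∨ I.2.1 = r)
    (hblock : ∀ α ≤ r, ∀ y x z q σ, ¬MinimalBlock T r s α y x z q σ)
    (hcard : (T.card : ℤ) =
      min ((r + 3).choose 3 : ℤ) (3 * degreeOf r s ρ - genusOf r s ρ + 1)) :
    TropicalMaximalRank r s ρ 3 := by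
  refine ⟨admissibleConst r s, fun Γ hΓ => ?_⟩
  have hP := slopePath_blockSlope (ρ := ρ) hr hs
  have hΓ' := hΓ.shortBottoms
  obtain ⟨ψ, hψ, hdep⟩ := exists_tripleFunctions hP hΓ'
  refine ⟨baseDivisor Γ r s (blockSpecial r s), deg_baseDivisor, hasRank_baseDivisor hP hΓ',
    vertexAvoiding_baseDivisor hP hΓ', fun i => endDivisor Γ r (blockSlope r s) (blockSpecial r s) i,
    ψ, isEndDivisor_endDivisor hP hΓ', hψ, T.image (tripleSym r), ?_, fun hcon => ?_⟩
  · rw [Finset.card_image_of_injOn, hcard]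
    · rfl
    · exact (tripleSym_injOn r).mono fun I hI => hT I hI
  · obtain ⟨w, hw⟩ := hdep T hT hcon
    obtain ⟨α, hα, y, x, z, q, σ, hb⟩ := exists_minimalBlock hs hΓ hT hsep hw
    exact hblock α hα y x z q σ hb

end ChainOfLoops

theorem six_mul_choose_three (r : ℕ) : 6 * (r + 3).choose 3 = (r + 3) * (r + 2) * (r + 1) := by
  have := Nat.descFactorial_eq_factorial_mul_choose (r + 3) 3
  simp [Nat.descFactorial, Nat.factorial] at this
  linarith

theorem card_allTriples (r : ℕ) : (allTriples r).card = (r + 3).choose 3 := by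
  have h1 : (allTriples r).image (tripleSym r) = Finset.univ := by
    ext I
    obtain ⟨J, hJ, rfl⟩ := exists_tripleSym_eq r I
    simpa using ⟨_, _, _, mem_allTriples.2 hJ, rfl⟩
  rw [← Finset.card_image_of_injOn ((tripleSym_injOn r).mono fun I hI => mem_allTriples.1 hI), h1,
    Finset.card_univ, Sym.card_sym_eq_choose, Fintype.card_fin]
  rfl

theorem theorem1p3 (r s ρ : ℕ) (hr : 3 ≤ r) (hs : 1 ≤ s) :
    ((r : ℝ) ^ 2 / 4 ≤ s → InjectiveRange r s ρ 3 ∧ TropicalMaximalRank r s ρ 3) ∧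
    (ρ = 0 → s + 1 ≤ r → SurjectiveRange r s ρ 3 ∧ TropicalMaximalRank r s ρ 3) := by
  have hchoose := six_mul_choose_three r
  constructor
  · intro h
    have hrs : r ^ 2 ≤ 4 * s := by
      have : (r : ℝ) ^ 2 ≤ 4 * s := by linarith
      exact_mod_cast this
    have hinj : InjectiveRange r s ρ 3 := by
      unfold InjectiveRange degreeOf genusOf
      zify at *
      -- Twelve times the difference of the two sides of the inequality is three times this product
      -- plus the product in `h2` plus `24 * ρ`.
      have h1 : (0 : ℤ) ≤ (2 * r - 1) * (4 * s - r ^ 2) :=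
        mul_nonneg (by linarith) (by linarith)
      have h2 : (0 : ℤ) ≤ r * ((r - 2) * (4 * r - 7)) :=
        mul_nonneg (by linarith) (mul_nonneg (by linarith) (by linarith))
      have h3 : (0 : ℤ) ≤ ρ := Int.natCast_nonneg ρ
      linarith
    refine ⟨hinj, ChainOfLoops.tropicalMaximalRank_of_not_minimalBlock hr hs
      (T := allTriples r) (fun I => mem_allTriples.1) (fun I hI => ?_)
      (fun α hα _ _ _ _ _ => not_minimalBlock_allTriples hr hrs hα) ?_⟩
    · obtain ⟨h1, h2, h3⟩ := mem_allTriples.1 hI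
      have : r ≤ s + 1 := by nlinarith [sq_nonneg ((r : ℤ) - 2)]
      omega
    · rw [card_allTriples, min_eq_left]
      exact_mod_cast hinj
  · rintro rfl h
    have hN : ((s + 2 + (r - 1) * (2 * s + 2) + (r + 1) : ℕ) : ℤ) =
        3 * degreeOf r s 0 - genusOf r s 0 + 1 := by
      obtain ⟨r, rfl⟩ := Nat.exists_eq_add_of_le' (show 1 ≤ r by omega)
      simp only [degreeOf, genusOf, Nat.add_sub_cancel]
      push_cast
      ring
    have hcard := card_surjectiveTriples hr h
    -- The surjective inequality comes for free: the chosen set has the expected size and lies in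
    -- the set of all triples.
    have hle : (surjectiveTriples r s).card ≤ (allTriples r).card :=
      Finset.card_le_card fun I hI => mem_allTriples.2 (isTriple_of_mem_surjectiveTriples hr h I hI)
    rw [card_allTriples, hcard] at hle
    have hsurj : SurjectiveRange r s 0 3 := by
      unfold SurjectiveRange
      push_cast
      rw [← hN]
      exact_mod_cast hle
    refine ⟨hsurj, ChainOfLoops.tropicalMaximalRank_of_not_minimalBlock hr hs
      (isTriple_of_mem_surjectiveTriples hr h) (fun ⟨i, j, k⟩ hI => ?_)
      (fun α hα _ _ _ _ _ => not_minimalBlock_surjectiveTriples hr h hα) ?_⟩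
    · obtain ⟨h1, h2, h3, h4⟩ := surjectiveTriples_cases hr h hI
      simp only
      omega
    · rw [hcard, hN, min_eq_right]
      exact_mod_cast hsurj
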